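/- **Setting.** Let $(\zeta_i)_{i\in\mathbb Z}$ be i.i.d. random elements, $\mathcal F_i=(\dots,\zeta_{i-1},\zeta_i)$, and let $G(t,\cdot)$, $t\in[0,1]$, be measurable filters with $\|G(t,\mathcal F_i)-G(s,\mathcal F_i)\|_4\le C|t-s|$ for all $s,t\in[0,1]$ and $\sup_{t\in[0,1]}\|G(t,\mathcal F_i)\|_8<\infty$, where $\|V\|_p=(\mathbb E|V|^p)^{1/p}$ and $\|\cdot\|=\|\cdot\|_2$. Put $\gamma_k(t)=\mathrm{Cov}(G(t,\mathcal F_k),G(t,\mathcal F_0))$, $\beta_k(t)=2\gamma_0(t)-2\gamma_k(t)$ and $$H_k(t,\mathcal F_i)=\bigl(G(t,\mathcal F_i)-G(t,\mathcal F_{i-k})\bigr)^2-\beta_k(t).$$ Fix integers $1\le k<h$, let $\widetilde H_k=(H_h,H_k)^\top$ and $$\Sigma_k^2(t)=\sum_{j=-\infty}^{\infty}\mathrm{Cov}\bigl(\widetilde H_k(t,\mathcal F_0),\widetilde H_k(t,\mathcal F_j)\bigr).$$ For $j\ge0$ let $\delta_4(\widetilde H_k,j)=\sup_{t\in[0,1]}\|\widetilde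 H_k(t,\mathcal F_j)-\widetilde H_k(t,\mathcal F_j')\|_4$, where $\mathcal F_j'$ is $\mathcal F_j$ with $\zeta_0$ replaced by an independent copy $\zeta_0'$. **Estimator.** For $1\le i\le n$ let $t_i=i/n$ and $\tilde\varepsilon_i=(\varepsilon_i^h,\varepsilon_i^k)^\top$ with $\varepsilon_i^l=H_l(t_i,\mathcal F_{i+l})$ for $l\in\{h,k\}$; set $\tilde\varepsilon_i=0$ for $i\notin\{1,\dots,n\}$. Let $Q_i=\sum_{j=-m}^m\tilde\varepsilon_{i+j}$, $N_i=Q_iQ_i^\top/(2m+1)$ and $$\widetilde\Sigma_k^2(t)=\sum_{i=1}^n\frac{K((t_i-t)/\tau)}{\sum_{l=1}^nK((t_l-t)/\tau)}\,N_i,$$ where $K$ is a symmetric probability density of bounded variation that vanishes outside $[-1,1]$. **Theorem.** Assume that $\Sigma_k^2\in\mathcal C^2[0,1]$, that $\delta_4(\widetilde H_k,j)=\mathcal O(\{j\log j\}^{-2})$ as $j\to\infty$, and that $m=m_n\to\infty$, $m=\mathcal O(n^{1/3})$, $\tau=\tau_n\to0$ and $n\tau\to\infty$. Then the series defining $\Sigma_k^2(t)$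 converges absolutely for every $t\in[0,1]$ and, with $|\cdot|$ the Frobenius norm, as $n\to\infty$: (i) for each fixed $t\in(0,1)$, $$\bigl\|\,|\widetilde\Sigma_k^2(t)-\Sigma_k^2(t)|\,\bigr\|=\mathcal O\Bigl(\sqrt{\tfrac{m}{n\tau}}+\tfrac1m+\tau^2\Bigr);$$ (ii) for $\mathcal I=[\tau,1-\tau]$, $$\Bigl\|\sup_{t\in\mathcal I}\bigl|\widetilde\Sigma_k^2(t)-\Sigma_k^2(t)\bigr|\Bigr\|=\mathcal O\Bigl(\sqrt{\tfrac{m}{n\tau^2}}+\tfrac1m+\tau^2\Bigr).$$ -/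

import Mathlib

open MeasureTheory ProbabilityTheory Filter Asymptotics
open scoped ENNReal NNReal

namespace LocStat

noncomputable section

/-- The information set `F_i = (…, ζ_{i-1}, ζ_i)`, stored as `l ↦ ζ_{i-l}`. -/
def past {Ω E : Type*} (ζ : ℤ → Ω → E) (i : ℤ) (ω : Ω) : ℕ → E :=
  fun l => ζ (i - l) ω

/-- `F_i'`: the information set `F_i` with `ζ_0` replaced by an independent copy `ζ_0'`.
The copy is realised on the second factor of `Ω × Ω` (with the product measure). -/
def coupledPast {Ω E : Type*} (ζ : ℤ → Ω → E) (i : ℤ) (p : Ω × Ω) : ℕ → E :=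
  fun l => if i - l = 0 then ζ 0 p.2 else ζ (i - l) p.1

/-- The physical dependence measure
`δ_q(L, j) = sup_{t ∈ [0,1]} ‖L(t, F_j) - L(t, F_j')‖_q`, with values in `[0, ∞]`. -/
def physDep {Ω E V : Type*} [MeasurableSpace Ω] [NormedAddCommGroup V]
    (P : Measure Ω) (ζ : ℤ → Ω → E) (q : ℝ≥0∞) (L : ℝ → (ℕ → E) → V) (j : ℕ) : ℝ≥0∞ :=
  ⨆ t ∈ Set.Icc (0 : ℝ) 1,
    eLpNorm (fun p : Ω × Ω => L t (past ζ j p.1) - L t (coupledPast ζ j p)) q (P.prod P)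

/-- `ζ` is a sequence of i.i.d. random elements indexed by `ℤ`. -/
structure IsIID {Ω E : Type*} [MeasurableSpace Ω] [MeasurableSpace E]
    (P : Measure Ω) (ζ : ℤ → Ω → E) : Prop where
  measurable : ∀ i, Measurable (ζ i)
  indep : iIndepFun ζ P
  identDistrib : ∀ i, IdentDistrib (ζ i) (ζ 0) P P

/-- Stochastic Lipschitz continuity of the filter `G` in `L⁴`, together with uniformly bounded
eighth moments. -/
structure IsStochLipschitz {Ω E : Type*} [MeasurableSpace Ω]
    (P : Measure Ω) (ζ : ℤ → Ω → E) (G : ℝ → (ℕ → E) → ℝ) : Prop where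
  lipschitz : ∃ C : ℝ, ∀ i : ℤ, ∀ t ∈ Set.Icc (0 : ℝ) 1, ∀ s ∈ Set.Icc (0 : ℝ) 1,
    eLpNorm (fun ω => G t (past ζ i ω) - G s (past ζ i ω)) 4 P ≤ ENNReal.ofReal (C * |t - s|)
  moment : ∃ M : ℝ, ∀ i : ℤ, ∀ t ∈ Set.Icc (0 : ℝ) 1,
    eLpNorm (fun ω => G t (past ζ i ω)) 8 P ≤ ENNReal.ofReal M

/-- The autocovariance `γ_k(t)` at lag `k` of the stationary process `(G(t, F_i))_i`. -/
def autocov {Ω E : Type*} [MeasurableSpace Ω]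
    (P : Measure Ω) (ζ : ℤ → Ω → E) (G : ℝ → (ℕ → E) → ℝ) (k : ℕ) (t : ℝ) : ℝ :=
  cov[fun ω => G t (past ζ k ω), fun ω => G t (past ζ 0 ω); P]

/-- The trend `β_k(t) = 2 γ_0(t) - 2 γ_k(t)` of the squared lag-`k` differences. -/
def trend {Ω E : Type*} [MeasurableSpace Ω]
    (P : Measure Ω) (ζ : ℤ → Ω → E) (G : ℝ → (ℕ → E) → ℝ) (k : ℕ) (t : ℝ) : ℝ :=
  2 * autocov P ζ G 0 t - 2 * autocov P ζ G k t

/-- The error filter `H_k(t, F_i) = (G(t, F_i) - G(t, F_{i-k}))² - β_k(t)`; note that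
`F_{i-k}` is the shift of `F_i` by `k`. -/
def errFilter {Ω E : Type*} [MeasurableSpace Ω]
    (P : Measure Ω) (ζ : ℤ → Ω → E) (G : ℝ → (ℕ → E) → ℝ) (k : ℕ) (t : ℝ) (F : ℕ → E) : ℝ :=
  (G t F - G t (fun l => F (l + k))) ^ 2 - trend P ζ G k t

/-- The bivariate filter `(H_h, H_k)`. -/
def errFilter₂ {Ω E : Type*} [MeasurableSpace Ω]
    (P : Measure Ω) (ζ : ℤ → Ω → E) (G : ℝ → (ℕ → E) → ℝ) (h k : ℕ) (t : ℝ) (F : ℕ → E) :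
    EuclideanSpace ℝ (Fin 2) :=
  !₂[errFilter P ζ G h t F, errFilter P ζ G k t F]

/-- The cross-covariance at lag `j` of the components `a`, `b` of the stationary process
`((H_h, H_k)(t, F_i))_i`. -/
def crossCov {Ω E : Type*} [MeasurableSpace Ω]
    (P : Measure Ω) (ζ : ℤ → Ω → E) (G : ℝ → (ℕ → E) → ℝ) (h k : ℕ) (t : ℝ) (a b : Fin 2)
    (j : ℤ) : ℝ :=
  cov[fun ω => errFilter₂ P ζ G h k t (past ζ 0 ω) a,
    fun ω => errFilter₂ P ζ G h k t (past ζ j ω) b; P]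

/-- The long-run covariance matrix
`Σ_k²(t) = ∑_{j ∈ ℤ} Cov((H_h, H_k)(t, F_0), (H_h, H_k)(t, F_j))`. -/
def longRunCov {Ω E : Type*} [MeasurableSpace Ω]
    (P : Measure Ω) (ζ : ℤ → Ω → E) (G : ℝ → (ℕ → E) → ℝ) (h k : ℕ) (t : ℝ) :
    Matrix (Fin 2) (Fin 2) ℝ :=
  Matrix.of fun a b => ∑' j : ℤ, crossCov P ζ G h k t a b j

/-- The errors `(ε_i^h, ε_i^k)`, `i = 1, …, n`, of the squared difference series, where
`ε_i^k = H_k(i/n, F_{i+k})` belongs to the difference of the observations `i + k` and `i`.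
There are no errors with an index outside `1, …, n`, which is encoded by the value `0`. -/
def err {Ω E : Type*} [MeasurableSpace Ω]
    (P : Measure Ω) (ζ : ℤ → Ω → E) (G : ℝ → (ℕ → E) → ℝ) (h k n : ℕ) (i : ℤ) (ω : Ω) :
    Fin 2 → ℝ :=
  if 1 ≤ i ∧ i ≤ n then
    ![errFilter P ζ G h ((i : ℝ) / n) (past ζ (i + h) ω),
      errFilter P ζ G k ((i : ℝ) / n) (past ζ (i + k) ω)]
  else 0

/-- The block sum `Q_i = ∑_{j=-m}^{m} (ε_{i+j}^h, ε_{i+j}^k)`. -/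
def blockSum {Ω E : Type*} [MeasurableSpace Ω]
    (P : Measure Ω) (ζ : ℤ → Ω → E) (G : ℝ → (ℕ → E) → ℝ) (h k n m : ℕ) (i : ℤ) (ω : Ω) :
    Fin 2 → ℝ :=
  ∑ j ∈ Finset.Icc (-(m : ℤ)) m, err P ζ G h k n (i + j) ω

/-- `N_i = Q_i Q_iᵀ / (2m + 1)`. -/
def blockMat {Ω E : Type*} [MeasurableSpace Ω]
    (P : Measure Ω) (ζ : ℤ → Ω → E) (G : ℝ → (ℕ → E) → ℝ) (h k n m : ℕ) (i : ℤ) (ω : Ω) :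
    Matrix (Fin 2) (Fin 2) ℝ :=
  (2 * (m : ℝ) + 1)⁻¹ •
    Matrix.vecMulVec (blockSum P ζ G h k n m i ω) (blockSum P ζ G h k n m i ω)

/-- The kernel weights `K((t_i - t)/τ) / ∑_{l=1}^n K((t_l - t)/τ)` with `t_i = i/n`. -/
def weight (K : ℝ → ℝ) (n : ℕ) (τ t : ℝ) (i : ℕ) : ℝ :=
  K (((i : ℝ) / n - t) / τ) / ∑ l ∈ Finset.Icc 1 n, K (((l : ℝ) / n - t) / τ)

/-- The kernel-smoothed block-sum estimator `∑_{i=1}^n w(t, i) N_i` of `Σ_k²(t)`. -/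
def estimator {Ω E : Type*} [MeasurableSpace Ω]
    (P : Measure Ω) (ζ : ℤ → Ω → E) (G : ℝ → (ℕ → E) → ℝ) (h k : ℕ) (K : ℝ → ℝ)
    (n m : ℕ) (τ t : ℝ) (ω : Ω) : Matrix (Fin 2) (Fin 2) ℝ :=
  ∑ i ∈ Finset.Icc 1 n, weight K n τ t i • blockMat P ζ G h k n m i ω

/-- The Frobenius norm of a `2 × 2` matrix. -/
def frob (A : Matrix (Fin 2) (Fin 2) ℝ) : ℝ :=
  √(∑ a, ∑ b, A a b ^ 2)

/-- A symmetric probability density of bounded variation that vanishes outside `[-1, 1]`. -/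
structure IsKernel (K : ℝ → ℝ) : Prop where
  nonneg : ∀ x, 0 ≤ K x
  integral_eq_one : ∫ x, K x = 1
  symm : ∀ x, K (-x) = K x
  support : ∀ x, 1 < |x| → K x = 0
  boundedVariation : BoundedVariationOn K Set.univ

end

end LocStat

namespace LocStat

noncomputable section

/-! Everything is carried to the space of i.i.d. sequences: `past ζ (n + h)` preserves measure, and
with coordinates numbered from the newest innovation to the oldest, each error of the sample is a
filter applied to a shifted sequence. There `reveal μ f N`, an explicit integral, is the conditional
expectation given the newest `N` innovations. Its increments are orthogonal, and the increment at
coordinate `N` is bounded in `L^p` by `depNorm μ p f N`, the effect of resampling that coordinate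
(`eLpNorm_reveal_sub_le`). Dependence measures thus control martingale differences, with time
running backwards.

Three inequalities follow. `lpNorm_four_centered_le` shows that block sums are `O(√m)` in `L⁴`.
`lpNorm_runMax_centered_le` sorts the differences by the distance between block and innovation: at a
fixed distance they form a martingale difference sequence, so Doob's inequality applies, and the
distances are summed by the triangle inequality. `abs_integral_mul_le_of_reveal` bounds the
covariance at lag `j` by `∑ δ_N δ_{N+j}`. The decay `(j log j)^{-2}` makes `∑ j δ_j` finite, hence
also `∑ |j| |γ_j|`.

Fluctuation: by the product rule, resampling one innovation changes `N_i` in `L²` by `O(m^{-1/2})`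
times the sum of `δ` over the block, which adds up to `O(√m)` over all distances. At a fixed time
the squared weights sum to `O(1/(nτ))`, which gives `√(m/(nτ))`. Uniformly in time, summation by
parts bounds the weighted sum by `O(1/(nτ))`, the size and variation of the weights, times a maximal
partial sum of order `√(mn)`, which gives `√(m/(nτ²))`.

Bias: freezing time inside a block costs `√m · m/n = O(1/m)`, as `m³ = O(n)`. Passing from the
covariances within a block to the long-run covariance costs `O(1/m)`. A Taylor expansion costs `O(τ²
+ 1/n)`, since the weights have first moment `O(1/n)` by the symmetry of `K`. Blocks cut off by the
ends of the sample have bounded mean; they get no weight at a fixed interior time once `n` is large,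
and weight `O(m/(nτ)) = O(√(m/(nτ²)))` uniformly. -/

/-- The sequence that agrees with `x` before `N` and with `y` from `N` on. -/
def splice {E : Type*} (N : ℕ) (x y : ℕ → E) : ℕ → E := fun l => if l < N then x l else y l

/-- The sequence without its first `p` terms. -/
def shiftSeq {E : Type*} (p : ℕ) (x : ℕ → E) : ℕ → E := fun l => x (l + p)

/-- The law of an i.i.d. sequence with marginal `μ`. -/
abbrev iidLaw {E : Type*} [MeasurableSpace E] (μ : Measure E) [IsProbabilityMeasure μ] :
    Measure (ℕ → E) := Measure.infinitePi fun _ : ℕ => μ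

/-! ### Law-preserving operations on pairs of i.i.d. sequences. -/

section Splice

variable {E : Type*} [MeasurableSpace E]

@[fun_prop]
theorem measurable_shiftSeq (p : ℕ) : Measurable (shiftSeq (E := E) p) := by
  unfold shiftSeq; fun_prop

theorem measurable_splice (N : ℕ) :
    Measurable fun q : (ℕ → E) × (ℕ → E) => splice N q.1 q.2 := by
  refine measurable_pi_lambda _ fun l => ?_
  unfold splice
  split_ifs <;> fun_prop

theorem measurable_splice_swap (N : ℕ) :
    Measurable fun q : (ℕ → E) × (ℕ → E) => (splice N q.1 q.2, splice N q.2 q.1) :=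
  (measurable_splice N).prodMk ((measurable_splice N).comp measurable_swap)

theorem measurable_updateAt (N : ℕ) :
    Measurable fun q : (ℕ → E) × (ℕ → E) => Function.update q.1 N (q.2 N) := by
  refine measurable_pi_lambda _ fun l => ?_
  by_cases h : l = N
  · subst h; simpa using by fun_prop
  · simp only [Function.update_of_ne h]; fun_prop

/-- The bridge between resampling and revealing: on a pair whose tails from `N + 1` on have been
exchanged, resampling coordinate `N` hides exactly one revealed coordinate. -/
theorem update_splice_swap {E : Type*} (N : ℕ) (x y : ℕ → E) :
    Function.update (splice (N + 1) x y) N (splice (N + 1) y x N) = splice N x y := by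
  funext l
  rcases lt_trichotomy l N with h | rfl | h
  · rw [Function.update_of_ne h.ne]; simp [splice, h, h.trans (Nat.lt_succ_self N)]
  · simp [splice]
  · rw [Function.update_of_ne h.ne']
    simp [splice, not_lt.2 h.le, show ¬ l < N + 1 by omega]

variable (μ : Measure E) [IsProbabilityMeasure μ]

theorem measurePreserving_shiftSeq (p : ℕ) :
    MeasurePreserving (shiftSeq p) (iidLaw μ) (iidLaw μ) :=
  ⟨measurable_shiftSeq p, Measure.map_infinitePi_infinitePi_of_inj
    (P := fun _ : ℕ => μ) (f := fun l => l + p) (add_left_injective p)⟩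

theorem measurePreserving_pair :
    MeasurePreserving (fun ω : Bool × ℕ → E => ((fun l => ω (false, l)), fun l => ω (true, l)))
      (Measure.infinitePi fun _ => μ) ((iidLaw μ).prod (iidLaw μ)) := by
  refine ⟨by fun_prop, ?_⟩
  have h1 := Measure.infinitePi_map_curry (X := E) fun (_ : Bool) (_ : ℕ) => μ
  have h2 := Measure.infinitePi_map_eval_prod (P := fun _ : Bool => iidLaw μ)
    (i := false) (j := true) (by simp)
  rw [← h2, ← h1, Measure.map_map (by fun_prop) (by fun_prop)]
  rfl

/-- The pair is an i.i.d. array indexed by `Bool × ℕ`. Exchanging the tails is a relabelling `f` of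
the indices, which does not change the law. -/
theorem measurePreserving_splice_swap (N : ℕ) :
    MeasurePreserving (fun q : (ℕ → E) × (ℕ → E) => (splice N q.1 q.2, splice N q.2 q.1))
      ((iidLaw μ).prod (iidLaw μ)) ((iidLaw μ).prod (iidLaw μ)) := by
  refine ⟨measurable_splice_swap N, ?_⟩
  let f : Bool × ℕ → Bool × ℕ := fun b => if b.2 < N then b else (!b.1, b.2)
  have hf : Function.Injective f := by
    rintro ⟨b, l⟩ ⟨b', l'⟩ h
    simp only [f] at h
    split_ifs at h <;> simp_all <;> omega
  have h := Measure.map_infinitePi_infinitePi_of_inj (P := fun _ : Bool × ℕ => μ) hf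
  have hp := measurePreserving_pair μ
  rw [← hp.map_eq, Measure.map_map (measurable_splice_swap N) hp.measurable]
  conv_rhs => rw [← h]
  rw [Measure.map_map hp.measurable (by fun_prop)]
  congr 1
  funext ω
  simp only [Function.comp, f, Prod.mk.injEq]
  constructor <;> funext l <;> simp only [splice] <;> split_ifs <;> simp

theorem measurePreserving_splice (N : ℕ) :
    MeasurePreserving (fun q : (ℕ → E) × (ℕ → E) => splice N q.1 q.2)
      ((iidLaw μ).prod (iidLaw μ)) (iidLaw μ) :=
  measurePreserving_fst.comp (measurePreserving_splice_swap μ N)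

end Splice

/-! ### Conditional expectations given the first coordinates. -/

section Reveal

variable {E : Type*} [MeasurableSpace E] (μ : Measure E) [IsProbabilityMeasure μ]

/-- The conditional expectation of `f` given the first `N` coordinates. -/
def reveal (f : (ℕ → E) → ℝ) (N : ℕ) (x : ℕ → E) : ℝ := ∫ y, f (splice N x y) ∂(iidLaw μ)

theorem reveal_zero (f : (ℕ → E) → ℝ) (x : ℕ → E) : reveal μ f 0 x = ∫ y, f y ∂(iidLaw μ) := by
  have : ∀ y, splice 0 x y = y := fun y => funext fun l => if_neg (Nat.not_lt_zero l)
  simp [reveal, this]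

theorem dependsOn_reveal (f : (ℕ → E) → ℝ) (N : ℕ) :
    DependsOn (reveal μ f N) (Set.Iio N) := by
  intro x y hxy
  simp only [reveal]
  congr 1; funext z; congr 1; funext l
  simp only [splice]
  split_ifs with h
  · exact hxy l h
  · rfl

theorem splice_of_dependsOn {E β : Type*} {g : (ℕ → E) → β} {N : ℕ} (hg : DependsOn g (Set.Iio N))
    (x y : ℕ → E) : g (splice N x y) = g x :=
  hg fun _ hi => if_pos hi

theorem measurable_reveal {f : (ℕ → E) → ℝ} (hf : Measurable f) (N : ℕ) :
    Measurable (reveal μ f N) :=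
  ((hf.comp (measurable_splice N)).stronglyMeasurable.integral_prod_right' (ν := iidLaw μ)).measurable

/-- The first `N` coordinates, as a σ-algebra. -/
def coordFiltration (E : Type*) [MeasurableSpace E] :
    Filtration ℕ (MeasurableSpace.pi : MeasurableSpace (ℕ → E)) where
  seq N := ⨆ l : ℕ, ⨆ _ : l < N, MeasurableSpace.comap (fun x : ℕ → E => x l) inferInstance
  mono' _ _ h := iSup_mono fun _ => iSup_mono' fun hl => ⟨hl.trans_le h, le_rfl⟩
  le' _ := iSup_le fun l => iSup_le fun _ => (measurable_pi_apply l).comap_le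

theorem measurable_coord {N l : ℕ} (h : l < N) :
    Measurable[coordFiltration E N] fun x : ℕ → E => x l := by
  refine Measurable.mono (comap_measurable _) ?_ le_rfl
  exact le_iSup₂_of_le (f := fun l (_ : l < N) =>
    MeasurableSpace.comap (fun x : ℕ → E => x l) inferInstance) l h le_rfl

theorem iSup_coordFiltration : ⨆ N, coordFiltration E N = MeasurableSpace.pi := by
  refine le_antisymm (iSup_le fun N => (coordFiltration E).le N) ?_
  refine iSup_le fun l => le_iSup_of_le (l + 1) ?_
  exact (measurable_coord (Nat.lt_succ_self l)).comap_le

/-- `splice N x y` reads `x` only below `N`, so `reveal` factors through the restriction of `x` to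
these indices; `j` glues a restricted sequence to a tail. -/
theorem measurable_reveal_coordFiltration {f : (ℕ → E) → ℝ} (hf : Measurable f) (N : ℕ) :
    Measurable[coordFiltration E N] (reveal μ f N) := by
  let j : ({l : ℕ // l < N} → E) × (ℕ → E) → ℕ → E :=
    fun q l => if h : l < N then q.1 ⟨l, h⟩ else q.2 l
  have hj : Measurable j := by
    refine measurable_pi_lambda _ fun l => ?_
    simp only [j]
    split_ifs <;> fun_prop
  have h1 : Measurable fun r : {l : ℕ // l < N} → E => ∫ y, f (j (r, y)) ∂(iidLaw μ) :=
    ((hf.comp hj).stronglyMeasurable.integral_prod_right' (ν := iidLaw μ)).measurable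
  have h2 : Measurable[coordFiltration E N] fun (x : ℕ → E) (l : {l : ℕ // l < N}) => x l := by
    refine @measurable_pi_lambda _ _ _ (coordFiltration E N) _ _ fun l => measurable_coord l.2
  exact h1.comp h2

theorem dependsOn_of_measurableSet {N : ℕ} {s : Set (ℕ → E)}
    (hs : MeasurableSet[coordFiltration E N] s) : DependsOn (fun x => x ∈ s) (Set.Iio N) := by
  let r : (ℕ → E) → ({l : ℕ // l < N} → E) := fun x l => x l
  have h : coordFiltration E N ≤ MeasurableSpace.comap r MeasurableSpace.pi := by
    refine iSup_le fun l => iSup_le fun hl => ?_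
    have : (fun x : ℕ → E => x l) = (fun z : {l : ℕ // l < N} → E => z ⟨l, hl⟩) ∘ r := rfl
    rw [this, ← MeasurableSpace.comap_comp]
    exact MeasurableSpace.comap_mono (measurable_pi_apply _).comap_le
  obtain ⟨t, -, rfl⟩ := h s hs
  intro x y hxy
  have : r x = r y := funext fun l => hxy l l.2
  simp [this]

variable {μ}

/-- Fubini: splicing preserves the law, and `g` does not see the new tail. Only the product has to
be integrable, which later admits cubes as `g`. -/
theorem integral_mul_reveal {f g : (ℕ → E) → ℝ} {N : ℕ} (hg : DependsOn g (Set.Iio N))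
    (hfg : Integrable (fun x => g x * f x) (iidLaw μ)) :
    ∫ x, g x * reveal μ f N x ∂(iidLaw μ) = ∫ x, g x * f x ∂(iidLaw μ) := by
  have h1 := (measurePreserving_splice μ N).integrable_comp_of_integrable hfg
  calc ∫ x, g x * reveal μ f N x ∂(iidLaw μ)
      = ∫ x, ∫ y, g (splice N x y) * f (splice N x y) ∂(iidLaw μ) ∂(iidLaw μ) := by
        refine integral_congr_ae (.of_forall fun x => ?_)
        simp only [splice_of_dependsOn hg, reveal, integral_const_mul]
    _ = ∫ q, g (splice N q.1 q.2) * f (splice N q.1 q.2) ∂((iidLaw μ).prod (iidLaw μ)) :=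
        (integral_prod _ h1).symm
    _ = ∫ x, g x * f x ∂(iidLaw μ) := by
        have hp := measurePreserving_splice μ N
        conv_rhs => rw [← hp.map_eq]
        refine (integral_map (μ := (iidLaw μ).prod (iidLaw μ))
          (f := fun x => g x * f x) hp.measurable.aemeasurable ?_).symm
        rw [hp.map_eq]; exact hfg.aestronglyMeasurable

/-- Averaging over an independent variable contracts `L^p`: Jensen for each `x`, then Tonelli. -/
theorem eLpNorm_integral_le {X Y : Type*} [MeasurableSpace X] [MeasurableSpace Y] {κ : Measure X}
    {ρ : Measure Y} [IsProbabilityMeasure ρ] [SFinite κ] {F : X × Y → ℝ} {p : ℝ≥0∞} (hp : 1 ≤ p)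
    (hp' : p ≠ ∞) (hF : Measurable F) :
    eLpNorm (fun x => ∫ y, F (x, y) ∂ρ) p κ ≤ eLpNorm F p (κ.prod ρ) := by
  have h0 : p ≠ 0 := (zero_lt_one.trans_le hp).ne'
  have hpr : 0 < p.toReal := ENNReal.toReal_pos h0 hp'
  rw [eLpNorm_eq_lintegral_rpow_enorm_toReal h0 hp', eLpNorm_eq_lintegral_rpow_enorm_toReal h0 hp']
  gcongr
  rw [lintegral_prod _ (by fun_prop)]
  refine lintegral_mono fun x => ?_
  have h1 : ‖∫ y, F (x, y) ∂ρ‖ₑ ≤ eLpNorm (fun y => F (x, y)) p ρ := by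
    refine (enorm_integral_le_lintegral_enorm _).trans ?_
    rw [← eLpNorm_one_eq_lintegral_enorm]
    exact eLpNorm_le_eLpNorm_of_exponent_le hp
      (hF.comp measurable_prodMk_left).aestronglyMeasurable
  calc ‖∫ y, F (x, y) ∂ρ‖ₑ ^ p.toReal ≤ eLpNorm (fun y => F (x, y)) p ρ ^ p.toReal := by gcongr
    _ = _ := by
      rw [eLpNorm_eq_lintegral_rpow_enorm_toReal h0 hp', ← ENNReal.rpow_mul,
        one_div_mul_cancel hpr.ne', ENNReal.rpow_one]

theorem eLpNorm_reveal_le {f : (ℕ → E) → ℝ} (hf : Measurable f) {p : ℝ≥0∞} (hp : 1 ≤ p)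
    (hp' : p ≠ ∞) (N : ℕ) : eLpNorm (reveal μ f N) p (iidLaw μ) ≤ eLpNorm f p (iidLaw μ) := by
  refine (eLpNorm_integral_le (κ := iidLaw μ) (ρ := iidLaw μ) hp hp'
    (hf.comp (measurable_splice N))).trans_eq ?_
  exact eLpNorm_comp_measurePreserving hf.aestronglyMeasurable (measurePreserving_splice μ N)

theorem memLp_reveal {f : (ℕ → E) → ℝ} (hf : Measurable f) {p : ℝ≥0∞} (hp : 1 ≤ p)
    (hp' : p ≠ ∞) (hfp : MemLp f p (iidLaw μ)) (N : ℕ) : MemLp (reveal μ f N) p (iidLaw μ) :=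
  ⟨(measurable_reveal μ hf N).aestronglyMeasurable, (eLpNorm_reveal_le hf hp hp' N).trans_lt hfp.2⟩

/-- The projection onto the `N`-th coordinate is dominated by the effect of replacing that
coordinate by an independent copy. -/
theorem eLpNorm_reveal_sub_le {f : (ℕ → E) → ℝ} (hf : Measurable f)
    (hfi : Integrable f (iidLaw μ)) {p : ℝ≥0∞} (hp : 1 ≤ p) (hp' : p ≠ ∞) (N : ℕ) :
    eLpNorm (fun x => reveal μ f (N + 1) x - reveal μ f N x) p (iidLaw μ) ≤
      eLpNorm (fun q : (ℕ → E) × (ℕ → E) => f q.1 - f (Function.update q.1 N (q.2 N))) p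
        ((iidLaw μ).prod (iidLaw μ)) := by
  have hm : Measurable fun q : (ℕ → E) × (ℕ → E) =>
      f q.1 - f (Function.update q.1 N (q.2 N)) :=
    (hf.comp measurable_fst).sub (hf.comp (measurable_updateAt N))
  -- After exchanging the tails, the resampling difference is the difference of two consecutive
  -- splices, and `reveal` averages it over `y`.
  rw [← eLpNorm_comp_measurePreserving hm.aestronglyMeasurable
    (measurePreserving_splice_swap μ (N + 1))]
  have h1 : ∀ n, ∀ᵐ x ∂(iidLaw μ), Integrable (fun y => f (splice n x y)) (iidLaw μ) := fun n =>
    ((measurePreserving_splice μ n).integrable_comp_of_integrable hfi).prod_right_ae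
  have h2 : (fun x => reveal μ f (N + 1) x - reveal μ f N x) =ᵐ[iidLaw μ]
      fun x => ∫ y, (f (splice (N + 1) x y) - f (splice N x y)) ∂(iidLaw μ) := by
    filter_upwards [h1 (N + 1), h1 N] with x hx hx'
    exact (integral_sub hx hx').symm
  rw [eLpNorm_congr_ae h2]
  refine (eLpNorm_integral_le (κ := iidLaw μ) (ρ := iidLaw μ)
    (F := fun q => f (splice (N + 1) q.1 q.2) - f (splice N q.1 q.2)) hp hp'
    ((hf.comp (measurable_splice _)).sub (hf.comp (measurable_splice _)))).trans_eq ?_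
  congr 1
  funext q
  simp only [Function.comp, update_splice_swap]

/-- Lévy's upward theorem, after identifying `reveal` with the conditional expectation given
`coordFiltration`. -/
theorem tendsto_reveal {f : (ℕ → E) → ℝ} (hf : Measurable f) (hfi : Integrable f (iidLaw μ)) :
    ∀ᵐ x ∂(iidLaw μ), Tendsto (fun N => reveal μ f N x) atTop (nhds (f x)) := by
  have h1 : ∀ N, reveal μ f N =ᵐ[iidLaw μ] (iidLaw μ)[f | coordFiltration E N] := by
    intro N
    have hint : Integrable (reveal μ f N) (iidLaw μ) :=
      memLp_one_iff_integrable.1 (memLp_reveal hf le_rfl (by simp)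
        (memLp_one_iff_integrable.2 hfi) N)
    refine ae_eq_condExp_of_forall_setIntegral_eq ((coordFiltration E).le N) hfi
      (fun s _ _ => hint.integrableOn) (fun s hs _ => ?_)
      (measurable_reveal_coordFiltration μ hf N).stronglyMeasurable.aestronglyMeasurable
    have hs' : MeasurableSet s := (coordFiltration E).le N s hs
    have hd : DependsOn (s.indicator fun _ => (1 : ℝ)) (Set.Iio N) := by
      intro x y hxy
      have := dependsOn_of_measurableSet hs hxy
      simp only [eq_iff_iff] at this
      by_cases hx : x ∈ s
      · simp [hx, this.1 hx]
      · simp [hx, mt this.2 hx]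
    have e : ∀ g : (ℕ → E) → ℝ, (fun x => s.indicator (fun _ => (1 : ℝ)) x * g x) =
        s.indicator g := by
      intro g; funext x; by_cases hx : x ∈ s <;> simp [hx]
    have := integral_mul_reveal (μ := μ) (f := f) hd (by rw [e]; exact hfi.indicator hs')
    rwa [e, e, integral_indicator hs', integral_indicator hs'] at this
  have h2 := hfi.tendsto_ae_condExp (ℱ := coordFiltration E)
    (by rw [iSup_coordFiltration]; exact hf.stronglyMeasurable)
  filter_upwards [h2, ae_all_iff.2 h1] with x hx hx'
  simpa [hx'] using hx

end Reveal

/-! ### Hölder, monotonicity and Fatou for `L^p` norms. -/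

section LpTools

variable {Ω : Type*} [MeasurableSpace Ω] {P : Measure Ω}

instance holderTriple_four_four_two : ENNReal.HolderTriple 4 4 2 where
  inv_add_inv_eq_inv := by
    have h : (4 : ℝ≥0∞) = 2 * 2 := by norm_num
    rw [h, ENNReal.mul_inv (by simp) (by simp), ← two_mul, ← mul_assoc,
      ENNReal.mul_inv_cancel (by simp) (by simp), one_mul]

instance holderTriple_eight_eight_four : ENNReal.HolderTriple 8 8 4 where
  inv_add_inv_eq_inv := by
    have h : (8 : ℝ≥0∞) = 2 * 4 := by norm_num
    rw [h, ENNReal.mul_inv (by simp) (by simp), ← two_mul, ← mul_assoc,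
      ENNReal.mul_inv_cancel (by simp) (by simp), one_mul]

theorem lpNorm_mul_le {f g : Ω → ℝ} {p q : ℝ≥0∞} (r : ℝ≥0∞) (hf : MemLp f p P) (hg : MemLp g q P)
    [ENNReal.HolderTriple p q r] :
    lpNorm (fun x => f x * g x) r P ≤ lpNorm f p P * lpNorm g q P := by
  have h := eLpNorm_smul_le_mul_eLpNorm (p := p) (q := q) (r := r) hg.1 hf.1
  rw [← ENNReal.toReal_le_toReal (hg.smul (r := r) hf).2.ne
    (ENNReal.mul_ne_top hf.2.ne hg.2.ne), ENNReal.toReal_mul, toReal_eLpNorm (hf.1.smul hg.1),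
    toReal_eLpNorm hf.1, toReal_eLpNorm hg.1] at h
  exact h

theorem abs_integral_le_lpNorm_one (f : Ω → ℝ) : |∫ x, f x ∂P| ≤ lpNorm f 1 P := by
  by_cases hf : AEStronglyMeasurable f P
  · rw [lpNorm_one_eq_integral_norm hf]
    exact norm_integral_le_integral_norm f
  · rw [integral_non_aestronglyMeasurable hf]; simp

theorem abs_integral_mul_le {f g : Ω → ℝ} (hf : MemLp f 2 P) (hg : MemLp g 2 P) :
    |∫ x, f x * g x ∂P| ≤ lpNorm f 2 P * lpNorm g 2 P :=
  (abs_integral_le_lpNorm_one _).trans (lpNorm_mul_le 1 hf hg)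

theorem lpNorm_two_sq {f : Ω → ℝ} (hf : AEStronglyMeasurable f P) :
    lpNorm f 2 P ^ 2 = ∫ x, f x ^ 2 ∂P := by
  rw [lpNorm_eq_integral_norm_rpow_toReal (by simp) (by simp) hf, ← Real.rpow_natCast,
    ← Real.rpow_mul (integral_nonneg fun x => by positivity)]
  simp

theorem lpNorm_four_pow {f : Ω → ℝ} (hf : AEStronglyMeasurable f P) :
    lpNorm f 4 P ^ 4 = ∫ x, f x ^ 4 ∂P := by
  rw [lpNorm_eq_integral_norm_rpow_toReal (by simp) (by simp) hf, ← Real.rpow_natCast,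
    ← Real.rpow_mul (integral_nonneg fun x => by positivity)]
  have h : ∀ x, |f x| ^ (4 : ℝ) = f x ^ 4 := fun x => by
    rw [show (4 : ℝ) = ((4 : ℕ) : ℝ) by norm_num, Real.rpow_natCast, Even.pow_abs (by decide)]
  simp [h]

theorem lpNorm_le_lpNorm_of_exponent_le [IsProbabilityMeasure P] {f : Ω → ℝ} {p q : ℝ≥0∞}
    (hpq : p ≤ q) (hf : MemLp f q P) : lpNorm f p P ≤ lpNorm f q P := by
  rw [← toReal_eLpNorm hf.1, ← toReal_eLpNorm hf.1]
  exact ENNReal.toReal_mono hf.2.ne (eLpNorm_le_eLpNorm_of_exponent_le hpq hf.1)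

theorem lpNorm_le_of_eLpNorm_le {f : Ω → ℝ} {p : ℝ≥0∞} {C : ℝ} (hC : 0 ≤ C)
    (h : eLpNorm f p P ≤ ENNReal.ofReal C) : lpNorm f p P ≤ C := by
  by_cases hf : AEStronglyMeasurable f P
  · rw [← toReal_eLpNorm hf]
    exact ENNReal.toReal_le_of_le_ofReal hC h
  · rwa [lpNorm_of_not_aestronglyMeasurable hf]

theorem eLpNorm_le_of_lpNorm_le {f : Ω → ℝ} {p : ℝ≥0∞} {C : ℝ} (hf : MemLp f p P)
    (h : lpNorm f p P ≤ C) : eLpNorm f p P ≤ ENNReal.ofReal C := by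
  rw [← ofReal_lpNorm hf]; exact ENNReal.ofReal_le_ofReal h

theorem lpNorm_const_mul (c : ℝ) (f : Ω → ℝ) (p : ℝ≥0∞) :
    lpNorm (fun x => c * f x) p P = |c| * lpNorm f p P :=
  lpNorm_const_smul c f P

theorem lpNorm_fun_sum_le {ι : Type*} {s : Finset ι} {f : ι → Ω → ℝ} {p : ℝ≥0∞}
    (hf : ∀ i ∈ s, MemLp (f i) p P) (hp : 1 ≤ p) :
    lpNorm (fun x => ∑ i ∈ s, f i x) p P ≤ ∑ i ∈ s, lpNorm (f i) p P := by
  have : (fun x => ∑ i ∈ s, f i x) = ∑ i ∈ s, f i := by ext; simp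
  rw [this]; exact lpNorm_sum_le hf hp

/-- Fatou's lemma for `L^p` norms. -/
theorem memLp_and_lpNorm_le_of_tendsto {f : ℕ → Ω → ℝ} {g : Ω → ℝ} {p : ℝ≥0∞} {C : ℝ}
    (hf : ∀ n, MemLp (f n) p P) (hC : ∀ n, lpNorm (f n) p P ≤ C)
    (h : ∀ᵐ x ∂P, Tendsto (fun n => f n x) atTop (nhds (g x))) :
    MemLp g p P ∧ lpNorm g p P ≤ C := by
  have hC0 : 0 ≤ C := lpNorm_nonneg.trans (hC 0)
  have h1 : eLpNorm g p P ≤ ENNReal.ofReal C := by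
    refine (Lp.eLpNorm_lim_le_liminf_eLpNorm (fun n => (hf n).1) g h).trans ?_
    refine (liminf_le_liminf (v := fun _ : ℕ => ENNReal.ofReal C)
      (.of_forall fun n => eLpNorm_le_of_lpNorm_le (hf n) (hC n))).trans_eq ?_
    simp
  exact ⟨⟨aestronglyMeasurable_of_tendsto_ae atTop (fun n => (hf n).1) h,
    h1.trans_lt ENNReal.ofReal_lt_top⟩, lpNorm_le_of_eLpNorm_le hC0 h1⟩

end LpTools

/-! ### Running maxima. -/

section RunMax

/-- The running maximum of a sequence. -/
def runMax (s : ℕ → ℝ) : ℕ → ℝ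
  | 0 => s 0
  | n + 1 => max (runMax s n) (s (n + 1))

theorem le_runMax (s : ℕ → ℝ) {j n : ℕ} (h : j ≤ n) : s j ≤ runMax s n := by
  induction n with
  | zero => obtain rfl : j = 0 := by omega
            exact le_rfl
  | succ n ih =>
    rcases h.lt_or_eq with h | rfl
    · exact (ih (by omega)).trans (le_max_left _ _)
    · exact le_max_right _ _

theorem runMax_le {s : ℕ → ℝ} {n : ℕ} {C : ℝ} (h : ∀ j ≤ n, s j ≤ C) : runMax s n ≤ C := by
  induction n with
  | zero => exact h 0 le_rfl
  | succ n ih => exact max_le (ih fun j hj => h j (by omega)) (h _ le_rfl)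

theorem runMax_congr {s t : ℕ → ℝ} {n : ℕ} (h : ∀ j ≤ n, s j = t j) : runMax s n = runMax t n :=
  le_antisymm (runMax_le fun j hj => (h j hj).trans_le (le_runMax t hj))
    (runMax_le fun j hj => (h j hj).symm.trans_le (le_runMax s hj))

theorem tendsto_runMax {s : ℕ → ℕ → ℝ} {t : ℕ → ℝ} (n : ℕ)
    (h : ∀ j ≤ n, Tendsto (fun T => s T j) atTop (nhds (t j))) :
    Tendsto (fun T => runMax (s T) n) atTop (nhds (runMax t n)) := by
  induction n with
  | zero => exact h 0 le_rfl
  | succ n ih => exact (ih fun j hj => h j (by omega)).max (h _ le_rfl)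

/-- A pathwise form of Doob's `L²` inequality. -/
theorem runMax_sq_le (d : ℕ → ℝ) (n : ℕ) :
    runMax (fun j => ∑ q ∈ Finset.range j, d q) n ^ 2 ≤
      4 * (∑ q ∈ Finset.range n, d q) ^ 2 -
        4 * ∑ q ∈ Finset.range n, runMax (fun j => ∑ q ∈ Finset.range j, d q) q * d q := by
  set S : ℕ → ℝ := fun j => ∑ q ∈ Finset.range j, d q with hS
  -- The induction closes in this form; completing the square afterwards yields the constants 4. The
  -- factor `runMax S q` is known before `d q`, so for martingale differences the sum on the right
  -- has mean zero.
  have key : ∀ n, runMax S n ^ 2 ≤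
      2 * runMax S n * S n - 2 * ∑ q ∈ Finset.range n, runMax S q * d q := by
    intro n
    induction n with
    | zero => simp [runMax, hS]
    | succ n ih =>
      have hs : S (n + 1) = S n + d n := Finset.sum_range_succ _ _
      rw [Finset.sum_range_succ]
      change max (runMax S n) (S (n + 1)) ^ 2 ≤ 2 * max (runMax S n) (S (n + 1)) * S (n + 1) - _
      rcases le_total (S (n + 1)) (runMax S n) with h | h
      · rw [max_eq_left h, hs]
        linarith
      · rw [max_eq_right h, show d n = S (n + 1) - S n by rw [hs]; ring]
        nlinarith [sq_nonneg (S (n + 1) - runMax S n)]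
  nlinarith [key n, sq_nonneg (runMax S n - 2 * S n)]

/-- `s 0 = 0` makes both one-sided maxima nonnegative, so the larger of them dominates `|s j|`. -/
theorem runMax_abs_sq_le {s : ℕ → ℝ} (h0 : s 0 = 0) (n : ℕ) :
    runMax (fun j => |s j|) n ^ 2 ≤ runMax s n ^ 2 + runMax (fun j => -s j) n ^ 2 := by
  have h1 : 0 ≤ runMax s n := h0.symm.le.trans (le_runMax s (Nat.zero_le n))
  have h2 : 0 ≤ runMax (fun j => -s j) n := by
    have := le_runMax (fun j => -s j) (Nat.zero_le n); simpa [h0] using this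
  have h3 : runMax (fun j => |s j|) n ≤ max (runMax s n) (runMax (fun j => -s j) n) :=
    runMax_le fun j hj => max_le_max (le_runMax s hj) (le_runMax (fun j => -s j) hj)
  have h4 : 0 ≤ runMax (fun j => |s j|) n :=
    (abs_nonneg _).trans (le_runMax (fun j => |s j|) (Nat.zero_le n))
  calc runMax (fun j => |s j|) n ^ 2 ≤ max (runMax s n) (runMax (fun j => -s j) n) ^ 2 := by gcongr
    _ ≤ _ := by rcases max_choice (runMax s n) (runMax (fun j => -s j) n) with h | h <;> rw [h] <;>
                nlinarith

theorem runMax_sum_le {ι : Type*} (I : Finset ι) (s : ι → ℕ → ℝ) (n : ℕ) :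
    runMax (fun j => |∑ i ∈ I, s i j|) n ≤ ∑ i ∈ I, runMax (fun j => |s i j|) n :=
  runMax_le fun _ hj => (Finset.abs_sum_le_sum_abs _ _).trans
    (Finset.sum_le_sum fun i _ => le_runMax (fun j => |s i j|) hj)

theorem runMax_abs_nonneg (s : ℕ → ℝ) (n : ℕ) : 0 ≤ runMax (fun j => |s j|) n :=
  (abs_nonneg _).trans (le_runMax (fun j => |s j|) (Nat.zero_le n))

variable {Ω : Type*} [MeasurableSpace Ω] {P : Measure Ω}

theorem memLp_runMax {s : ℕ → Ω → ℝ} {p : ℝ≥0∞} (h : ∀ j, MemLp (s j) p P) (n : ℕ) :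
    MemLp (fun x => runMax (fun j => s j x) n) p P := by
  induction n with
  | zero => exact h 0
  | succ n ih => exact ih.sup (h _)

theorem dependsOn_runMax {E : Type*} {s : ℕ → (ℕ → E) → ℝ} {I : Set ℕ} {n : ℕ}
    (h : ∀ j ≤ n, DependsOn (s j) I) : DependsOn (fun x => runMax (fun j => s j x) n) I :=
  fun _ _ hxy => runMax_congr fun j hj => h j hj hxy

theorem dependsOn_sum {E ι : Type*} {s : ι → (ℕ → E) → ℝ} {I : Set ℕ} {J : Finset ι}
    (h : ∀ j ∈ J, DependsOn (s j) I) : DependsOn (fun x => ∑ j ∈ J, s j x) I :=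
  fun _ _ hxy => Finset.sum_congr rfl fun j hj => h j hj hxy

end RunMax

/-! ### Martingale inequalities for revealed coordinates. -/

section Martingale

variable {E : Type*} [MeasurableSpace E] {μ : Measure E} [IsProbabilityMeasure μ]

/-- Orthogonality of increments in `L²`. -/
theorem integral_sum_sq_of_orthogonal {Ω : Type*} [MeasurableSpace Ω] {P : Measure Ω}
    {d : ℕ → Ω → ℝ} (hd : ∀ q, MemLp (d q) 2 P)
    (ho : ∀ n, ∫ x, (∑ q ∈ Finset.range n, d q x) * d n x ∂P = 0) (n : ℕ) :
    ∫ x, (∑ q ∈ Finset.range n, d q x) ^ 2 ∂P = ∑ q ∈ Finset.range n, lpNorm (d q) 2 P ^ 2 := by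
  have hS : ∀ n, MemLp (fun x => ∑ q ∈ Finset.range n, d q x) 2 P := fun n =>
    memLp_finsetSum _ fun q _ => hd q
  induction n with
  | zero => simp
  | succ n ih =>
    rw [Finset.sum_range_succ, ← ih, lpNorm_two_sq (hd n).1]
    have e : ∀ x, (∑ q ∈ Finset.range (n + 1), d q x) ^ 2 = (∑ q ∈ Finset.range n, d q x) ^ 2 +
        2 * ((∑ q ∈ Finset.range n, d q x) * d n x) + d n x ^ 2 := fun x => by
      rw [Finset.sum_range_succ]; ring
    simp_rw [e]
    have i1 := (hS n).integrable_sq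
    have i2 : Integrable (fun x => 2 * ((∑ q ∈ Finset.range n, d q x) * d n x)) P :=
      ((hS n).integrable_mul (hd n)).const_mul 2
    have i3 : Integrable (fun x => (∑ q ∈ Finset.range n, d q x) ^ 2 +
        2 * ((∑ q ∈ Finset.range n, d q x) * d n x)) P := i1.add i2
    rw [integral_add i3 (hd n).integrable_sq, integral_add i1 i2, integral_const_mul, ho]
    ring

/-- Doob's `L²` inequality for martingale differences with respect to the coordinates. -/
theorem lpNorm_runMax_le {d : ℕ → (ℕ → E) → ℝ} {a : ℕ → ℕ} (ha : Monotone a)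
    (hd : ∀ q, MemLp (d q) 2 (iidLaw μ)) (hdep : ∀ q, DependsOn (d q) (Set.Iio (a (q + 1))))
    (ho : ∀ q g, DependsOn g (Set.Iio (a q)) → MemLp g 2 (iidLaw μ) →
      ∫ x, g x * d q x ∂(iidLaw μ) = 0) (n : ℕ) :
    lpNorm (fun x => runMax (fun j => |∑ q ∈ Finset.range j, d q x|) n) 2 (iidLaw μ) ≤
      3 * √(∑ q ∈ Finset.range n, lpNorm (d q) 2 (iidLaw μ) ^ 2) := by
  have one_side : ∀ d : ℕ → (ℕ → E) → ℝ, (∀ q, MemLp (d q) 2 (iidLaw μ)) →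
      (∀ q, DependsOn (d q) (Set.Iio (a (q + 1)))) →
      (∀ q g, DependsOn g (Set.Iio (a q)) → MemLp g 2 (iidLaw μ) →
        ∫ x, g x * d q x ∂(iidLaw μ) = 0) →
      MemLp (fun x => runMax (fun j => ∑ q ∈ Finset.range j, d q x) n) 2 (iidLaw μ) ∧
      ∫ x, runMax (fun j => ∑ q ∈ Finset.range j, d q x) n ^ 2 ∂(iidLaw μ) ≤
        4 * ∑ q ∈ Finset.range n, lpNorm (d q) 2 (iidLaw μ) ^ 2 := by
    intro d hd hdep ho
    have hS : ∀ n, MemLp (fun x => ∑ q ∈ Finset.range n, d q x) 2 (iidLaw μ) := fun n =>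
      memLp_finsetSum _ fun q _ => hd q
    have hSd : ∀ n, DependsOn (fun x => ∑ q ∈ Finset.range n, d q x) (Set.Iio (a n)) := fun n =>
      dependsOn_sum fun q hq => (hdep q).mono
        (Set.Iio_subset_Iio (ha (Finset.mem_range.1 hq)))
    have hM : ∀ n, MemLp (fun x => runMax (fun j => ∑ q ∈ Finset.range j, d q x) n) 2
      (iidLaw μ) := fun n => memLp_runMax hS n
    have hMd : ∀ n, DependsOn (fun x => runMax (fun j => ∑ q ∈ Finset.range j, d q x) n)
        (Set.Iio (a n)) := fun n =>
      dependsOn_runMax fun j hj => (hSd j).mono (Set.Iio_subset_Iio (ha hj))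
    refine ⟨hM n, ?_⟩
    have i1 : Integrable (fun x => 4 * (∑ q ∈ Finset.range n, d q x) ^ 2) (iidLaw μ) :=
      (hS n).integrable_sq.const_mul 4
    have i3 : ∀ q, Integrable (fun x => runMax (fun j => ∑ q ∈ Finset.range j, d q x) q * d q x)
        (iidLaw μ) := fun q => (hM q).integrable_mul (hd q)
    have i2 : Integrable (fun x => 4 * ∑ q ∈ Finset.range n,
        runMax (fun j => ∑ q ∈ Finset.range j, d q x) q * d q x) (iidLaw μ) :=
      (integrable_finsetSum _ fun q _ => i3 q).const_mul 4
    refine (integral_mono (hM n).integrable_sq (i1.sub i2)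
      fun x => runMax_sq_le (fun q => d q x) n).trans_eq ?_
    simp only [Pi.sub_apply]
    rw [integral_sub i1 i2, integral_const_mul, integral_const_mul,
      integral_sum_sq_of_orthogonal hd (fun n => ho n _ (hSd n) (hS n)),
      integral_finsetSum _ fun q _ => i3 q,
      Finset.sum_eq_zero fun q _ => ho q _ (hMd q) (hM q)]
    simp
  obtain ⟨m1, h1⟩ := one_side d hd hdep ho
  obtain ⟨m2, h2⟩ := one_side (fun q x => -d q x) (fun q => (hd q).neg)
    (fun q x y hxy => by simp [hdep q hxy])
    (fun q g hg hg2 => by simp [integral_neg, ho q g hg hg2])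
  simp only [Finset.sum_neg_distrib, lpNorm_fun_neg] at h2 m2
  have m3 : MemLp (fun x => runMax (fun j => |∑ q ∈ Finset.range j, d q x|) n) 2 (iidLaw μ) :=
    memLp_runMax (fun j => (memLp_finsetSum _ fun q _ => hd q).abs) n
  -- The two one-sided bounds add up to 8 times the sum, and `8 ≤ 3²`.
  refine le_of_sq_le_sq ?_ (by positivity)
  rw [mul_pow, Real.sq_sqrt (Finset.sum_nonneg fun _ _ => sq_nonneg _), lpNorm_two_sq m3.1]
  have h3 : ∫ x, runMax (fun j => |∑ q ∈ Finset.range j, d q x|) n ^ 2 ∂(iidLaw μ) ≤ _ :=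
    integral_mono m3.integrable_sq (m1.integrable_sq.add m2.integrable_sq)
      fun x => runMax_abs_sq_le (s := fun j => ∑ q ∈ Finset.range j, d q x) (by simp) n
  simp only [Pi.add_apply] at h3
  rw [integral_add m1.integrable_sq m2.integrable_sq] at h3
  have : 0 ≤ ∑ q ∈ Finset.range n, lpNorm (d q) 2 (iidLaw μ) ^ 2 :=
    Finset.sum_nonneg fun _ _ => sq_nonneg _
  linarith

theorem integral_mul_reveal_sub {f g : (ℕ → E) → ℝ} {N N' : ℕ} (hN : N ≤ N')
    (hg : DependsOn g (Set.Iio N)) (hfm : Measurable f) {p q : ℝ≥0∞}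
    [ENNReal.HolderTriple p q 1] (hq : 1 ≤ q) (hq' : q ≠ ∞)
    (hf : MemLp f q (iidLaw μ)) (hgp : MemLp g p (iidLaw μ)) :
    ∫ x, g x * (reveal μ f N' x - reveal μ f N x) ∂(iidLaw μ) = 0 := by
  have i : ∀ {F : (ℕ → E) → ℝ}, MemLp F q (iidLaw μ) →
      Integrable (fun x => g x * F x) (iidLaw μ) := fun hF =>
    memLp_one_iff_integrable.1 (hF.mul' hgp)
  simp only [mul_sub]
  rw [integral_sub (i (memLp_reveal hfm hq hq' hf N')) (i (memLp_reveal hfm hq hq' hf N)),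
    integral_mul_reveal hg (i hf),
    integral_mul_reveal (hg.mono (Set.Iio_subset_Iio hN)) (i hf), sub_self]

/-- A maximal inequality for partial sums of centred functions of an i.i.d. sequence whose
projections onto single coordinates are controlled by the distance to that coordinate. -/
theorem lpNorm_runMax_centered_le {Y : ℕ → (ℕ → E) → ℝ} (hYm : ∀ q, Measurable (Y q))
    (hY : ∀ q, MemLp (Y q) 2 (iidLaw μ)) {n : ℕ} {w c : ℕ → ℝ} (hw : ∀ q, 0 ≤ w q)
    (hc : ∀ s, 0 ≤ c s) (hcs : Summable c)
    (hD : ∀ q < n, ∀ N, lpNorm (fun x => reveal μ (Y q) (N + 1) x - reveal μ (Y q) N x) 2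
      (iidLaw μ) ≤ w q * c (N + n - q)) :
    MemLp (fun x => runMax (fun j => |∑ q ∈ Finset.range j, (Y q x - ∫ y, Y q y ∂(iidLaw μ))|) n) 2
      (iidLaw μ) ∧
    lpNorm (fun x => runMax (fun j => |∑ q ∈ Finset.range j, (Y q x - ∫ y, Y q y ∂(iidLaw μ))|) n) 2
      (iidLaw μ) ≤ 3 * √(∑ q ∈ Finset.range n, w q ^ 2) * ∑' s, c s := by
  have hR : ∀ q N, MemLp (reveal μ (Y q) N) 2 (iidLaw μ) := fun q N =>
    memLp_reveal (hYm q) (by norm_num) (by simp) (hY q) N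
  -- For fixed `s`, the increment of `Y q` at coordinate `q + s - n`. This coordinate moves with
  -- `q`, so each `d s` is a martingale difference sequence in `q`. If `q + s < n`, truncated
  -- subtraction makes both indices 0 and the increment vanishes.
  let d : ℕ → ℕ → (ℕ → E) → ℝ := fun s q x =>
    reveal μ (Y q) (q + s + 1 - n) x - reveal μ (Y q) (q + s - n) x
  have hd : ∀ s q, MemLp (d s q) 2 (iidLaw μ) := fun s q => (hR _ _).sub (hR _ _)
  have hdn : ∀ s, ∀ q < n, lpNorm (d s q) 2 (iidLaw μ) ≤ w q * c s := by
    intro s q hq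
    rcases lt_or_ge (q + s) n with h | h
    · have e : d s q = fun _ => 0 := by
        funext x
        simp [d, show q + s + 1 - n = 0 by omega, show q + s - n = 0 by omega]
      rw [e, lpNorm_fun_zero]
      exact mul_nonneg (hw q) (hc s)
    · have := hD q hq (q + s - n)
      rw [show q + s - n + 1 = q + s + 1 - n by omega, show q + s - n + n - q = s by omega] at this
      exact this
  have hmax : ∀ s, lpNorm (fun x => runMax (fun j => |∑ q ∈ Finset.range j, d s q x|) n) 2
      (iidLaw μ) ≤ 3 * √(∑ q ∈ Finset.range n, w q ^ 2) * c s := by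
    intro s
    have h := lpNorm_runMax_le (μ := μ) (d := d s) (a := fun q => q + s - n)
      (fun i j h => by simp only; omega) (hd s)
      (fun q x y hxy => by
        simp only [d]
        rw [dependsOn_reveal μ (Y q) _ fun i hi => hxy i ?_,
          dependsOn_reveal μ (Y q) _ fun i hi => hxy i ?_]
        · simp only [Set.mem_Iio] at hi ⊢; omega
        · simp only [Set.mem_Iio] at hi ⊢; omega)
      (fun q g hg hg2 => integral_mul_reveal_sub (p := 2) (q := 2) (by omega) hg (hYm q)
        (by norm_num) (by simp) (hY q) hg2) n
    refine h.trans ?_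
    rw [mul_assoc]
    gcongr
    refine Real.sqrt_le_iff.2 ⟨by have := hc s; positivity, ?_⟩
    rw [mul_pow, Real.sq_sqrt (Finset.sum_nonneg fun _ _ => sq_nonneg _), Finset.sum_mul]
    refine Finset.sum_le_sum fun q hq => ?_
    rw [← mul_pow]
    exact pow_le_pow_left₀ lpNorm_nonneg (hdn s q (Finset.mem_range.1 hq)) 2
  -- Sums over the first `T` diagonals: their norms are bounded independently of `T`, and the inner
  -- sums telescope to `reveal` minus the mean, so Fatou gives the claim.
  let F : ℕ → (ℕ → E) → ℝ := fun T x =>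
    runMax (fun j => |∑ q ∈ Finset.range j, ∑ s ∈ Finset.range T, d s q x|) n
  have mdm : ∀ s, MemLp (fun x => runMax (fun j => |∑ q ∈ Finset.range j, d s q x|) n) 2
      (iidLaw μ) := fun s => memLp_runMax (fun j => (memLp_finsetSum _ fun q _ => hd s q).abs) n
  refine memLp_and_lpNorm_le_of_tendsto (f := F) (fun T => ?_) (fun T => ?_) ?_
  · exact memLp_runMax (fun j => (memLp_finsetSum _ fun q _ =>
      memLp_finsetSum _ fun s _ => hd s q).abs) n
  · calc lpNorm (F T) 2 (iidLaw μ) ≤ lpNorm (fun x => ∑ s ∈ Finset.range T,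
          runMax (fun j => |∑ q ∈ Finset.range j, d s q x|) n) 2 (iidLaw μ) := by
          refine lpNorm_mono_real (memLp_finsetSum _ fun s _ => mdm s) fun x => ?_
          simp only [F]
          rw [Real.norm_of_nonneg (runMax_abs_nonneg _ n)]
          simp_rw [Finset.sum_comm (s := Finset.range _) (t := Finset.range T)]
          exact runMax_sum_le (Finset.range T) (fun s j => ∑ q ∈ Finset.range j, d s q x) n
      _ ≤ ∑ s ∈ Finset.range T, 3 * √(∑ q ∈ Finset.range n, w q ^ 2) * c s :=
          (lpNorm_fun_sum_le (fun s _ => mdm s) (by norm_num)).trans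
            (Finset.sum_le_sum fun s _ => hmax s)
      _ ≤ _ := by
          rw [← Finset.mul_sum]
          gcongr
          exact hcs.sum_le_tsum _ fun s _ => hc s
  · have h := ae_all_iff.2 fun q => tendsto_reveal (μ := μ) (hYm q)
      ((hY q).integrable (by norm_num))
    filter_upwards [h] with x hx
    refine tendsto_runMax n fun j hj => (tendsto_finsetSum _ fun q hq => ?_).abs
    have hqn : q < n := (Finset.mem_range.1 hq).trans_le hj
    have e : ∀ T, ∑ s ∈ Finset.range T, d s q x =
        reveal μ (Y q) (q + T - n) x - ∫ y, Y q y ∂(iidLaw μ) := fun T => by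
      rw [← reveal_zero μ (Y q) x]
      refine (Finset.sum_range_sub (fun s => reveal μ (Y q) (q + s - n) x) T).trans ?_
      simp [show q - n = 0 by omega]
    simp_rw [e]
    refine Tendsto.sub_const ((hx q).comp (tendsto_atTop_atTop.2 fun b => ⟨b + n, ?_⟩)) _
    intro T hT; omega

/-- The fourth-moment martingale inequality. -/
theorem lpNorm_four_centered_le {f : (ℕ → E) → ℝ} (hfm : Measurable f)
    (hf : MemLp f 4 (iidLaw μ)) {b : ℕ → ℝ} {B : ℝ}
    (hD : ∀ N, lpNorm (fun x => reveal μ f (N + 1) x - reveal μ f N x) 4 (iidLaw μ) ≤ b N)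
    (hB : ∀ T, ∑ N ∈ Finset.range T, b N ^ 2 ≤ B ^ 2) (hB0 : 0 ≤ B) :
    lpNorm (fun x => f x - ∫ y, f y ∂(iidLaw μ)) 4 (iidLaw μ) ≤ 2 * B := by
  set m := ∫ y, f y ∂(iidLaw μ) with hm
  have hR : ∀ N, MemLp (reveal μ f N) 4 (iidLaw μ) := fun N =>
    memLp_reveal hfm (by norm_num) (by simp) hf N
  have hS : ∀ N, MemLp (fun x => reveal μ f N x - m) 4 (iidLaw μ) := fun N =>
    (hR N).sub (memLp_const m)
  have hDm : ∀ N, MemLp (fun x => reveal μ f (N + 1) x - reveal μ f N x) 4 (iidLaw μ) := fun N =>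
    (hR _).sub (hR _)
  have step : ∀ N, lpNorm (fun x => reveal μ f N x - m) 4 (iidLaw μ) ^ 2 ≤
      4 * ∑ l ∈ Finset.range N, b l ^ 2 := by
    intro N
    induction N with
    | zero => simp [reveal_zero, ← hm]
    | succ N ih =>
      set S : (ℕ → E) → ℝ := fun x => reveal μ f N x - m with hSd
      set D : (ℕ → E) → ℝ := fun x => reveal μ f (N + 1) x - reveal μ f N x with hDd
      have e : (fun x => reveal μ f (N + 1) x - m) = fun x => S x + D x := by
        funext x; simp [hSd, hDd]
      have hSD : MemLp (fun x => S x * D x) 2 (iidLaw μ) := (hDm N).mul' (hS N)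
      have hS2 : MemLp (fun x => S x * S x) 2 (iidLaw μ) := (hS N).mul' (hS N)
      have hD2 : MemLp (fun x => D x * D x) 2 (iidLaw μ) := (hDm N).mul' (hDm N)
      have i1 : Integrable (fun x => S x ^ 4) (iidLaw μ) :=
        hS2.integrable_sq.congr (.of_forall fun x => by ring)
      have i2 : Integrable (fun x => S x ^ 3 * D x) (iidLaw μ) :=
        (hS2.integrable_mul hSD).congr (.of_forall fun x => by simp only [Pi.mul_apply]; ring)
      have i3 : Integrable (fun x => (S x * D x) ^ 2) (iidLaw μ) := hSD.integrable_sq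
      have i4 : Integrable (fun x => D x ^ 4) (iidLaw μ) :=
        hD2.integrable_sq.congr (.of_forall fun x => by ring)
      have hz : ∫ x, S x ^ 3 * D x ∂(iidLaw μ) = 0 := by
        have hdep : DependsOn (fun x => S x ^ 3) (Set.Iio N) := fun x y hxy => by
          simp only [hSd, dependsOn_reveal μ f N hxy]
        have hdi : Integrable (fun x => S x ^ 3 * f x) (iidLaw μ) := by
          have : MemLp (fun x => S x * f x) 2 (iidLaw μ) := hf.mul' (hS N)
          exact (hS2.integrable_mul this).congr
            (.of_forall fun x => by simp only [Pi.mul_apply]; ring)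
        have hdr : ∀ n, Integrable (fun x => S x ^ 3 * reveal μ f n x) (iidLaw μ) := fun n => by
          have : MemLp (fun x => S x * reveal μ f n x) 2 (iidLaw μ) := (hR n).mul' (hS N)
          exact (hS2.integrable_mul this).congr
            (.of_forall fun x => by simp only [Pi.mul_apply]; ring)
        simp only [hDd, mul_sub]
        rw [integral_sub (hdr _) (hdr _), integral_mul_reveal hdep hdi,
          integral_mul_reveal (hdep.mono (Set.Iio_subset_Iio N.le_succ)) hdi, sub_self]
      -- The term `4S³D` has mean zero, `4SD³` is absorbed by `2D²(S - D)² ≥ 0`, and Hölder bounds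
      -- the rest by this square. So squared `L⁴` norms grow additively with factor 4, which is the
      -- origin of the constant 2.
      have key : lpNorm (fun x => S x + D x) 4 (iidLaw μ) ^ 4 ≤
          (lpNorm S 4 (iidLaw μ) ^ 2 + 4 * lpNorm D 4 (iidLaw μ) ^ 2) ^ 2 := by
        have i5 : Integrable (fun x => S x ^ 4 + 4 * (S x ^ 3 * D x)) (iidLaw μ) :=
          i1.add (i2.const_mul 4)
        have i6 : Integrable (fun x => S x ^ 4 + 4 * (S x ^ 3 * D x) + 8 * (S x * D x) ^ 2)
          (iidLaw μ) := i5.add (i3.const_mul 8)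
        have h1 : ∫ x, (S x + D x) ^ 4 ∂(iidLaw μ) ≤ ∫ x, (S x ^ 4 + 4 * (S x ^ 3 * D x) +
            8 * (S x * D x) ^ 2 + 3 * D x ^ 4) ∂(iidLaw μ) := by
          refine integral_mono_of_nonneg (.of_forall fun x => by positivity)
            (i6.add (i4.const_mul 3)) (.of_forall fun x => ?_)
          simp only
          nlinarith [mul_nonneg (sq_nonneg (D x)) (sq_nonneg (S x - D x))]
        rw [integral_add i6 (i4.const_mul 3), integral_add i5 (i3.const_mul 8),
          integral_add i1 (i2.const_mul 4), integral_const_mul, integral_const_mul,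
          integral_const_mul, hz, ← lpNorm_four_pow (hS N).1, ← lpNorm_four_pow (hDm N).1,
          ← lpNorm_two_sq hSD.1] at h1
        have h0 : lpNorm (fun x => S x + D x) 4 (iidLaw μ) ^ 4 = ∫ x, (S x + D x) ^ 4 ∂(iidLaw μ) :=
          lpNorm_four_pow ((hS N).add (hDm N)).1
        rw [h0]
        have h2 := pow_le_pow_left₀ lpNorm_nonneg (lpNorm_mul_le 2 (hS N) (hDm N)) 2
        refine h1.trans ?_
        have h3 : 0 ≤ lpNorm D 4 (iidLaw μ) ^ 4 := by positivity
        change lpNorm (fun x => S x * D x) 2 (iidLaw μ) ^ 2 ≤ _ at h2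
        change lpNorm S 4 (iidLaw μ) ^ 4 + 4 * 0 +
          8 * lpNorm (fun x => S x * D x) 2 (iidLaw μ) ^ 2 + 3 * lpNorm D 4 (iidLaw μ) ^ 4 ≤ _
        nlinarith
      rw [e, Finset.sum_range_succ]
      have h5 : lpNorm (fun x => S x + D x) 4 (iidLaw μ) ^ 2 ≤
          lpNorm S 4 (iidLaw μ) ^ 2 + 4 * lpNorm D 4 (iidLaw μ) ^ 2 :=
        le_of_sq_le_sq (by rw [← pow_mul]; exact key) (by positivity)
      have h6 := pow_le_pow_left₀ lpNorm_nonneg (hD N) 2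
      change lpNorm D 4 (iidLaw μ) ^ 2 ≤ _ at h6
      linarith
  refine (memLp_and_lpNorm_le_of_tendsto hS (fun N => ?_) ?_).2
  · refine le_of_sq_le_sq ?_ (by positivity)
    have := step N
    have := hB N
    nlinarith
  · filter_upwards [tendsto_reveal (μ := μ) hfm (hf.integrable (by norm_num))] with x hx
    exact hx.sub_const m

theorem lpNorm_sub_sq {Ω : Type*} [MeasurableSpace Ω] {P : Measure Ω} {f g : Ω → ℝ}
    (hf : MemLp f 2 P) (hg : MemLp g 2 P) :
    lpNorm (fun x => f x - g x) 2 P ^ 2 =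
      lpNorm f 2 P ^ 2 - 2 * ∫ x, g x * f x ∂P + lpNorm g 2 P ^ 2 := by
  have i : Integrable (fun x => 2 * (g x * f x)) P := (hg.integrable_mul hf).const_mul 2
  have h : lpNorm (fun x => f x - g x) 2 P ^ 2 = ∫ x, (f x - g x) ^ 2 ∂P :=
    lpNorm_two_sq (hf.sub hg).1
  rw [h, lpNorm_two_sq hf.1, lpNorm_two_sq hg.1, ← integral_const_mul,
    ← integral_sub hf.integrable_sq i]
  refine Eq.trans (integral_congr_ae (.of_forall fun x => ?_))
    (integral_add (hf.integrable_sq.sub i) hg.integrable_sq)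
  beta_reduce; ring

/-- `L²` convergence of the conditional expectations given the first coordinates. -/
theorem tendsto_lpNorm_sub_reveal {f : (ℕ → E) → ℝ} (hfm : Measurable f)
    (hf : MemLp f 2 (iidLaw μ)) :
    Tendsto (fun N => lpNorm (fun x => f x - reveal μ f N x) 2 (iidLaw μ)) atTop (nhds 0) := by
  have hR : ∀ N, MemLp (reveal μ f N) 2 (iidLaw μ) := fun N =>
    memLp_reveal hfm (by norm_num) (by simp) hf N
  set a : ℕ → ℝ := fun N => lpNorm (reveal μ f N) 2 (iidLaw μ) with ha
  have hfR : ∀ N, ∫ x, reveal μ f N x * f x ∂(iidLaw μ) = a N ^ 2 := fun N => by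
    rw [ha, lpNorm_two_sq (hR N).1,
      ← integral_mul_reveal (dependsOn_reveal μ f N) ((hR N).integrable_mul hf)]
    simp only [sq]
  have h1 : ∀ N, lpNorm (fun x => f x - reveal μ f N x) 2 (iidLaw μ) ^ 2 =
      lpNorm f 2 (iidLaw μ) ^ 2 - a N ^ 2 := fun N => by
    rw [lpNorm_sub_sq hf (hR N), hfR]; ring
  have hmono : Monotone fun N => a N ^ 2 := by
    refine monotone_nat_of_le_succ fun N => ?_
    have h := lpNorm_sub_sq (hR (N + 1)) (hR N)
    have h2 : ∫ x, reveal μ f N x * reveal μ f (N + 1) x ∂(iidLaw μ) = a N ^ 2 := by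
      rw [integral_mul_reveal ((dependsOn_reveal μ f N).mono (Set.Iio_subset_Iio N.le_succ))
        ((hR N).integrable_mul hf), hfR]
    rw [h2] at h
    have := sq_nonneg (lpNorm (fun x => reveal μ f (N + 1) x - reveal μ f N x) 2 (iidLaw μ))
    simp only [ha] at *
    linarith
  have hbdd : ∀ N, a N ^ 2 ≤ lpNorm f 2 (iidLaw μ) ^ 2 := fun N => by
    have := sq_nonneg (lpNorm (fun x => f x - reveal μ f N x) 2 (iidLaw μ))
    rw [h1] at this; linarith
  have hb : BddAbove (Set.range fun N => a N ^ 2) := ⟨_, by rintro _ ⟨N, rfl⟩; exact hbdd N⟩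
  have hlim := tendsto_atTop_ciSup hmono hb
  -- By orthogonality the norms of the projections increase and stay below that of `f`; almost sure
  -- convergence and Fatou rule out a smaller limit.
  have hL : ⨆ N, a N ^ 2 = lpNorm f 2 (iidLaw μ) ^ 2 := by
    refine le_antisymm (ciSup_le hbdd) ?_
    have hL0 : 0 ≤ ⨆ N, a N ^ 2 := (sq_nonneg (a 0)).trans (le_ciSup hb 0)
    have := (memLp_and_lpNorm_le_of_tendsto (C := √(⨆ N, a N ^ 2)) hR (fun N =>
      Real.le_sqrt_of_sq_le (le_ciSup hb N))
      (tendsto_reveal hfm (hf.integrable (by norm_num)))).2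
    exact (Real.le_sqrt lpNorm_nonneg hL0).1 this
  rw [hL] at hlim
  have h2 := (tendsto_const_nhds (x := lpNorm f 2 (iidLaw μ) ^ 2)).sub hlim
  rw [sub_self] at h2
  have h3 := (Real.continuous_sqrt.tendsto 0).comp (h2.congr fun N => (h1 N).symm)
  simpa [Function.comp_def, Real.sqrt_sq lpNorm_nonneg] using h3

/-- Covariances are bounded through the projections onto single coordinates. -/
theorem abs_integral_mul_le_of_reveal {f g : (ℕ → E) → ℝ} (hfm : Measurable f) (hgm : Measurable g)
    (hf : MemLp f 2 (iidLaw μ)) (hg : MemLp g 2 (iidLaw μ)) (hf0 : ∫ x, f x ∂(iidLaw μ) = 0)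
    {b b' : ℕ → ℝ} {B : ℝ}
    (hb : ∀ N, lpNorm (fun x => reveal μ f (N + 1) x - reveal μ f N x) 2 (iidLaw μ) ≤ b N)
    (hb' : ∀ N, lpNorm (fun x => reveal μ g (N + 1) x - reveal μ g N x) 2 (iidLaw μ) ≤ b' N)
    (hB : ∀ T, ∑ N ∈ Finset.range T, b N * b' N ≤ B) :
    |∫ x, f x * g x ∂(iidLaw μ)| ≤ B := by
  have hR : ∀ N, MemLp (reveal μ f N) 2 (iidLaw μ) := fun N =>
    memLp_reveal hfm (by norm_num) (by simp) hf N
  have hR' : ∀ N, MemLp (reveal μ g N) 2 (iidLaw μ) := fun N =>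
    memLp_reveal hgm (by norm_num) (by simp) hg N
  have h1 : ∀ N, |∫ x, reveal μ f N x * reveal μ g N x ∂(iidLaw μ)| ≤
      ∑ l ∈ Finset.range N, b l * b' l := by
    intro N
    induction N with
    | zero => simp [reveal_zero, hf0]
    | succ N ih =>
      rw [Finset.sum_range_succ]
      have e : ∀ x, reveal μ f (N + 1) x * reveal μ g (N + 1) x =
          reveal μ f N x * reveal μ g N x
          + reveal μ f N x * (reveal μ g (N + 1) x - reveal μ g N x)
          + reveal μ g N x * (reveal μ f (N + 1) x - reveal μ f N x)
          + (reveal μ f (N + 1) x - reveal μ f N x) * (reveal μ g (N + 1) x - reveal μ g N x) :=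
        fun x => by ring
      have i1 := (hR N).integrable_mul (hR' N)
      have i2 := (hR N).integrable_mul ((hR' (N + 1)).sub (hR' N))
      have i3 := (hR' N).integrable_mul ((hR (N + 1)).sub (hR N))
      have i4 := ((hR (N + 1)).sub (hR N)).integrable_mul ((hR' (N + 1)).sub (hR' N))
      -- The mixed terms vanish: an increment is orthogonal to whatever the first `N` coordinates
      -- determine.
      have h : ∫ x, reveal μ f (N + 1) x * reveal μ g (N + 1) x ∂(iidLaw μ) =
          (∫ x, reveal μ f N x * reveal μ g N x ∂(iidLaw μ)) + 0 + 0 +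
          ∫ x, (reveal μ f (N + 1) x - reveal μ f N x) *
            (reveal μ g (N + 1) x - reveal μ g N x) ∂(iidLaw μ) := by
        simp_rw [e]
        have z2 := integral_mul_reveal_sub (p := 2) (q := 2) N.le_succ (dependsOn_reveal μ f N) hgm
            (by norm_num) (by simp) hg (hR N)
        have z3 := integral_mul_reveal_sub (p := 2) (q := 2) N.le_succ (dependsOn_reveal μ g N) hfm
            (by norm_num) (by simp) hf (hR' N)
        have h := integral_add' ((i1.add i2).add i3) i4
        rw [integral_add' (i1.add i2) i3, integral_add' i1 i2] at h
        simp only [Pi.add_apply, Pi.mul_apply, Pi.sub_apply] at h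
        rw [h, z2, z3]
      rw [h, add_zero, add_zero]
      refine (abs_add_le _ _).trans (add_le_add ih ?_)
      refine (abs_integral_mul_le ((hR (N + 1)).sub (hR N)) ((hR' (N + 1)).sub (hR' N))).trans ?_
      exact mul_le_mul (hb N) (hb' N) lpNorm_nonneg (lpNorm_nonneg.trans (hb N))
  -- Only `f` has to be approximated: against `reveal μ f N`, the function `g` may be exchanged for
  -- `reveal μ g N` without error.
  have h2 : ∀ N, |∫ x, f x * g x ∂(iidLaw μ)| ≤
      B + lpNorm (fun x => f x - reveal μ f N x) 2 (iidLaw μ) * lpNorm g 2 (iidLaw μ) := by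
    intro N
    have e : ∫ x, f x * g x ∂(iidLaw μ) = (∫ x, reveal μ f N x * reveal μ g N x ∂(iidLaw μ)) +
        ∫ x, (f x - reveal μ f N x) * g x ∂(iidLaw μ) := by
      have i1 := (hR N).integrable_mul hg
      have i2 := (hf.sub (hR N)).integrable_mul hg
      rw [integral_mul_reveal (dependsOn_reveal μ f N) i1]
      change _ = ∫ x, (reveal μ f N * g) x ∂(iidLaw μ) + ∫ x, ((f - reveal μ f N) * g) x ∂(iidLaw μ)
      rw [← integral_add i1 i2]
      refine integral_congr_ae (.of_forall fun x => ?_)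
      simp only [Pi.mul_apply, Pi.sub_apply]; ring
    rw [e]
    refine (abs_add_le _ _).trans (add_le_add ((h1 N).trans (hB N)) ?_)
    exact abs_integral_mul_le (hf.sub (hR N)) hg
  have h3 := ((tendsto_lpNorm_sub_reveal hfm hf).mul_const (lpNorm g 2 (iidLaw μ))).const_add B
  rw [zero_mul, add_zero] at h3
  exact ge_of_tendsto' h3 h2

end Martingale

/-! ### Resampling one coordinate. -/

section DepNorm

variable {E : Type*} [MeasurableSpace E] (μ : Measure E) [IsProbabilityMeasure μ]

/-- Precomposed with the exchange of tails this map is `splice N`, whose law is known. -/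
theorem measurePreserving_updateAt (N : ℕ) :
    MeasurePreserving (fun q : (ℕ → E) × (ℕ → E) => Function.update q.1 N (q.2 N))
      ((iidLaw μ).prod (iidLaw μ)) (iidLaw μ) := by
  refine ⟨measurable_updateAt N, ?_⟩
  have h := measurePreserving_splice_swap μ (N + 1)
  rw [← h.map_eq, Measure.map_map (measurable_updateAt N) h.measurable]
  refine Eq.trans ?_ (measurePreserving_splice μ N).map_eq
  congr 1
  funext q
  simp only [Function.comp, update_splice_swap]

/-- The `L^p` norm of the change of `f` when its `N`-th coordinate is replaced by an independent
copy. -/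
def depNorm (p : ℝ≥0∞) (f : (ℕ → E) → ℝ) (N : ℕ) : ℝ :=
  lpNorm (fun q : (ℕ → E) × (ℕ → E) => f q.1 - f (Function.update q.1 N (q.2 N))) p
    ((iidLaw μ).prod (iidLaw μ))

variable {μ}

theorem depNorm_nonneg (p : ℝ≥0∞) (f : (ℕ → E) → ℝ) (N : ℕ) : 0 ≤ depNorm μ p f N := lpNorm_nonneg

theorem lpNorm_comp_measurePreserving {X Y : Type*} [MeasurableSpace X] [MeasurableSpace Y]
    {κ : Measure X} {ρ : Measure Y} {T : X → Y} (hT : MeasurePreserving T κ ρ) {f : Y → ℝ}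
    (hf : AEStronglyMeasurable f ρ) (p : ℝ≥0∞) : lpNorm (fun x => f (T x)) p κ = lpNorm f p ρ := by
  rw [← toReal_eLpNorm hf, ← eLpNorm_comp_measurePreserving hf hT,
    toReal_eLpNorm (hf.comp_measurePreserving hT)]
  rfl

theorem memLp_fst {f : (ℕ → E) → ℝ} {p : ℝ≥0∞} (hf : MemLp f p (iidLaw μ)) :
    MemLp (fun q : (ℕ → E) × (ℕ → E) => f q.1) p ((iidLaw μ).prod (iidLaw μ)) :=
  hf.comp_measurePreserving measurePreserving_fst

theorem memLp_update {f : (ℕ → E) → ℝ} {p : ℝ≥0∞} (hf : MemLp f p (iidLaw μ)) (N : ℕ) :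
    MemLp (fun q : (ℕ → E) × (ℕ → E) => f (Function.update q.1 N (q.2 N))) p
      ((iidLaw μ).prod (iidLaw μ)) :=
  hf.comp_measurePreserving (measurePreserving_updateAt μ N)

theorem memLp_dep {f : (ℕ → E) → ℝ} {p : ℝ≥0∞} (hf : MemLp f p (iidLaw μ)) (N : ℕ) :
    MemLp (fun q : (ℕ → E) × (ℕ → E) => f q.1 - f (Function.update q.1 N (q.2 N))) p
      ((iidLaw μ).prod (iidLaw μ)) :=
  (memLp_fst hf).sub (memLp_update hf N)

theorem lpNorm_reveal_sub_le {f : (ℕ → E) → ℝ} (hfm : Measurable f) {p : ℝ≥0∞} (hp : 1 ≤ p)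
    (hp' : p ≠ ∞) (hf : MemLp f p (iidLaw μ)) (N : ℕ) :
    lpNorm (fun x => reveal μ f (N + 1) x - reveal μ f N x) p (iidLaw μ) ≤ depNorm μ p f N := by
  refine lpNorm_le_of_eLpNorm_le (depNorm_nonneg p f N) ?_
  rw [depNorm, ofReal_lpNorm (memLp_dep hf N)]
  exact eLpNorm_reveal_sub_le hfm (hf.integrable hp) hp hp' N

theorem depNorm_sum_le {ι : Type*} {J : Finset ι} {f : ι → (ℕ → E) → ℝ} {p : ℝ≥0∞} (hp : 1 ≤ p)
    (hf : ∀ i ∈ J, MemLp (f i) p (iidLaw μ)) (N : ℕ) :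
    depNorm μ p (fun x => ∑ i ∈ J, f i x) N ≤ ∑ i ∈ J, depNorm μ p (f i) N := by
  simp only [depNorm, ← Finset.sum_sub_distrib]
  exact lpNorm_fun_sum_le (fun i hi => memLp_dep (hf i hi) N) hp

theorem depNorm_const_mul (c : ℝ) (f : (ℕ → E) → ℝ) (p : ℝ≥0∞) (N : ℕ) :
    depNorm μ p (fun x => c * f x) N = |c| * depNorm μ p f N := by
  simp only [depNorm, ← mul_sub]
  exact lpNorm_const_mul c _ p

/-- Product rule with Hölder exponents 4, 4 and 2; the resampled factor keeps the norm of the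
original one. -/
theorem depNorm_mul_le {f g : (ℕ → E) → ℝ} (hf : MemLp f 4 (iidLaw μ)) (hg : MemLp g 4 (iidLaw μ))
    (N : ℕ) : depNorm μ 2 (fun x => f x * g x) N ≤
      lpNorm f 4 (iidLaw μ) * depNorm μ 4 g N + depNorm μ 4 f N * lpNorm g 4 (iidLaw μ) := by
  have e : (fun q : (ℕ → E) × (ℕ → E) => f q.1 * g q.1 -
      f (Function.update q.1 N (q.2 N)) * g (Function.update q.1 N (q.2 N))) =
      (fun q => f q.1 * (g q.1 - g (Function.update q.1 N (q.2 N)))) +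
      fun q => (f q.1 - f (Function.update q.1 N (q.2 N))) * g (Function.update q.1 N (q.2 N)) := by
    funext q; simp only [Pi.add_apply]; ring
  have h1 := lpNorm_mul_le 2 (memLp_fst hf) (memLp_dep hg N)
  have h2 := lpNorm_mul_le 2 (memLp_dep hf N) (memLp_update hg N)
  rw [lpNorm_comp_measurePreserving measurePreserving_fst hf.1] at h1
  rw [lpNorm_comp_measurePreserving (measurePreserving_updateAt μ N) hg.1] at h2
  rw [depNorm, e]
  have hm : MemLp (fun q : (ℕ → E) × (ℕ → E) =>
      f q.1 * (g q.1 - g (Function.update q.1 N (q.2 N)))) 2 ((iidLaw μ).prod (iidLaw μ)) :=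
    (memLp_dep hg N).mul' (memLp_fst hf)
  exact (lpNorm_add_le hm (by norm_num)).trans (add_le_add h1 h2)

theorem shiftSeq_update_of_lt {E : Type*} {N k : ℕ} (h : N < k) (x : ℕ → E) (v : E) :
    shiftSeq k (Function.update x N v) = shiftSeq k x := by
  funext l
  simp only [shiftSeq]
  rw [Function.update_of_ne (by omega)]

theorem shiftSeq_update {E : Type*} {N k : ℕ} (h : k ≤ N) (x : ℕ → E) (v : E) :
    shiftSeq k (Function.update x N v) = Function.update (shiftSeq k x) (N - k) v := by
  funext l
  by_cases hl : l = N - k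
  · subst hl; simp [shiftSeq, Nat.sub_add_cancel h]
  · rw [Function.update_of_ne hl]
    simp only [shiftSeq]
    rw [Function.update_of_ne (by omega)]

theorem depNorm_shiftSeq_of_lt (f : (ℕ → E) → ℝ) (p : ℝ≥0∞) {N k : ℕ} (h : N < k) :
    depNorm μ p (fun x => f (shiftSeq k x)) N = 0 := by
  simp [depNorm, shiftSeq_update_of_lt h]

theorem depNorm_shiftSeq {f : (ℕ → E) → ℝ} (hf : Measurable f) (p : ℝ≥0∞) {N k : ℕ} (h : k ≤ N) :
    depNorm μ p (fun x => f (shiftSeq k x)) N = depNorm μ p f (N - k) := by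
  have hp := (measurePreserving_shiftSeq μ k).prod (measurePreserving_shiftSeq μ k)
  have hm : Measurable fun q : (ℕ → E) × (ℕ → E) =>
      f q.1 - f (Function.update q.1 (N - k) (q.2 (N - k))) :=
    (hf.comp measurable_fst).sub (hf.comp (measurable_updateAt _))
  simp only [depNorm]
  rw [← lpNorm_comp_measurePreserving hp hm.aestronglyMeasurable]
  congr 1
  funext q
  simp only [shiftSeq_update h, Prod.map]
  simp [shiftSeq, Nat.sub_add_cancel h]

end DepNorm

/-! ### Summability of the covariance bounds. -/

section Ext

/-- Extension by zero to the integers. -/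
def extZ (δ : ℕ → ℝ) (v : ℤ) : ℝ := if 0 ≤ v then δ v.toNat else 0

theorem extZ_natCast (δ : ℕ → ℝ) (v : ℕ) : extZ δ v = δ v := by simp [extZ]

theorem extZ_nonneg {δ : ℕ → ℝ} (h : ∀ j, 0 ≤ δ j) (v : ℤ) : 0 ≤ extZ δ v := by
  unfold extZ; split_ifs
  · exact h _
  · exact le_rfl

theorem summable_extZ {δ : ℕ → ℝ} (h : Summable δ) : Summable (extZ δ) := by
  have hinj : Function.Injective ((↑) : ℕ → ℤ) := Nat.cast_injective
  rw [← hinj.summable_iff (fun x hx => ?_)]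
  · refine h.congr fun v => (extZ_natCast δ v).symm
  · unfold extZ
    rw [if_neg]
    exact fun h0 => hx ⟨x.toNat, Int.toNat_of_nonneg h0⟩

theorem sum_le_tsum_of_injOn {ι κ : Type*} {J : Finset ι} {φ : ι → κ} {f : κ → ℝ}
    (hf : Summable f) (h0 : ∀ v, 0 ≤ f v) (hφ : Set.InjOn φ J) :
    ∑ u ∈ J, f (φ u) ≤ ∑' v, f v := by
  classical
  rw [← Finset.sum_image (f := f) hφ]
  exact hf.sum_le_tsum _ fun v _ => h0 v

/-- The bound on the covariance at lag `j`. -/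
def covBound (δ : ℕ → ℝ) (j : ℤ) : ℝ := ∑' N : ℤ, extZ δ N * extZ δ (N + j)

/-- In the variables `N` and `N + j` the summand is dominated by a product of two summable
sequences, because `1 + |j| ≤ (1 + |N|)(1 + |N + j|)`. -/
theorem summable_covBound_aux {δ : ℕ → ℝ} (h0 : ∀ j, 0 ≤ δ j)
    (h : Summable fun j : ℕ => (1 + (j : ℝ)) * δ j) :
    Summable fun x : ℤ × ℤ => (1 + |(x.1 : ℝ)|) * (extZ δ x.2 * extZ δ (x.2 + x.1)) := by
  have hρ : Summable fun v : ℤ => (1 + |(v : ℝ)|) * extZ δ v := by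
    refine (summable_extZ h).congr fun v => ?_
    unfold extZ
    split_ifs with hv
    · lift v to ℕ using hv
      simp
    · simp
  have hρ0 : ∀ v : ℤ, 0 ≤ (1 + |(v : ℝ)|) * extZ δ v := fun v =>
    mul_nonneg (by positivity) (extZ_nonneg h0 v)
  have h1 := hρ.mul_of_nonneg hρ hρ0 hρ0
  have hinj : Function.Injective fun x : ℤ × ℤ => (x.2, x.2 + x.1) := by
    rintro ⟨a, b⟩ ⟨c, d⟩ h
    simp only [Prod.mk.injEq] at h ⊢
    omega
  refine Summable.of_nonneg_of_le (fun x => ?_) (fun x => ?_) (h1.comp_injective hinj)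
  · exact mul_nonneg (by positivity) (mul_nonneg (extZ_nonneg h0 _) (extZ_nonneg h0 _))
  · simp only [Function.comp]
    have h2 : (1 + |(x.1 : ℝ)|) ≤ (1 + |(x.2 : ℝ)|) * (1 + |((x.2 + x.1 : ℤ) : ℝ)|) := by
      push_cast
      have : |(x.1 : ℝ)| ≤ |(x.2 : ℝ) + x.1| + |(x.2 : ℝ)| := by
        have := abs_sub ((x.2 : ℝ) + x.1) x.2
        simpa using this
      nlinarith [abs_nonneg (x.2 : ℝ), abs_nonneg ((x.2 : ℝ) + x.1)]
    calc _ ≤ ((1 + |(x.2 : ℝ)|) * (1 + |((x.2 + x.1 : ℤ) : ℝ)|)) *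
          (extZ δ x.2 * extZ δ (x.2 + x.1)) := by
          gcongr
          exact mul_nonneg (extZ_nonneg h0 _) (extZ_nonneg h0 _)
      _ = _ := by ring

theorem summable_covBound {δ : ℕ → ℝ} (h0 : ∀ j, 0 ≤ δ j)
    (h : Summable fun j : ℕ => (1 + (j : ℝ)) * δ j) :
    Summable fun j : ℤ => (1 + |(j : ℝ)|) * covBound δ j := by
  have := (summable_covBound_aux h0 h).prod
  refine this.congr fun j => ?_
  simp only [covBound, tsum_mul_left]

theorem summable_covBound_factor {δ : ℕ → ℝ} (h0 : ∀ j, 0 ≤ δ j)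
    (h : Summable fun j : ℕ => (1 + (j : ℝ)) * δ j) (j : ℤ) :
    Summable fun N : ℤ => extZ δ N * extZ δ (N + j) := by
  have h1 := (summable_covBound_aux h0 h).prod_factor j
  have h2 : (1 + |(j : ℝ)|) ≠ 0 := by positivity
  exact (summable_mul_left_iff h2).1 h1

theorem covBound_nonneg {δ : ℕ → ℝ} (h0 : ∀ j, 0 ≤ δ j) (j : ℤ) : 0 ≤ covBound δ j :=
  tsum_nonneg fun N => mul_nonneg (extZ_nonneg h0 N) (extZ_nonneg h0 _)

end Ext

/-! ### Block sums: moments, dependence, maximal inequality. -/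

section Blocks

variable {E : Type*} [MeasurableSpace E] {μ : Measure E} [IsProbabilityMeasure μ]

/-- A pair of centred filters that are Lipschitz in time and short-range dependent. -/
structure FilterBounds (μ : Measure E) [IsProbabilityMeasure μ]
    (L : Fin 2 → ℝ → (ℕ → E) → ℝ) (Λ : ℝ) (δ : ℕ → ℝ) : Prop where
  meas : ∀ a, ∀ t ∈ Set.Icc (0 : ℝ) 1, Measurable (L a t)
  memLp : ∀ a, ∀ t ∈ Set.Icc (0 : ℝ) 1, MemLp (L a t) 4 (iidLaw μ)
  mean : ∀ a, ∀ t ∈ Set.Icc (0 : ℝ) 1, ∫ x, L a t x ∂(iidLaw μ) = 0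
  lip_nonneg : 0 ≤ Λ
  lip : ∀ a, ∀ t ∈ Set.Icc (0 : ℝ) 1, ∀ s ∈ Set.Icc (0 : ℝ) 1,
    lpNorm (fun x => L a t x - L a s x) 2 (iidLaw μ) ≤ Λ * |t - s|
  dep : ∀ a, ∀ t ∈ Set.Icc (0 : ℝ) 1, ∀ j, depNorm μ 4 (L a t) j ≤ δ j
  nonneg : ∀ j, 0 ≤ δ j
  summable : Summable fun j : ℕ => (1 + (j : ℝ)) * δ j

namespace FilterBounds

variable {L : Fin 2 → ℝ → (ℕ → E) → ℝ} {Λ : ℝ} {δ : ℕ → ℝ}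

theorem summable_extZ (hL : FilterBounds μ L Λ δ) : Summable (extZ δ) :=
  LocStat.summable_extZ <| Summable.of_nonneg_of_le hL.nonneg
    (fun j => by nlinarith [hL.nonneg j, (Nat.cast_nonneg j : (0 : ℝ) ≤ j)]) hL.summable

theorem dep_shift (hL : FilterBounds μ L Λ δ) (a : Fin 2) {t : ℝ} (ht : t ∈ Set.Icc (0 : ℝ) 1)
    (k N : ℕ) : depNorm μ 4 (fun x => L a t (shiftSeq k x)) N ≤ extZ δ ((N : ℤ) - k) := by
  rcases lt_or_ge N k with h | h
  · rw [depNorm_shiftSeq_of_lt _ _ h]; exact extZ_nonneg hL.nonneg _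
  · rw [depNorm_shiftSeq (hL.meas a t ht) _ h, ← Nat.cast_sub h, extZ_natCast]
    exact hL.dep a t ht _

theorem memLp_shift (hL : FilterBounds μ L Λ δ) (a : Fin 2) {t : ℝ} (ht : t ∈ Set.Icc (0 : ℝ) 1)
    (k : ℕ) : MemLp (fun x => L a t (shiftSeq k x)) 4 (iidLaw μ) :=
  (hL.memLp a t ht).comp_measurePreserving (measurePreserving_shiftSeq μ k)

theorem meas_shift (hL : FilterBounds μ L Λ δ) (a : Fin 2) {t : ℝ} (ht : t ∈ Set.Icc (0 : ℝ) 1)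
    (k : ℕ) : Measurable fun x => L a t (shiftSeq k x) :=
  (hL.meas a t ht).comp (measurable_shiftSeq k)

theorem mean_shift (hL : FilterBounds μ L Λ δ) (a : Fin 2) {t : ℝ} (ht : t ∈ Set.Icc (0 : ℝ) 1)
    (k : ℕ) : ∫ x, L a t (shiftSeq k x) ∂(iidLaw μ) = 0 := by
  have h := measurePreserving_shiftSeq μ k
  rw [← hL.mean a t ht]
  conv_rhs => rw [← h.map_eq]
  refine (integral_map (f := L a t) h.measurable.aemeasurable ?_).symm
  rw [h.map_eq]; exact (hL.memLp a t ht).1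

/-- Sums of shifted filters have a fourth moment norm of the order of the square root of the number
of terms. -/
theorem lpNorm_sum_le (hL : FilterBounds μ L Λ δ) (a : Fin 2) {J : Finset ℕ} {t : ℕ → ℝ}
    {p : ℕ → ℕ} (ht : ∀ u ∈ J, t u ∈ Set.Icc (0 : ℝ) 1) (hp : Set.InjOn p J) :
    lpNorm (fun x => ∑ u ∈ J, L a (t u) (shiftSeq (p u) x)) 4 (iidLaw μ) ≤
      2 * ((∑' v, extZ δ v) * √(J.card : ℝ)) := by
  set A := ∑' v, extZ δ v with hA
  have hA0 : 0 ≤ A := tsum_nonneg fun v => extZ_nonneg hL.nonneg v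
  have hm : ∀ u ∈ J, MemLp (fun x => L a (t u) (shiftSeq (p u) x)) 4 (iidLaw μ) := fun u hu =>
    hL.memLp_shift a (ht u hu) _
  have hF : MemLp (fun x => ∑ u ∈ J, L a (t u) (shiftSeq (p u) x)) 4 (iidLaw μ) :=
    memLp_finsetSum _ hm
  have hFm : Measurable (fun x => ∑ u ∈ J, L a (t u) (shiftSeq (p u) x)) :=
    Finset.measurable_sum _ fun u hu => hL.meas_shift a (ht u hu) _
  have h0 : ∫ x, ∑ u ∈ J, L a (t u) (shiftSeq (p u) x) ∂(iidLaw μ) = 0 := by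
    rw [integral_finsetSum _ fun u hu => (hm u hu).integrable (by norm_num)]
    exact Finset.sum_eq_zero fun u hu => hL.mean_shift a (ht u hu) _
  have h := lpNorm_four_centered_le (μ := μ) hFm hF
    (b := fun N => ∑ u ∈ J, extZ δ ((N : ℤ) - p u)) (B := A * √(J.card : ℝ))
    (fun N => (lpNorm_reveal_sub_le hFm (by norm_num) (by simp) hF N).trans
      ((depNorm_sum_le (by norm_num) hm N).trans
        (Finset.sum_le_sum fun u hu => hL.dep_shift a (ht u hu) _ N))) ?_ (by positivity)
  · simpa [h0] using h
  · intro T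
    have hb : ∀ N : ℕ, ∑ u ∈ J, extZ δ ((N : ℤ) - p u) ≤ A := fun N =>
      sum_le_tsum_of_injOn (φ := fun u => (N : ℤ) - p u) hL.summable_extZ
        (extZ_nonneg hL.nonneg) fun u hu v hv huv => hp hu hv (by simp only at huv; omega)
    have hb0 : ∀ N : ℕ, 0 ≤ ∑ u ∈ J, extZ δ ((N : ℤ) - p u) := fun N =>
      Finset.sum_nonneg fun u _ => extZ_nonneg hL.nonneg _
    -- One factor of the square is at most `A` because the positions `p u` are distinct; in the
    -- other, summing over `N` first gives at most `A` for each `u`.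
    calc ∑ N ∈ Finset.range T, (∑ u ∈ J, extZ δ ((N : ℤ) - p u)) ^ 2
        ≤ ∑ N ∈ Finset.range T, A * ∑ u ∈ J, extZ δ ((N : ℤ) - p u) :=
          Finset.sum_le_sum fun N _ => by
            rw [sq]; exact mul_le_mul_of_nonneg_right (hb N) (hb0 N)
      _ = A * ∑ u ∈ J, ∑ N ∈ Finset.range T, extZ δ ((N : ℤ) - p u) := by
          rw [← Finset.mul_sum, Finset.sum_comm]
      _ ≤ A * ∑ u ∈ J, A := by
          gcongr with u hu
          exact sum_le_tsum_of_injOn (φ := fun N : ℕ => (N : ℤ) - p u) hL.summable_extZ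
            (extZ_nonneg hL.nonneg) fun N _ N' _ h => by simp only at h; omega
      _ = (A * √(J.card : ℝ)) ^ 2 := by
          rw [mul_pow, Real.sq_sqrt (Nat.cast_nonneg _)]; simp; ring

/-- Coordinate `N` is at distance `N - p` from one filter and `N - p'` from the other, so the
products of the projection bounds are terms of `covBound δ (p - p')`. -/
theorem abs_integral_shift_mul_le (hL : FilterBounds μ L Λ δ) (a b : Fin 2) {t s : ℝ}
    (ht : t ∈ Set.Icc (0 : ℝ) 1) (hs : s ∈ Set.Icc (0 : ℝ) 1) (p p' : ℕ) :
    |∫ x, L a t (shiftSeq p x) * L b s (shiftSeq p' x) ∂(iidLaw μ)| ≤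
      covBound δ ((p : ℤ) - p') := by
  have m1 := hL.memLp_shift a ht p
  have m2 := hL.memLp_shift b hs p'
  have h24 : (2 : ℝ≥0∞) ≤ 4 := by norm_num
  have hb : ∀ (a : Fin 2) (t : ℝ), t ∈ Set.Icc (0 : ℝ) 1 → ∀ p N : ℕ,
      lpNorm (fun x => reveal μ (fun x => L a t (shiftSeq p x)) (N + 1) x -
        reveal μ (fun x => L a t (shiftSeq p x)) N x) 2 (iidLaw μ) ≤ extZ δ ((N : ℤ) - p) := by
    intro a t ht p N
    have m := hL.memLp_shift a ht p
    have hm := hL.meas_shift a ht p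
    have hr := fun N => memLp_reveal hm (by norm_num) (by simp) m N
    exact (lpNorm_le_lpNorm_of_exponent_le h24 ((hr (N + 1)).sub (hr N))).trans
      ((lpNorm_reveal_sub_le hm (by norm_num) (by simp) m N).trans (hL.dep_shift a ht p N))
  refine abs_integral_mul_le_of_reveal (hL.meas_shift a ht p) (hL.meas_shift b hs p')
    (m1.mono_exponent h24) (m2.mono_exponent h24) (hL.mean_shift a ht p) (hb a t ht p)
    (hb b s hs p') fun T => ?_
  have h := sum_le_tsum_of_injOn (J := Finset.range T) (φ := fun N : ℕ => (N : ℤ) - p)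
    (summable_covBound_factor hL.nonneg hL.summable ((p : ℤ) - p'))
    (fun N => mul_nonneg (extZ_nonneg hL.nonneg _) (extZ_nonneg hL.nonneg _))
    fun N _ N' _ h => by simp only at h; omega
  refine le_trans (le_of_eq ?_) h
  refine Finset.sum_congr rfl fun N _ => ?_
  congr 2; ring

end FilterBounds

/-- The indices in `1, …, n` at distance at most `m` from `i`. -/
def window (n m i : ℕ) : Finset ℕ := {u ∈ Finset.Icc 1 n | i ≤ u + m ∧ u ≤ i + m}

theorem card_window_le (n m i : ℕ) : (window n m i).card ≤ 2 * m + 1 := by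
  have h : window n m i ⊆ Finset.Icc (i - m) (i + m) := by
    intro u hu
    simp only [window, Finset.mem_filter, Finset.mem_Icc] at hu ⊢
    omega
  refine (Finset.card_le_card h).trans ?_
  rw [Nat.card_Icc]; omega

theorem mem_Icc_of_mem_window {n m i u : ℕ} (hu : u ∈ window n m i) :
    (u : ℝ) / n ∈ Set.Icc (0 : ℝ) 1 := by
  simp only [window, Finset.mem_filter, Finset.mem_Icc] at hu
  exact ⟨by positivity, div_le_one_of_le₀ (by exact_mod_cast hu.1.2) (by positivity)⟩

/-- The block sum around `i`, as a function of the reversed innovation sequence. -/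
def seqBlock (L : Fin 2 → ℝ → (ℕ → E) → ℝ) (o : Fin 2 → ℕ) (n m i : ℕ) (a : Fin 2)
    (x : ℕ → E) : ℝ :=
  ∑ u ∈ window n m i, L a ((u : ℝ) / n) (shiftSeq (n - u + o a) x)

/-- The normalised product of two block sums. -/
def blockProd (L : Fin 2 → ℝ → (ℕ → E) → ℝ) (o : Fin 2 → ℕ) (n m i : ℕ) (a b : Fin 2)
    (x : ℕ → E) : ℝ :=
  (2 * (m : ℝ) + 1)⁻¹ * (seqBlock L o n m i a x * seqBlock L o n m i b x)

/-- The cumulated dependence of the blocks on an innovation. -/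
def blockDep (δ : ℕ → ℝ) (o : Fin 2 → ℕ) (n m : ℕ) (s : ℕ) : ℝ :=
  ∑ a, ∑ v ∈ Finset.Icc (-(m : ℤ)) m, extZ δ ((s : ℤ) - n + v - o a)

namespace FilterBounds

variable {L : Fin 2 → ℝ → (ℕ → E) → ℝ} {Λ : ℝ} {δ : ℕ → ℝ}

theorem injOn_window (n m i c : ℕ) : Set.InjOn (fun u => n - u + c) (window n m i) := by
  intro u hu v hv h
  simp only [window, Finset.coe_filter, Finset.mem_Icc, Set.mem_ofPred_eq] at hu hv h
  omega

theorem measurable_seqBlock (hL : FilterBounds μ L Λ δ) (o : Fin 2 → ℕ) (n m i : ℕ) (a : Fin 2) :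
    Measurable (seqBlock L o n m i a) :=
  Finset.measurable_sum _ fun _ hu => hL.meas_shift a (mem_Icc_of_mem_window hu) _

theorem memLp_seqBlock (hL : FilterBounds μ L Λ δ) (o : Fin 2 → ℕ) (n m i : ℕ) (a : Fin 2) :
    MemLp (seqBlock L o n m i a) 4 (iidLaw μ) :=
  memLp_finsetSum _ fun _ hu => hL.memLp_shift a (mem_Icc_of_mem_window hu) _

theorem lpNorm_seqBlock_le (hL : FilterBounds μ L Λ δ) (o : Fin 2 → ℕ) (n m i : ℕ) (a : Fin 2) :
    lpNorm (seqBlock L o n m i a) 4 (iidLaw μ) ≤ 2 * ((∑' v, extZ δ v) * √(2 * (m : ℝ) + 1)) := by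
  refine (hL.lpNorm_sum_le a (t := fun u => (u : ℝ) / n) (p := fun u => n - u + o a)
    (fun u hu => mem_Icc_of_mem_window hu) (injOn_window n m i (o a))).trans ?_
  have hA0 : 0 ≤ ∑' v, extZ δ v := tsum_nonneg fun v => extZ_nonneg hL.nonneg v
  gcongr
  exact_mod_cast card_window_le n m i

/-- The coordinate and the centre of the block enter only through `N + i`, as the maximal inequality
requires. A window cut off by the sample only loses nonnegative terms. -/
theorem depNorm_seqBlock_le (hL : FilterBounds μ L Λ δ) (o : Fin 2 → ℕ) (n m i : ℕ) (a : Fin 2)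
    (N : ℕ) : depNorm μ 4 (seqBlock L o n m i a) N ≤
      ∑ v ∈ Finset.Icc (-(m : ℤ)) m, extZ δ (((N + i : ℕ) : ℤ) - n + v - o a) := by
  refine (depNorm_sum_le (by norm_num)
    (fun u hu => hL.memLp_shift a (mem_Icc_of_mem_window hu) _) N).trans ?_
  refine (Finset.sum_le_sum fun u hu =>
    hL.dep_shift a (mem_Icc_of_mem_window hu) (n - u + o a) N).trans ?_
  have hinj : Set.InjOn (fun u : ℕ => (u : ℤ) - i) (window n m i) := fun u _ v _ h => by
    simp only at h; omega
  calc ∑ u ∈ window n m i, extZ δ ((N : ℤ) - (n - u + o a : ℕ))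
      = ∑ u ∈ window n m i, extZ δ (((N + i : ℕ) : ℤ) - n + ((u : ℤ) - i) - o a) := by
        refine Finset.sum_congr rfl fun u hu => ?_
        simp only [window, Finset.mem_filter, Finset.mem_Icc] at hu
        congr 1
        push_cast [Nat.cast_sub hu.1.2]
        ring
    _ = ∑ v ∈ (window n m i).image fun u : ℕ => (u : ℤ) - i,
          extZ δ (((N + i : ℕ) : ℤ) - n + v - o a) := by
        rw [Finset.sum_image hinj]
    _ ≤ _ := by
        refine Finset.sum_le_sum_of_subset_of_nonneg (fun v hv => ?_)
          fun v _ _ => extZ_nonneg hL.nonneg _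
        simp only [window, Finset.mem_image, Finset.mem_filter, Finset.mem_Icc] at hv ⊢
        omega

theorem blockDep_nonneg (hL : FilterBounds μ L Λ δ) (o : Fin 2 → ℕ) (n m s : ℕ) :
    0 ≤ blockDep δ o n m s :=
  Finset.sum_nonneg fun _ _ => Finset.sum_nonneg fun _ _ => extZ_nonneg hL.nonneg _

/-- There are two components and `2m + 1` positions, and each contributes a translate of `extZ δ`.
-/
theorem summable_blockDep (hL : FilterBounds μ L Λ δ) (o : Fin 2 → ℕ) (n m : ℕ) :
    Summable (blockDep δ o n m) ∧
      ∑' s, blockDep δ o n m s ≤ 2 * ((2 * (m : ℝ) + 1) * ∑' v, extZ δ v) := by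
  have h1 : ∀ c : ℤ, Summable fun s : ℕ => extZ δ ((s : ℤ) + c) := fun c =>
    hL.summable_extZ.comp_injective (i := fun s : ℕ => (s : ℤ) + c)
      fun s s' h => by simp only at h; omega
  have h2 : ∀ c : ℤ, ∑' s : ℕ, extZ δ ((s : ℤ) + c) ≤ ∑' v, extZ δ v := fun c =>
    (h1 c).tsum_le_of_sum_le fun S => sum_le_tsum_of_injOn (φ := fun s : ℕ => (s : ℤ) + c)
      hL.summable_extZ (extZ_nonneg hL.nonneg) fun s _ s' _ h => by simp only at h; omega
  have e : blockDep δ o n m = fun s : ℕ => ∑ a, ∑ v ∈ Finset.Icc (-(m : ℤ)) m,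
      extZ δ ((s : ℤ) + (-n + v - o a)) := by
    funext s
    unfold blockDep
    refine Finset.sum_congr rfl fun a _ => Finset.sum_congr rfl fun v _ => ?_
    congr 1; ring
  have h3 : ∀ a, Summable fun s : ℕ => ∑ v ∈ Finset.Icc (-(m : ℤ)) m,
      extZ δ ((s : ℤ) + (-n + v - o a)) := fun a => summable_sum fun v _ => h1 _
  rw [e]
  refine ⟨summable_sum fun a _ => h3 a, ?_⟩
  rw [Summable.tsum_finsetSum fun a _ => h3 a]
  calc ∑ a, ∑' s : ℕ, ∑ v ∈ Finset.Icc (-(m : ℤ)) m, extZ δ ((s : ℤ) + (-n + v - o a))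
      ≤ ∑ _a : Fin 2, (2 * (m : ℝ) + 1) * ∑' v, extZ δ v := by
        refine Finset.sum_le_sum fun a _ => ?_
        rw [Summable.tsum_finsetSum fun v _ => h1 _]
        refine (Finset.sum_le_sum fun v _ => h2 _).trans_eq ?_
        rw [Finset.sum_const, nsmul_eq_mul, Int.card_Icc,
          show ((m : ℤ) + 1 - -(m : ℤ)).toNat = 2 * m + 1 by omega]
        push_cast; ring
    _ = _ := by simp

theorem measurable_blockProd (hL : FilterBounds μ L Λ δ) (o : Fin 2 → ℕ) (n m i : ℕ)
    (a b : Fin 2) : Measurable (blockProd L o n m i a b) :=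
  ((hL.measurable_seqBlock o n m i a).mul (hL.measurable_seqBlock o n m i b)).const_mul _

theorem memLp_blockProd (hL : FilterBounds μ L Λ δ) (o : Fin 2 → ℕ) (n m i : ℕ) (a b : Fin 2) :
    MemLp (blockProd L o n m i a b) 2 (iidLaw μ) := by
  have : MemLp (fun x => seqBlock L o n m i a x * seqBlock L o n m i b x) 2 (iidLaw μ) :=
    (hL.memLp_seqBlock o n m i b).mul' (hL.memLp_seqBlock o n m i a)
  exact this.const_mul _

/-- The product rule pairs the dependence of one block sum with the `L⁴` norm of the other, at most
`2A√W` with `W = 2m + 1`. The normalisation `1/W` leaves `1/√W`. -/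
theorem lpNorm_reveal_blockProd_le (hL : FilterBounds μ L Λ δ) (o : Fin 2 → ℕ) (n m i : ℕ)
    (a b : Fin 2) (N : ℕ) :
    depNorm μ 2 (blockProd L o n m i a b) N ≤
      4 * (∑' v, extZ δ v) / √(2 * (m : ℝ) + 1) * blockDep δ o n m (N + i) := by
  set A := ∑' v, extZ δ v
  set W : ℝ := 2 * (m : ℝ) + 1 with hW
  have hW0 : 0 < W := by positivity
  have hA0 : 0 ≤ A := tsum_nonneg fun v => extZ_nonneg hL.nonneg v
  have hc : ∀ a, depNorm μ 4 (seqBlock L o n m i a) N ≤ blockDep δ o n m (N + i) := fun a =>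
    (hL.depNorm_seqBlock_le o n m i a N).trans
      (Finset.single_le_sum (f := fun a => ∑ v ∈ Finset.Icc (-(m : ℤ)) m,
        extZ δ (((N + i : ℕ) : ℤ) - n + v - o a))
        (fun a _ => Finset.sum_nonneg fun v _ => extZ_nonneg hL.nonneg _) (Finset.mem_univ a))
  unfold blockProd
  rw [depNorm_const_mul, abs_of_nonneg (inv_nonneg.2 hW0.le)]
  have h := depNorm_mul_le (hL.memLp_seqBlock o n m i a) (hL.memLp_seqBlock o n m i b) N
  have hB := hL.blockDep_nonneg o n m (N + i)
  have h1 : depNorm μ 2 (fun x => seqBlock L o n m i a x * seqBlock L o n m i b x) N ≤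
      2 * (A * √W) * blockDep δ o n m (N + i) + blockDep δ o n m (N + i) * (2 * (A * √W)) := by
    refine h.trans (add_le_add ?_ ?_)
    · exact mul_le_mul (hL.lpNorm_seqBlock_le o n m i a) (hc b) (depNorm_nonneg _ _ _)
        (by positivity)
    · exact mul_le_mul (hc a) (hL.lpNorm_seqBlock_le o n m i b) lpNorm_nonneg hB
  calc W⁻¹ * depNorm μ 2 (fun x => seqBlock L o n m i a x * seqBlock L o n m i b x) N
      ≤ W⁻¹ * (2 * (A * √W) * blockDep δ o n m (N + i) +
          blockDep δ o n m (N + i) * (2 * (A * √W))) := by gcongr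
    _ = (√W * √W) * W⁻¹ * (4 * A / √W * blockDep δ o n m (N + i)) := by
        have : √W ≠ 0 := (Real.sqrt_pos.2 hW0).ne'
        field_simp; ring
    _ = _ := by rw [Real.mul_self_sqrt hW0.le, mul_inv_cancel₀ hW0.ne', one_mul]

/-- The maximal inequality for weighted partial sums of centred block products. -/
theorem lpNorm_runMax_blockProd_le (hL : FilterBounds μ L Λ δ) (o : Fin 2 → ℕ) (n m : ℕ)
    (a b : Fin 2) {w : ℕ → ℝ} (hw : ∀ i, 0 ≤ w i) :
    MemLp (fun x => runMax (fun j => |∑ q ∈ Finset.range j, w (n - q) *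
      (blockProd L o n m (n - q) a b x - ∫ y, blockProd L o n m (n - q) a b y ∂(iidLaw μ))|) n) 2
      (iidLaw μ) ∧
    lpNorm (fun x => runMax (fun j => |∑ q ∈ Finset.range j, w (n - q) *
      (blockProd L o n m (n - q) a b x - ∫ y, blockProd L o n m (n - q) a b y ∂(iidLaw μ))|) n) 2
      (iidLaw μ) ≤
      24 * (∑' v, extZ δ v) ^ 2 * √(2 * (m : ℝ) + 1) * √(∑ q ∈ Finset.range n, w (n - q) ^ 2) := by
  set A := ∑' v, extZ δ v
  set W : ℝ := 2 * (m : ℝ) + 1 with hW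
  have hW0 : 0 < W := by positivity
  have hA0 : 0 ≤ A := tsum_nonneg fun v => extZ_nonneg hL.nonneg v
  obtain ⟨hs, hsum⟩ := hL.summable_blockDep o n m
  have hY : ∀ q, MemLp (fun x => w (n - q) * blockProd L o n m (n - q) a b x) 2 (iidLaw μ) :=
    fun q => (hL.memLp_blockProd o n m (n - q) a b).const_mul _
  have hYm : ∀ q, Measurable (fun x => w (n - q) * blockProd L o n m (n - q) a b x) :=
    fun q => (hL.measurable_blockProd o n m (n - q) a b).const_mul _
  -- Blocks are enumerated from the last one, `i = n - q`, so that increasing `q` means older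
  -- innovations, that is, higher coordinates. The distance `N + n - q` is then `N + i`.
  have h := lpNorm_runMax_centered_le (μ := μ) (n := n) (w := fun q => w (n - q)) hYm hY
    (c := fun s => 4 * A / √W * blockDep δ o n m s)
    (fun q => hw _) (fun s => mul_nonneg (by positivity) (hL.blockDep_nonneg o n m s))
    (hs.mul_left _) (fun q hq N => by
      refine (lpNorm_reveal_sub_le (hYm q) (by norm_num) (by simp) (hY q) N).trans ?_
      rw [depNorm_const_mul, abs_of_nonneg (hw _), show N + n - q = N + (n - q) by omega]
      exact mul_le_mul_of_nonneg_left (hL.lpNorm_reveal_blockProd_le o n m (n - q) a b N) (hw _))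
  simp only [integral_const_mul, ← mul_sub] at h
  refine ⟨h.1, h.2.trans ?_⟩
  rw [tsum_mul_left]
  -- `24 = 3 · 4 · 2`: Doob, the product rule, and the two components in `blockDep`.
  calc 3 * √(∑ q ∈ Finset.range n, w (n - q) ^ 2) * (4 * A / √W * ∑' s, blockDep δ o n m s)
      ≤ 3 * √(∑ q ∈ Finset.range n, w (n - q) ^ 2) * (4 * A / √W * (2 * (W * A))) := by gcongr
    _ = 3 * √(∑ q ∈ Finset.range n, w (n - q) ^ 2) * (4 * A / √W * (2 * ((√W * √W) * A))) := by
        rw [Real.mul_self_sqrt hW0.le]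
    _ = _ := by
        have : √W ≠ 0 := (Real.sqrt_pos.2 hW0).ne'
        field_simp; ring

end FilterBounds

end Blocks

/-! ### Double sums over lags. -/

section LagSums

/-- Counts the rows of the double sum in which a lag is missing; this is where the weight `|j|` on
the covariances originates. -/
theorem card_filter_shift_notMem_le (l r : ℕ) (d : ℤ) :
    ((((Finset.Icc l r).filter fun u : ℕ => ¬((l : ℤ) ≤ u + d ∧ (u : ℤ) + d ≤ r))).card : ℤ) ≤ |d| := by
  rcases le_total 0 d with h | h
  · lift d to ℕ using h
    have hs : ((Finset.Icc l r).filter fun u : ℕ => ¬((l : ℤ) ≤ u + (d : ℤ) ∧ (u : ℤ) + (d : ℤ) ≤ r)) ⊆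
        Finset.Ico (r + 1 - d) (r + 1) := by
      intro u hu
      simp only [Finset.mem_filter, Finset.mem_Icc, Finset.mem_Ico] at hu ⊢
      omega
    have := Finset.card_le_card hs
    rw [Nat.card_Ico] at this
    rw [abs_of_nonneg (by positivity)]
    omega
  · obtain ⟨e, rfl⟩ : ∃ e : ℕ, d = -(e : ℤ) := ⟨(-d).toNat, by omega⟩
    have hs : ((Finset.Icc l r).filter fun u : ℕ => ¬((l : ℤ) ≤ u + -(e : ℤ) ∧ (u : ℤ) + -(e : ℤ) ≤ r)) ⊆
        Finset.Ico l (l + e) := by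
      intro u hu
      simp only [Finset.mem_filter, Finset.mem_Icc, Finset.mem_Ico] at hu ⊢
      omega
    have := Finset.card_le_card hs
    rw [Nat.card_Ico] at this
    rw [abs_neg, abs_of_nonneg (by positivity)]
    omega

/-- The double sum of an absolutely summable sequence over lags in a block is close to the block
length times the full sum. -/
theorem abs_sum_sum_lag_sub_le {γ g : ℤ → ℝ} (hγ : ∀ j, |γ j| ≤ g j)
    (hg : Summable fun j : ℤ => (1 + |(j : ℝ)|) * g j) (l r : ℕ) (c : ℤ) :
    |∑ u ∈ Finset.Icc l r, ∑ v ∈ Finset.Icc l r, γ ((v : ℤ) - u + c) -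
      ((Finset.Icc l r).card : ℝ) * ∑' j, γ j| ≤
      (1 + |(c : ℝ)|) * ∑' j : ℤ, (1 + |(j : ℝ)|) * g j := by
  have hg0 : ∀ j, 0 ≤ g j := fun j => (abs_nonneg _).trans (hγ j)
  have hγs : Summable γ := by
    refine Summable.of_norm_bounded hg fun j => (hγ j).trans ?_
    nlinarith [hg0 j, abs_nonneg (j : ℝ)]
  have h1 : ∀ u : ℕ, HasSum
      (fun j : ℤ => if (l : ℤ) ≤ u + (j - c) ∧ (u : ℤ) + (j - c) ≤ r then γ j else 0)
      (∑ v ∈ Finset.Icc l r, γ ((v : ℤ) - u + c)) := by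
    intro u
    have hinj : Set.InjOn (fun v : ℕ => (v : ℤ) - u + c) (Finset.Icc l r) := fun v _ v' _ h => by
      simp only at h; omega
    rw [← Finset.sum_image (f := γ) hinj]
    have e : ∑ j ∈ (Finset.Icc l r).image (fun v : ℕ => (v : ℤ) - u + c), γ j =
        ∑ j ∈ (Finset.Icc l r).image (fun v : ℕ => (v : ℤ) - u + c),
          if (l : ℤ) ≤ u + (j - c) ∧ (u : ℤ) + (j - c) ≤ r then γ j else 0 := by
      refine Finset.sum_congr rfl fun j hj => ?_
      simp only [Finset.mem_image, Finset.mem_Icc] at hj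
      rw [if_pos]; omega
    rw [e]
    refine hasSum_sum_of_ne_finset_zero fun j hj => if_neg fun hj' => hj ?_
    simp only [Finset.mem_image, Finset.mem_Icc]
    exact ⟨(u + (j - c)).toNat, by omega, by omega⟩
  have h2 : HasSum (fun j : ℤ => ∑ u ∈ Finset.Icc l r,
      ((if (l : ℤ) ≤ u + (j - c) ∧ (u : ℤ) + (j - c) ≤ r then γ j else 0) - γ j))
      (∑ u ∈ Finset.Icc l r, (∑ v ∈ Finset.Icc l r, γ ((v : ℤ) - u + c) - ∑' j, γ j)) :=
    hasSum_sum fun u _ => (h1 u).sub hγs.hasSum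
  rw [Finset.sum_sub_distrib, Finset.sum_const, nsmul_eq_mul] at h2
  rw [← h2.tsum_eq, ← tsum_mul_left, ← Real.norm_eq_abs]
  refine tsum_of_norm_bounded (hg.mul_left _).hasSum fun j => ?_
  -- Each row lacking lag `j` contributes `-γ j` and every other row 0.
  have e : ∑ u ∈ Finset.Icc l r,
      ((if (l : ℤ) ≤ u + (j - c) ∧ (u : ℤ) + (j - c) ≤ r then γ j else 0) - γ j) =
      -(((((Finset.Icc l r).filter fun u : ℕ => ¬((l : ℤ) ≤ u + (j - c) ∧ (u : ℤ) + (j - c) ≤ r))).card : ℝ) *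
        γ j) := by
    rw [← nsmul_eq_mul, ← Finset.sum_const, Finset.sum_filter, ← Finset.sum_neg_distrib]
    refine Finset.sum_congr rfl fun u _ => ?_
    split_ifs <;> simp_all
  rw [e, norm_neg, norm_mul, Real.norm_of_nonneg (Nat.cast_nonneg _)]
  have hcard : ((((Finset.Icc l r).filter fun u : ℕ => ¬((l : ℤ) ≤ u + (j - c) ∧
      (u : ℤ) + (j - c) ≤ r))).card : ℝ) ≤ |((j - c : ℤ) : ℝ)| := by
    exact_mod_cast card_filter_shift_notMem_le l r (j - c)
  have h3 : |((j - c : ℤ) : ℝ)| ≤ (1 + |(c : ℝ)|) * (1 + |(j : ℝ)|) := by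
    push_cast
    nlinarith [abs_sub (j : ℝ) c, abs_nonneg (j : ℝ), abs_nonneg (c : ℝ)]
  rw [← mul_assoc]
  exact mul_le_mul (hcard.trans h3) (hγ j) (norm_nonneg _) (by positivity)

end LagSums

/-! ### Bias of a single block product. -/

section Bias

variable {E : Type*} [MeasurableSpace E] {μ : Measure E} [IsProbabilityMeasure μ]

/-- `γ` collects the stationary cross-covariances of the filters `L`. -/
def IsCrossCov (μ : Measure E) [IsProbabilityMeasure μ] (L : Fin 2 → ℝ → (ℕ → E) → ℝ)
    (γ : ℝ → Fin 2 → Fin 2 → ℤ → ℝ) : Prop :=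
  ∀ t ∈ Set.Icc (0 : ℝ) 1, ∀ a b, ∀ p p' : ℕ,
    γ t a b ((p : ℤ) - p') = ∫ x, L a t (shiftSeq p x) * L b t (shiftSeq p' x) ∂(iidLaw μ)

namespace FilterBounds

variable {L : Fin 2 → ℝ → (ℕ → E) → ℝ} {Λ : ℝ} {δ : ℕ → ℝ} {γ : ℝ → Fin 2 → Fin 2 → ℤ → ℝ}

theorem abs_crossCov_le (hL : FilterBounds μ L Λ δ) (hγ : IsCrossCov μ L γ) {t : ℝ}
    (ht : t ∈ Set.Icc (0 : ℝ) 1) (a b : Fin 2) (j : ℤ) : |γ t a b j| ≤ covBound δ j := by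
  -- An integer lag is the difference of its positive and negative parts, which serve as the two
  -- shifts.
  have h := hL.abs_integral_shift_mul_le a b ht ht j.toNat (-j).toNat
  rw [← hγ t ht] at h
  rwa [show ((j.toNat : ℕ) : ℤ) - ((-j).toNat : ℕ) = j by omega] at h

theorem summable_crossCov (hL : FilterBounds μ L Λ δ) (hγ : IsCrossCov μ L γ) {t : ℝ}
    (ht : t ∈ Set.Icc (0 : ℝ) 1) (a b : Fin 2) : Summable (γ t a b) := by
  refine Summable.of_norm_bounded (summable_covBound hL.nonneg hL.summable) fun j =>
    (hL.abs_crossCov_le hγ ht a b j).trans ?_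
  nlinarith [covBound_nonneg hL.nonneg j, abs_nonneg (j : ℝ)]

theorem abs_tsum_crossCov_le (hL : FilterBounds μ L Λ δ) (hγ : IsCrossCov μ L γ) {t : ℝ}
    (ht : t ∈ Set.Icc (0 : ℝ) 1) (a b : Fin 2) :
    |∑' j, γ t a b j| ≤ ∑' j : ℤ, (1 + |(j : ℝ)|) * covBound δ j := by
  rw [← Real.norm_eq_abs]
  refine tsum_of_norm_bounded (summable_covBound hL.nonneg hL.summable).hasSum fun j =>
    (hL.abs_crossCov_le hγ ht a b j).trans ?_
  nlinarith [covBound_nonneg hL.nonneg j, abs_nonneg (j : ℝ)]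

/-- A crude bound that needs no full window; it handles the blocks cut off at the ends of the
sample. -/
theorem abs_integral_blockProd_le (hL : FilterBounds μ L Λ δ) (o : Fin 2 → ℕ) (n m i : ℕ)
    (a b : Fin 2) :
    |∫ x, blockProd L o n m i a b x ∂(iidLaw μ)| ≤ 4 * (∑' v, extZ δ v) ^ 2 := by
  set A := ∑' v, extZ δ v
  set W : ℝ := 2 * (m : ℝ) + 1 with hW
  have hW0 : 0 < W := by positivity
  have hA0 : 0 ≤ A := tsum_nonneg fun v => extZ_nonneg hL.nonneg v
  have h24 : (2 : ℝ≥0∞) ≤ 4 := by norm_num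
  have h2 : ∀ a, lpNorm (seqBlock L o n m i a) 2 (iidLaw μ) ≤ 2 * (A * √W) := fun a =>
    (lpNorm_le_lpNorm_of_exponent_le h24 (hL.memLp_seqBlock o n m i a)).trans
      (hL.lpNorm_seqBlock_le o n m i a)
  have h := abs_integral_mul_le ((hL.memLp_seqBlock o n m i a).mono_exponent h24)
    ((hL.memLp_seqBlock o n m i b).mono_exponent h24)
  have h3 := h.trans (mul_le_mul (h2 a) (h2 b) lpNorm_nonneg (by positivity))
  simp only [blockProd]
  rw [integral_const_mul, abs_mul, abs_of_pos (inv_pos.2 hW0), inv_mul_le_iff₀ hW0]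
  refine h3.trans_eq ?_
  have := Real.mul_self_sqrt hW0.le
  calc 2 * (A * √W) * (2 * (A * √W)) = (√W * √W) * (4 * A ^ 2) := by ring
    _ = _ := by rw [this]

/-- The bias of a block product away from the boundary. -/
theorem abs_integral_blockProd_sub_le (hL : FilterBounds μ L Λ δ) (hγ : IsCrossCov μ L γ)
    (o : Fin 2 → ℕ) {n m i : ℕ} (hi : m < i) (hin : i + m ≤ n) (a b : Fin 2) :
    |∫ x, blockProd L o n m i a b x ∂(iidLaw μ) - ∑' j, γ ((i : ℝ) / n) a b j| ≤
      4 * (∑' v, extZ δ v) * Λ * (√(2 * (m : ℝ) + 1) * (m / n)) +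
      (1 + |((o a : ℤ) - o b : ℝ)|) * (∑' j : ℤ, (1 + |(j : ℝ)|) * covBound δ j) /
        (2 * (m : ℝ) + 1) := by
  set A := ∑' v, extZ δ v
  set W : ℝ := 2 * (m : ℝ) + 1 with hW
  have hW0 : 0 < W := by positivity
  have hA0 : 0 ≤ A := tsum_nonneg fun v => extZ_nonneg hL.nonneg v
  have h24 : (2 : ℝ≥0∞) ≤ 4 := by norm_num
  have hn : (0 : ℝ) < n := by exact_mod_cast (by omega : 0 < n)
  have ht : (i : ℝ) / n ∈ Set.Icc (0 : ℝ) 1 :=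
    ⟨by positivity, div_le_one_of_le₀ (by exact_mod_cast (by omega : i ≤ n)) hn.le⟩
  have hwin : window n m i = Finset.Icc (i - m) (i + m) := by
    ext u
    simp only [window, Finset.mem_filter, Finset.mem_Icc]
    omega
  have hcard : ((Finset.Icc (i - m) (i + m)).card : ℝ) = W := by
    rw [Nat.card_Icc, show i + m + 1 - (i - m) = 2 * m + 1 by omega]
    push_cast; rfl
  -- The block sum with time frozen at its centre, hence a sum over a stationary process. Each of
  -- its `W` terms moves by at most `Λ m / n` in `L²`.
  set F : Fin 2 → (ℕ → E) → ℝ := fun a x =>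
    ∑ u ∈ window n m i, L a ((i : ℝ) / n) (shiftSeq (n - u + o a) x) with hF
  have mS : ∀ a, MemLp (seqBlock L o n m i a) 2 (iidLaw μ) := fun a =>
    (hL.memLp_seqBlock o n m i a).mono_exponent h24
  have mF4 : ∀ a, MemLp (F a) 4 (iidLaw μ) := fun a =>
    memLp_finsetSum _ fun u _ => hL.memLp_shift a ht _
  have mF : ∀ a, MemLp (F a) 2 (iidLaw μ) := fun a => (mF4 a).mono_exponent h24
  have nS : ∀ a, lpNorm (seqBlock L o n m i a) 2 (iidLaw μ) ≤ 2 * (A * √W) := fun a =>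
    (lpNorm_le_lpNorm_of_exponent_le h24 (hL.memLp_seqBlock o n m i a)).trans
      (hL.lpNorm_seqBlock_le o n m i a)
  have nF : ∀ a, lpNorm (F a) 2 (iidLaw μ) ≤ 2 * (A * √W) := fun a => by
    refine (lpNorm_le_lpNorm_of_exponent_le h24 (mF4 a)).trans ?_
    have := hL.lpNorm_sum_le a (t := fun _ => (i : ℝ) / n) (p := fun u => n - u + o a)
      (fun u _ => ht) (injOn_window n m i (o a))
    rwa [hwin, hcard, ← hwin] at this
  have nD : ∀ a, lpNorm (fun x => seqBlock L o n m i a x - F a x) 2 (iidLaw μ) ≤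
      W * (Λ * (m / n)) := fun a => by
    simp only [seqBlock, hF, ← Finset.sum_sub_distrib]
    refine (lpNorm_fun_sum_le (fun u hu => ((hL.memLp_shift a (mem_Icc_of_mem_window hu) _).sub
      (hL.memLp_shift a ht _)).mono_exponent h24) (by norm_num)).trans ?_
    calc _ ≤ ∑ u ∈ window n m i, Λ * (m / n) := Finset.sum_le_sum fun u hu => by
          have hu1 := mem_Icc_of_mem_window hu
          have := lpNorm_comp_measurePreserving (measurePreserving_shiftSeq μ (n - u + o a))
            ((hL.memLp a _ hu1).sub (hL.memLp a _ ht)).1 2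
          refine this.trans_le ((hL.lip a _ hu1 _ ht).trans ?_)
          refine mul_le_mul_of_nonneg_left ?_ hL.lip_nonneg
          rw [← sub_div, abs_div, abs_of_pos hn]
          gcongr
          rw [hwin, Finset.mem_Icc] at hu
          rw [abs_le]
          have h1 : (i : ℝ) ≤ u + m := by exact_mod_cast (by omega : i ≤ u + m)
          have h2 : (u : ℝ) ≤ i + m := by exact_mod_cast hu.2
          constructor <;> linarith
      _ = _ := by rw [Finset.sum_const, nsmul_eq_mul, hwin, hcard]
  have hdiff : |∫ x, seqBlock L o n m i a x * seqBlock L o n m i b x ∂(iidLaw μ) -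
      ∫ x, F a x * F b x ∂(iidLaw μ)| ≤ 2 * (2 * (A * √W) * (W * (Λ * (m / n)))) := by
    have e : ∫ x, seqBlock L o n m i a x * seqBlock L o n m i b x ∂(iidLaw μ) -
        ∫ x, F a x * F b x ∂(iidLaw μ) =
        ∫ x, seqBlock L o n m i a x * (seqBlock L o n m i b x - F b x) ∂(iidLaw μ) +
        ∫ x, (seqBlock L o n m i a x - F a x) * F b x ∂(iidLaw μ) := by
      have i1 : Integrable (fun x => seqBlock L o n m i a x *
        (seqBlock L o n m i b x - F b x)) (iidLaw μ) := (mS a).integrable_mul ((mS b).sub (mF b))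
      have i2 : Integrable (fun x => (seqBlock L o n m i a x - F a x) * F b x) (iidLaw μ) :=
        ((mS a).sub (mF a)).integrable_mul (mF b)
      have i3 : Integrable (fun x => seqBlock L o n m i a x * seqBlock L o n m i b x) (iidLaw μ) :=
        (mS a).integrable_mul (mS b)
      have i4 : Integrable (fun x => F a x * F b x) (iidLaw μ) := (mF a).integrable_mul (mF b)
      rw [← integral_add i1 i2, ← integral_sub i3 i4]
      refine integral_congr_ae (.of_forall fun x => ?_)
      simp only; ring
    rw [e, two_mul]
    refine (abs_add_le _ _).trans (add_le_add ?_ ?_)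
    · exact (abs_integral_mul_le (mS a) ((mS b).sub (mF b))).trans
        (mul_le_mul (nS a) (nD b) lpNorm_nonneg (by positivity))
    · refine (abs_integral_mul_le ((mS a).sub (mF a)) (mF b)).trans ?_
      rw [mul_comm]
      exact mul_le_mul (nF b) (nD a) lpNorm_nonneg (by positivity)
  -- The components are aligned at different innovations, which shifts all lags by `o a - o b`. The
  -- sum over all integer lags does not change; only the boundary error gains a factor.
  have hFF : ∫ x, F a x * F b x ∂(iidLaw μ) =
      ∑ u ∈ Finset.Icc (i - m) (i + m), ∑ v ∈ Finset.Icc (i - m) (i + m),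
        γ ((i : ℝ) / n) a b ((v : ℤ) - u + ((o a : ℤ) - o b)) := by
    simp only [hF, Finset.sum_mul_sum]
    have hi2 : ∀ u v : ℕ, Integrable (fun x => L a ((i : ℝ) / n) (shiftSeq (n - u + o a) x) *
        L b ((i : ℝ) / n) (shiftSeq (n - v + o b) x)) (iidLaw μ) := fun u v =>
      ((hL.memLp_shift a ht _).mono_exponent h24).integrable_mul
        ((hL.memLp_shift b ht _).mono_exponent h24)
    rw [integral_finsetSum _ fun u _ => integrable_finsetSum _ fun v _ => hi2 u v, ← hwin]
    refine Finset.sum_congr rfl fun u hu => ?_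
    rw [integral_finsetSum _ fun v _ => hi2 u v]
    refine Finset.sum_congr rfl fun v hv => ?_
    rw [← hγ _ ht]
    congr 1
    simp only [window, Finset.mem_filter, Finset.mem_Icc] at hu hv
    push_cast [Nat.cast_sub hu.1.2, Nat.cast_sub hv.1.2]
    ring
  have hst := abs_sum_sum_lag_sub_le (hL.abs_crossCov_le hγ ht a b)
    (summable_covBound hL.nonneg hL.summable) (i - m) (i + m) ((o a : ℤ) - o b)
  rw [← hFF, hcard] at hst
  set σ := ∑' j, γ ((i : ℝ) / n) a b j
  have e : ∫ x, blockProd L o n m i a b x ∂(iidLaw μ) - σ = W⁻¹ *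
      ((∫ x, seqBlock L o n m i a x * seqBlock L o n m i b x ∂(iidLaw μ) -
        ∫ x, F a x * F b x ∂(iidLaw μ)) + (∫ x, F a x * F b x ∂(iidLaw μ) - W * σ)) := by
    simp only [blockProd]
    rw [integral_const_mul]
    field_simp
    ring
  rw [e, abs_mul, abs_of_pos (inv_pos.2 hW0), inv_mul_le_iff₀ hW0]
  refine (abs_add_le _ _).trans ((add_le_add hdiff hst).trans_eq ?_)
  push_cast
  field_simp
  ring

end FilterBounds

end Bias

/-! ### Riemann sums and kernel weights. -/

section KernelWeights

/-- A bounded monotone function dominating the increments of a function of bounded variation. -/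
theorem exists_monotone_dominating {K : ℝ → ℝ} (hK : BoundedVariationOn K Set.univ) :
    ∃ v : ℝ → ℝ, ∃ V : ℝ, 0 ≤ V ∧ Monotone v ∧ (∀ x y, v x - v y ≤ V) ∧
      ∀ y x, y ≤ x → |K x - K y| ≤ v x - v y := by
  have hfin : ∀ s : Set ℝ, eVariationOn K s ≠ ∞ := fun s =>
    ((eVariationOn.mono K (Set.subset_univ s)).trans_lt (lt_top_iff_ne_top.2 hK)).ne
  have hadd : ∀ y x, y ≤ x → (eVariationOn K (Set.Iic x)).toReal =
      (eVariationOn K (Set.Iic y)).toReal + (eVariationOn K (Set.Icc y x)).toReal := by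
    intro y x h
    rw [← ENNReal.toReal_add (hfin _) (hfin _),
      ← eVariationOn.union K (x := y) isGreatest_Iic (isLeast_Icc h), Set.Iic_union_Icc_eq_Iic h]
  refine ⟨fun x => (eVariationOn K (Set.Iic x)).toReal, (eVariationOn K Set.univ).toReal,
    ENNReal.toReal_nonneg, fun y x h => ?_, fun x y => ?_, fun y x h => ?_⟩
  · simp only [hadd y x h]
    linarith [ENNReal.toReal_nonneg (a := eVariationOn K (Set.Icc y x))]
  · have h1 : (eVariationOn K (Set.Iic x)).toReal ≤ (eVariationOn K Set.univ).toReal :=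
      ENNReal.toReal_mono hK (eVariationOn.mono K (Set.subset_univ _))
    have h2 := ENNReal.toReal_nonneg (a := eVariationOn K (Set.Iic y))
    simp only
    linarith
  · simp only [hadd y x h, add_sub_cancel_left]
    rw [← Real.dist_eq, dist_edist]
    exact ENNReal.toReal_mono (hfin _)
      (eVariationOn.edist_le K (Set.right_mem_Icc.2 h) (Set.left_mem_Icc.2 h))

/-- A non-integrable function has integral 0 by convention, so integral one forces integrability. -/
theorem IsKernel.integrable {K : ℝ → ℝ} (hK : IsKernel K) : Integrable K := by
  by_contra h
  have := hK.integral_eq_one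
  rw [integral_undef h] at this
  exact zero_ne_one this

/-- The rescaled design points. -/
def design (n : ℕ) (τ t : ℝ) (i : ℕ) : ℝ := ((i : ℝ) / n - t) / τ

theorem sum_Icc_one_eq_sum_range {β : Type*} [AddCommMonoid β] (f : ℕ → β) (n : ℕ) :
    ∑ i ∈ Finset.Icc 1 n, f i = ∑ i ∈ Finset.range n, f (i + 1) := by
  induction n with
  | zero => simp
  | succ n ih => rw [Finset.sum_Icc_succ_top (by omega), ih, Finset.sum_range_succ]

/-- Riemann sums of functions of bounded variation. -/
theorem abs_riemannSum_sub_le {K : ℝ → ℝ} (hK : IsKernel K) {v : ℝ → ℝ} {V : ℝ}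
    (hv : ∀ x y, v x - v y ≤ V) (hKv : ∀ y x, y ≤ x → |K x - K y| ≤ v x - v y)
    (hmono : Monotone v) {f : ℝ → ℝ}
    (hf : Integrable f) (hf0 : ∀ x, 1 < |x| → f x = 0)
    (hfK : ∀ x y, |f x - f y| ≤ |K x - K y| + K y * |x - y|)
    {n : ℕ} {τ t : ℝ} (hn : 0 < n) (hτ : 0 < τ) (ht : t ∈ Set.Icc τ (1 - τ)) :
    |∑ i ∈ Finset.Icc 1 n, f (design n τ t i) - (n * τ) * ∫ x, f x| ≤ V + 1 := by
  have hn' : (0 : ℝ) < n := by exact_mod_cast hn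
  set Δ : ℝ := (n * τ)⁻¹ with hΔ
  have hΔ0 : 0 < Δ := by positivity
  set x : ℕ → ℝ := design n τ t with hx
  have hstep : ∀ i, x (i + 1) = x i + Δ := fun i => by
    simp only [hx, design, hΔ]; push_cast; field_simp; ring
  have hle : ∀ i, x i ≤ x (i + 1) := fun i => by rw [hstep]; linarith
  -- As `t ∈ [τ, 1 - τ]`, the design points reach across `[-1, 1]`, so no mass of the kernel is cut
  -- off.
  have hx0 : x 0 ≤ -1 := by
    simp only [hx, design, Nat.cast_zero, zero_div, zero_sub]
    rw [div_le_iff₀ hτ]; linarith [ht.1]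
  have hxn : 1 ≤ x n := by
    simp only [hx, design]
    rw [div_self hn'.ne', le_div_iff₀ hτ]; linarith [ht.2]
  have hx0n : x 0 ≤ x n := by linarith
  have full : ∀ g : ℝ → ℝ, (∀ x, 1 < |x| → g x = 0) → ∫ y in (x 0)..(x n), g y = ∫ y, g y := by
    intro g hg
    rw [intervalIntegral.integral_of_le hx0n, ← integral_Icc_eq_integral_Ioc]
    refine setIntegral_eq_integral_of_forall_compl_eq_zero fun y hy => hg y ?_
    by_contra h
    push Not at h
    exact hy ⟨hx0.trans (abs_le.1 h).1, (abs_le.1 h).2.trans hxn⟩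
  have hKi := hK.integrable
  have h1 : ∫ y, f y = ∑ i ∈ Finset.range n, ∫ y in (x i)..(x (i + 1)), f y := by
    rw [intervalIntegral.sum_integral_adjacent_intervals fun k _ => hf.intervalIntegrable,
      full f hf0]
  -- Summed over the cells, the increments of `v` telescope to at most `V` and the integrals of `K`
  -- add up to 1, whence `V + 1`.
  have hcell : ∀ i, |f (x (i + 1)) * Δ - ∫ y in (x i)..(x (i + 1)), f y| ≤
      Δ * (v (x (i + 1)) - v (x i)) + Δ * ∫ y in (x i)..(x (i + 1)), K y := by
    intro i
    have e : f (x (i + 1)) * Δ - ∫ y in (x i)..(x (i + 1)), f y =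
        ∫ y in (x i)..(x (i + 1)), (f (x (i + 1)) - f y) := by
      rw [intervalIntegral.integral_sub intervalIntegrable_const hf.intervalIntegrable,
        intervalIntegral.integral_const, hstep, smul_eq_mul]
      ring
    have e2 : Δ * (v (x (i + 1)) - v (x i)) + Δ * ∫ y in (x i)..(x (i + 1)), K y =
        ∫ y in (x i)..(x (i + 1)), ((v (x (i + 1)) - v (x i)) + Δ * K y) := by
      rw [intervalIntegral.integral_add intervalIntegrable_const
        (hKi.intervalIntegrable.const_mul Δ), intervalIntegral.integral_const,
        intervalIntegral.integral_const_mul, hstep, smul_eq_mul]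
      ring
    rw [e, e2, ← Real.norm_eq_abs]
    refine intervalIntegral.norm_integral_le_of_norm_le (hle i) (.of_forall fun y hy => ?_)
      (intervalIntegrable_const.add (hKi.intervalIntegrable.const_mul Δ))
    rw [Real.norm_eq_abs]
    refine (hfK _ _).trans (add_le_add ?_ ?_)
    · exact (hKv _ _ hy.2).trans (by linarith [hmono hy.1.le])
    · rw [mul_comm]
      refine mul_le_mul_of_nonneg_right ?_ (hK.nonneg y)
      rw [abs_of_nonneg (by linarith [hy.2])]
      have := hstep i
      linarith [hy.1]
  have h2 : |∑ i ∈ Finset.range n, f (x (i + 1)) * Δ - ∫ y, f y| ≤ Δ * (V + 1) := by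
    rw [h1, ← Finset.sum_sub_distrib]
    refine (Finset.abs_sum_le_sum_abs _ _).trans ((Finset.sum_le_sum fun i _ => hcell i).trans ?_)
    rw [Finset.sum_add_distrib, ← Finset.mul_sum, ← Finset.mul_sum,
      Finset.sum_range_sub (fun i => v (x i)),
      intervalIntegral.sum_integral_adjacent_intervals fun k _ => hKi.intervalIntegrable,
      full K hK.support, hK.integral_eq_one, ← mul_add]
    gcongr
    exact hv _ _
  rw [← Finset.sum_mul] at h2
  rw [sum_Icc_one_eq_sum_range]
  have e : ∑ i ∈ Finset.range n, f (x (i + 1)) - n * τ * ∫ y, f y =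
      (n * τ) * ((∑ i ∈ Finset.range n, f (x (i + 1))) * Δ - ∫ y, f y) := by
    rw [hΔ]; field_simp
  rw [e, abs_mul, abs_of_pos (by positivity : (0 : ℝ) < n * τ)]
  calc (n * τ) * |(∑ i ∈ Finset.range n, f (x (i + 1))) * Δ - ∫ y, f y|
      ≤ (n * τ) * (Δ * (V + 1)) := by gcongr
    _ = V + 1 := by rw [hΔ]; field_simp

/-- The properties of the smoothing weights at `t` that the estimates use. -/
structure WeightBounds (K : ℝ → ℝ) (B : ℝ) (n : ℕ) (τ t : ℝ) : Prop where
  nonneg : ∀ i, 0 ≤ weight K n τ t i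
  le : ∀ i, weight K n τ t i ≤ B / (n * τ)
  sum_eq_one : ∑ i ∈ Finset.Icc 1 n, weight K n τ t i = 1
  variation : ∑ i ∈ Finset.range n, |weight K n τ t (i + 1) - weight K n τ t i| ≤ B / (n * τ)
  first_moment : |∑ i ∈ Finset.Icc 1 n, weight K n τ t i * ((i : ℝ) / n - t)| ≤ B / n
  support : ∀ i, weight K n τ t i ≠ 0 → |(i : ℝ) / n - t| ≤ τ

/-- The normalising sum is `nτ` up to `V + 1`, hence at least `nτ/2` once `nτ ≥ 2(V + 1)`. The first
moment is the Riemann sum of `x K(x)`, whose integral vanishes by symmetry, so it gains a factor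
`1/n` instead of `τ`. -/
theorem IsKernel.exists_weightBounds {K : ℝ → ℝ} (hK : IsKernel K) :
    ∃ B, 0 ≤ B ∧ ∀ (n : ℕ) (τ t : ℝ), 0 < n → 0 < τ → B ≤ n * τ → t ∈ Set.Icc τ (1 - τ) →
      WeightBounds K B n τ t := by
  obtain ⟨v, V, hV0, hmono, hv, hKv⟩ := exists_monotone_dominating hK.boundedVariation
  refine ⟨2 * (V + 1), by positivity, fun n τ t hn hτ hB ht => ?_⟩
  have hn' : (0 : ℝ) < n := by exact_mod_cast hn
  have hnτ : (0 : ℝ) < n * τ := by positivity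
  set S := ∑ i ∈ Finset.Icc 1 n, K (design n τ t i) with hS
  -- `K` vanishes at 2, so its size is bounded by its variation.
  have hKle : ∀ x, K x ≤ V := fun x => by
    have h2 : K 2 = 0 := hK.support 2 (by norm_num)
    have h3 : |K x - K 2| ≤ V := by
      rcases le_total 2 x with h | h
      · exact (hKv _ _ h).trans (hv _ _)
      · rw [abs_sub_comm]; exact (hKv _ _ h).trans (hv _ _)
    rw [h2, sub_zero] at h3
    exact (le_abs_self _).trans h3
  have hS1 : |S - n * τ| ≤ V + 1 := by
    have := abs_riemannSum_sub_le hK hv hKv hmono hK.integrable hK.support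
      (fun x y => le_add_of_nonneg_right (mul_nonneg (hK.nonneg y) (abs_nonneg _))) hn hτ ht
    rwa [hK.integral_eq_one, mul_one] at this
  have hSge : n * τ / 2 ≤ S := by have := (abs_le.1 hS1).1; linarith
  have hSpos : 0 < S := by linarith
  have hinv : S⁻¹ ≤ 2 / (n * τ) := by
    rw [inv_le_comm₀ hSpos (by positivity), inv_div]; exact hSge
  have hw : ∀ i, weight K n τ t i = K (design n τ t i) * S⁻¹ := fun i => div_eq_mul_inv _ _
  have hmom : |∑ i ∈ Finset.Icc 1 n, K (design n τ t i) * design n τ t i| ≤ V + 1 := by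
    have hi : Integrable fun x => K x * x := by
      refine hK.integrable.mono (hK.integrable.1.mul (by fun_prop)) (.of_forall fun x => ?_)
      rw [norm_mul]
      by_cases hx : 1 < |x|
      · simp [hK.support x hx]
      · exact mul_le_of_le_one_right (norm_nonneg _) (not_lt.1 hx)
    have h0 : ∫ x, K x * x = 0 := by
      have := integral_neg_eq_self (fun x => K x * x) volume
      simp only [hK.symm, mul_neg, integral_neg] at this
      linarith
    have := abs_riemannSum_sub_le hK hv hKv hmono (f := fun x => K x * x) hi
      (fun x hx => by simp [hK.support x hx]) (fun x y => ?_) hn hτ ht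
    · rwa [h0, mul_zero, sub_zero] at this
    -- The product rule puts the factor `x` on the increment of `K` and so needs `|x| ≤ 1`;
    -- otherwise `K x = 0`.
    · by_cases hx : |x| ≤ 1
      · have e : K x * x - K y * y = (K x - K y) * x + K y * (x - y) := by ring
        rw [e]
        refine (abs_add_le _ _).trans (add_le_add ?_ ?_)
        · rw [abs_mul]; exact mul_le_of_le_one_right (abs_nonneg _) hx
        · rw [abs_mul, abs_of_nonneg (hK.nonneg y)]
      · have hx0 := hK.support x (not_le.1 hx)
        have h1 : |K x * x - K y * y| ≤ |K x - K y| := by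
          rw [hx0]
          simp only [zero_mul, zero_sub, abs_neg, abs_mul]
          by_cases hy : 1 < |y|
          · simp [hK.support y hy]
          · exact mul_le_of_le_one_right (abs_nonneg _) (not_lt.1 hy)
        exact h1.trans (le_add_of_nonneg_right (mul_nonneg (hK.nonneg y) (abs_nonneg _)))
  refine ⟨fun i => ?_, fun i => ?_, ?_, ?_, ?_, fun i hi => ?_⟩
  · rw [hw]; exact mul_nonneg (hK.nonneg _) (inv_nonneg.2 hSpos.le)
  · rw [hw]
    calc K (design n τ t i) * S⁻¹ ≤ (V + 1) * (2 / (n * τ)) :=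
          mul_le_mul ((hKle _).trans (by linarith)) hinv (inv_nonneg.2 hSpos.le) (by linarith)
      _ = _ := by ring
  · simp only [hw, ← Finset.sum_mul, ← hS]; exact mul_inv_cancel₀ hSpos.ne'
  · have hle : ∀ i, design n τ t i ≤ design n τ t (i + 1) := fun i => by
      unfold design; push_cast; gcongr; linarith
    calc ∑ i ∈ Finset.range n, |weight K n τ t (i + 1) - weight K n τ t i|
        = (∑ i ∈ Finset.range n, |K (design n τ t (i + 1)) - K (design n τ t i)|) * S⁻¹ := by
          rw [Finset.sum_mul]
          refine Finset.sum_congr rfl fun i _ => ?_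
          rw [hw, hw, ← sub_mul, abs_mul, abs_of_nonneg (inv_nonneg.2 hSpos.le)]
      _ ≤ (V + 1) * (2 / (n * τ)) := by
          refine mul_le_mul ?_ hinv (inv_nonneg.2 hSpos.le) (by linarith)
          refine (Finset.sum_le_sum fun i _ => hKv _ _ (hle i)).trans ?_
          rw [Finset.sum_range_sub (fun i => v (design n τ t i))]
          linarith [hv (design n τ t n) (design n τ t 0)]
      _ = _ := by ring
  · have e : ∑ i ∈ Finset.Icc 1 n, weight K n τ t i * ((i : ℝ) / n - t) =
        τ * S⁻¹ * ∑ i ∈ Finset.Icc 1 n, K (design n τ t i) * design n τ t i := by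
      rw [Finset.mul_sum]
      refine Finset.sum_congr rfl fun i _ => ?_
      have : (i : ℝ) / n - t = τ * design n τ t i := by unfold design; field_simp
      rw [hw, this]; ring
    rw [e, abs_mul, abs_of_nonneg (mul_nonneg hτ.le (inv_nonneg.2 hSpos.le))]
    calc τ * S⁻¹ * |∑ i ∈ Finset.Icc 1 n, K (design n τ t i) * design n τ t i|
        ≤ τ * (2 / (n * τ)) * (V + 1) := by gcongr
      _ = _ := by field_simp
  · rw [hw] at hi
    have h1 : ¬ 1 < |design n τ t i| := fun h => hi (by rw [hK.support _ h, zero_mul])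
    rw [not_lt, design, abs_div, abs_of_pos hτ, div_le_one hτ] at h1
    exact h1

theorem WeightBounds.sum_sq_le {K : ℝ → ℝ} {B : ℝ} {n : ℕ} {τ t : ℝ}
    (hw : WeightBounds K B n τ t) :
    ∑ i ∈ Finset.Icc 1 n, weight K n τ t i ^ 2 ≤ B / (n * τ) := by
  calc ∑ i ∈ Finset.Icc 1 n, weight K n τ t i ^ 2
      ≤ ∑ i ∈ Finset.Icc 1 n, B / (n * τ) * weight K n τ t i := Finset.sum_le_sum fun i _ => by
        rw [sq]; exact mul_le_mul_of_nonneg_right (hw.le i) (hw.nonneg i)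
    _ = _ := by rw [← Finset.mul_sum, hw.sum_eq_one, mul_one]

end KernelWeights

/-! ### Taylor expansion and smoothing bias. -/

section Taylor

/-- A uniform first-order Taylor expansion for `C²` functions on the unit interval. -/
theorem exists_taylor_bound {g : ℝ → ℝ} (hg : ContDiffOn ℝ 2 g (Set.Icc (0 : ℝ) 1)) :
    ∃ M, 0 ≤ M ∧ ∃ g' : ℝ → ℝ, (∀ t ∈ Set.Icc (0 : ℝ) 1, |g' t| ≤ M) ∧
      ∀ t ∈ Set.Icc (0 : ℝ) 1, ∀ s ∈ Set.Icc (0 : ℝ) 1,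
        |g s - g t - g' t * (s - t)| ≤ M * (s - t) ^ 2 := by
  set I := Set.Icc (0 : ℝ) 1
  have hu : UniqueDiffOn ℝ I := uniqueDiffOn_Icc zero_lt_one
  have h2 : ContDiffOn ℝ (1 + 1) g I := by simpa [one_add_one_eq_two] using hg
  obtain ⟨hd, -, h1⟩ := (contDiffOn_succ_iff_derivWithin hu).1 h2
  obtain ⟨hd', hc⟩ := (contDiffOn_one_iff_derivWithin hu).1 h1
  obtain ⟨M1, hM1⟩ := isCompact_Icc.exists_bound_of_continuousOn h1.continuousOn
  obtain ⟨M2, hM2⟩ := isCompact_Icc.exists_bound_of_continuousOn hc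
  have hM20 : 0 ≤ M2 := (norm_nonneg _).trans (hM2 0 ⟨le_rfl, zero_le_one⟩)
  refine ⟨max M1 M2, hM20.trans (le_max_right _ _), derivWithin g I,
    fun t ht => (hM1 t ht).trans (le_max_left _ _), fun t ht s hs => ?_⟩
  have hlip : ∀ x ∈ I, |derivWithin g I x - derivWithin g I t| ≤ M2 * |x - t| := fun x hx =>
    (convex_Icc (0 : ℝ) 1).norm_image_sub_le_of_norm_hasDerivWithin_le
      (fun y hy => (hd' y hy).hasDerivWithinAt) hM2 ht hx
  have hsub : Set.uIcc t s ⊆ I := Set.OrdConnected.uIcc_subset Set.ordConnected_Icc ht hs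
  have h := (convex_uIcc t s).norm_image_sub_le_of_norm_hasDerivWithin_le
    (f := fun x => g x - derivWithin g I t * x)
    (f' := fun x => derivWithin g I x - derivWithin g I t * 1) (C := M2 * |s - t|)
    (fun x hx => ((hd x (hsub hx)).hasDerivWithinAt.mono hsub).sub
      ((hasDerivWithinAt_id x _).const_mul _))
    (fun x hx => by
      rw [mul_one, Real.norm_eq_abs]
      refine (hlip x (hsub hx)).trans (mul_le_mul_of_nonneg_left ?_ hM20)
      exact Set.abs_sub_left_of_mem_uIcc hx)
    Set.left_mem_uIcc Set.right_mem_uIcc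
  calc |g s - g t - derivWithin g I t * (s - t)|
      = ‖g s - derivWithin g I t * s - (g t - derivWithin g I t * t)‖ := by
        rw [Real.norm_eq_abs]; congr 1; ring
    _ ≤ M2 * |s - t| * ‖s - t‖ := h
    _ = M2 * (s - t) ^ 2 := by rw [Real.norm_eq_abs, mul_assoc, abs_mul_abs_self, sq]
    _ ≤ _ := by gcongr; exact le_max_right _ _

/-- The smoothing bias. -/
theorem WeightBounds.abs_sum_sub_le {K : ℝ → ℝ} {B : ℝ} {n : ℕ} {τ t : ℝ}
    (hw : WeightBounds K B n τ t) {g g' : ℝ → ℝ} {M : ℝ}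
    (ht : t ∈ Set.Icc (0 : ℝ) 1) (hM : ∀ t ∈ Set.Icc (0 : ℝ) 1, |g' t| ≤ M)
    (hg : ∀ t ∈ Set.Icc (0 : ℝ) 1, ∀ s ∈ Set.Icc (0 : ℝ) 1,
        |g s - g t - g' t * (s - t)| ≤ M * (s - t) ^ 2) :
    |∑ i ∈ Finset.Icc 1 n, weight K n τ t i * g ((i : ℝ) / n) - g t| ≤ M * (B / n) + M * τ ^ 2 := by
  have hM0 : 0 ≤ M := (abs_nonneg _).trans (hM t ht)
  have e : ∑ i ∈ Finset.Icc 1 n, weight K n τ t i * g ((i : ℝ) / n) - g t =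
      g' t * ∑ i ∈ Finset.Icc 1 n, weight K n τ t i * ((i : ℝ) / n - t) +
      ∑ i ∈ Finset.Icc 1 n, weight K n τ t i *
        (g ((i : ℝ) / n) - g t - g' t * ((i : ℝ) / n - t)) := by
    have : g t = ∑ i ∈ Finset.Icc 1 n, weight K n τ t i * g t := by
      rw [← Finset.sum_mul, hw.sum_eq_one, one_mul]
    conv_lhs => rw [this]
    rw [Finset.mul_sum, ← Finset.sum_sub_distrib, ← Finset.sum_add_distrib]
    exact Finset.sum_congr rfl fun i _ => by ring
  rw [e]
  refine (abs_add_le _ _).trans (add_le_add ?_ ?_)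
  · rw [abs_mul]; exact mul_le_mul (hM t ht) hw.first_moment (abs_nonneg _) hM0
  · calc _ ≤ ∑ i ∈ Finset.Icc 1 n, weight K n τ t i * (M * τ ^ 2) := by
          refine (Finset.abs_sum_le_sum_abs _ _).trans (Finset.sum_le_sum fun i hi => ?_)
          rw [abs_mul, abs_of_nonneg (hw.nonneg i)]
          by_cases h0 : weight K n τ t i = 0
          · simp [h0]
          · refine mul_le_mul_of_nonneg_left ?_ (hw.nonneg i)
            have hi' := Finset.mem_Icc.1 hi
            refine (hg t ht _ ⟨by positivity, div_le_one_of_le₀ (by exact_mod_cast hi'.2)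
              (by positivity)⟩).trans ?_
            refine mul_le_mul_of_nonneg_left ?_ hM0
            rw [← sq_abs]
            exact pow_le_pow_left₀ (abs_nonneg _) (hw.support i h0) 2
      _ = _ := by rw [← Finset.sum_mul, hw.sum_eq_one, one_mul]

end Taylor

/-! ### Summation by parts. -/

section Abel

theorem sum_mul_eq_abel (w d : ℕ → ℝ) (n : ℕ) :
    ∑ q ∈ Finset.range n, w q * d q = w n * ∑ q ∈ Finset.range n, d q +
      ∑ q ∈ Finset.range n, (w q - w (q + 1)) * ∑ r ∈ Finset.range (q + 1), d r := by
  induction n with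
  | zero => simp
  | succ n ih =>
    rw [Finset.sum_range_succ, ih, Finset.sum_range_succ (fun q => (w q - w (q + 1)) * _),
      Finset.sum_range_succ d n]
    ring

/-- Weighted sums are bounded by the variation of the weights times the largest partial sum. -/
theorem abs_sum_mul_le_runMax (w d : ℕ → ℝ) (n : ℕ) :
    |∑ q ∈ Finset.range n, w q * d q| ≤
      (|w n| + ∑ q ∈ Finset.range n, |w q - w (q + 1)|) *
        runMax (fun j => |∑ q ∈ Finset.range j, d q|) n := by
  rw [sum_mul_eq_abel, add_mul, Finset.sum_mul]
  refine (abs_add_le _ _).trans (add_le_add ?_ ((Finset.abs_sum_le_sum_abs _ _).trans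
    (Finset.sum_le_sum fun q hq => ?_)))
  · rw [abs_mul]
    exact mul_le_mul_of_nonneg_left
      (le_runMax (fun j => |∑ q ∈ Finset.range j, d q|) le_rfl) (abs_nonneg _)
  · rw [abs_mul]
    exact mul_le_mul_of_nonneg_left
      (le_runMax (fun j => |∑ q ∈ Finset.range j, d q|) (Finset.mem_range.1 hq)) (abs_nonneg _)

theorem sum_Icc_one_eq_sum_reverse (f : ℕ → ℝ) (n : ℕ) :
    ∑ i ∈ Finset.Icc 1 n, f i = ∑ q ∈ Finset.range n, f (n - q) := by
  rw [sum_Icc_one_eq_sum_range, ← Finset.sum_range_reflect]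
  refine Finset.sum_congr rfl fun q hq => ?_
  have := Finset.mem_range.1 hq
  congr 1; omega

/-- Summation by parts for the smoothing weights. -/
theorem WeightBounds.abs_sum_mul_le {K : ℝ → ℝ} {B : ℝ} {n : ℕ} {τ t : ℝ}
    (hw : WeightBounds K B n τ t) (d : ℕ → ℝ) :
    |∑ i ∈ Finset.Icc 1 n, weight K n τ t i * d i| ≤
      2 * (B / (n * τ)) * runMax (fun j => |∑ q ∈ Finset.range j, d (n - q)|) n := by
  rw [sum_Icc_one_eq_sum_reverse (fun i => weight K n τ t i * d i)]
  refine (abs_sum_mul_le_runMax (fun q => weight K n τ t (n - q)) (fun q => d (n - q)) n).trans ?_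
  refine mul_le_mul_of_nonneg_right ?_ (runMax_abs_nonneg _ n)
  rw [two_mul]
  refine add_le_add ?_ ?_
  · rw [abs_of_nonneg (hw.nonneg _)]; exact hw.le _
  -- Backwards, the weights run from index `n` down to `0`; hence `variation` includes the increment
  -- from index 0, which lies outside the sample.
  · refine le_trans (le_of_eq ?_) hw.variation
    rw [← Finset.sum_range_reflect]
    refine Finset.sum_congr rfl fun q hq => ?_
    have := Finset.mem_range.1 hq
    rw [show n - (n - 1 - q) = q + 1 by omega, show n - (n - 1 - q + 1) = q by omega]

end Abel

/-! ### Series with logarithms. -/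

section LogSeries

/-- Cauchy condensation turns the series into a multiple of `∑ 1/k²`. -/
theorem summable_inv_mul_log_sq : Summable fun j : ℕ => 1 / ((j : ℝ) * Real.log j ^ 2) := by
  refine (summable_condensed_iff_of_eventually_nonneg
    (.of_forall fun j => by positivity) ?_).1 ?_
  · filter_upwards [eventually_ge_atTop 2] with j hj
    have hj' : (2 : ℝ) ≤ j := by exact_mod_cast hj
    have hlog : 0 < Real.log j := Real.log_pos (by linarith)
    have hl : Real.log j ≤ Real.log (j + 1 : ℕ) :=
      Real.log_le_log (by linarith) (by push_cast; linarith)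
    have h0 : (0 : ℝ) < j * Real.log j ^ 2 := by positivity
    refine one_div_le_one_div_of_le h0 ?_
    gcongr
    exact Nat.le_succ j
  · have h := (Real.summable_one_div_nat_pow.2 one_lt_two).mul_left (1 / Real.log 2 ^ 2)
    refine h.congr fun k => ?_
    have h2 : (2 : ℝ) ^ k ≠ 0 := by positivity
    push_cast
    rw [Real.log_pow, mul_pow]
    field_simp

/-- The sequence bounding the dependence measures, with a free choice of the first two terms. -/
def depBound (C₀ C : ℝ) (j : ℕ) : ℝ := if j < 2 then C₀ else C / ((j : ℝ) * Real.log j) ^ 2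

theorem depBound_nonneg {C₀ C : ℝ} (h₀ : 0 ≤ C₀) (h : 0 ≤ C) (j : ℕ) : 0 ≤ depBound C₀ C j := by
  unfold depBound; split_ifs <;> positivity

/-- From `j = 2` on, `1 + j ≤ 2j` cancels one power of `j` and leaves a multiple of `1/(j log² j)`.
-/
theorem summable_depBound {C₀ C : ℝ} (h : 0 ≤ C) :
    Summable fun j : ℕ => (1 + (j : ℝ)) * depBound C₀ C j := by
  rw [← summable_nat_add_iff 2]
  refine Summable.of_nonneg_of_le (fun j => ?_) (fun j => ?_)
    (((summable_nat_add_iff 2).2 summable_inv_mul_log_sq).mul_left (2 * C))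
  · unfold depBound; rw [if_neg (by omega)]; positivity
  · unfold depBound; rw [if_neg (by omega)]
    have hj' : (2 : ℝ) ≤ (j + 2 : ℕ) := by push_cast; linarith [(Nat.cast_nonneg j : (0 : ℝ) ≤ j)]
    set x : ℝ := ((j + 2 : ℕ) : ℝ)
    have hlog : 0 < Real.log x := Real.log_pos (by linarith)
    calc (1 + x) * (C / (x * Real.log x) ^ 2) ≤ (2 * x) * (C / (x * Real.log x) ^ 2) := by
          gcongr; linarith
      _ = _ := by field_simp

end LogSeries

/-! ### The errors as filters of one innovation sequence. -/

section Filters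

theorem shiftSeq_past {Ω E : Type*} (ζ : ℤ → Ω → E) (i : ℤ) (p : ℕ) (ω : Ω) :
    shiftSeq p (past ζ i ω) = past ζ (i - p) ω := by
  funext l
  simp only [shiftSeq, past]
  congr 1
  push_cast; ring

/-- In `past ζ j` the innovation of time 0 sits at position `j`, so the dependence measure at lag
`j` resamples coordinate `j`. -/
theorem coupledPast_eq_update {Ω E : Type*} (ζ : ℤ → Ω → E) (j : ℕ) (p : Ω × Ω) :
    coupledPast ζ j p = Function.update (past ζ j p.1) j (past ζ j p.2 j) := by
  funext l
  by_cases h : l = j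
  · subst h; simp [coupledPast, past]
  · rw [Function.update_of_ne h]
    simp only [coupledPast, past]
    rw [if_neg]
    omega

/-- The difference filter at lag `k`. -/
def lagDiff {E : Type*} (G : ℝ → (ℕ → E) → ℝ) (k : ℕ) (t : ℝ) (F : ℕ → E) : ℝ := G t F - G t (shiftSeq k F)

/-- The components of the bivariate error filter. -/
def errComp {Ω E : Type*} [MeasurableSpace Ω] (P : Measure Ω) (ζ : ℤ → Ω → E) (G : ℝ → (ℕ → E) → ℝ) (h k : ℕ) (a : Fin 2) (t : ℝ)
    (F : ℕ → E) : ℝ := errFilter₂ P ζ G h k t F a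

theorem errComp_eq {Ω E : Type*} [MeasurableSpace Ω] (P : Measure Ω) (ζ : ℤ → Ω → E) (G : ℝ → (ℕ → E) → ℝ) (h k : ℕ) (a : Fin 2)
    (t : ℝ) (F : ℕ → E) :
    errComp P ζ G h k a t F = lagDiff G (![h, k] a) t F ^ 2 - trend P ζ G (![h, k] a) t := by
  fin_cases a <;> rfl

/-- The newest innovation in the sample is that of time `n + h`. Seen from there, the lag-`h` error
at `u` is shifted by `n - u` and the lag-`k` error by `h - k` more, which explains the offsets `![0,
h - k]`. -/
theorem blockSum_apply {Ω E : Type*} [MeasurableSpace Ω] {P : Measure Ω} {ζ : ℤ → Ω → E}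
    {G : ℝ → (ℕ → E) → ℝ} {h k : ℕ} (hkh : k < h) (n m i : ℕ) (a : Fin 2) (ω : Ω) :
    blockSum P ζ G h k n m i ω a =
      seqBlock (errComp P ζ G h k) ![0, h - k] n m i a (past ζ (n + h) ω) := by
  unfold blockSum seqBlock
  rw [Finset.sum_apply]
  have hinj : Set.InjOn (fun u : ℕ => (u : ℤ) - i) (window n m i) := fun u _ v _ h => by
    simp only at h; omega
  have hsub : (window n m i).image (fun u : ℕ => (u : ℤ) - i) ⊆ Finset.Icc (-(m : ℤ)) m := by
    intro v hv
    simp only [window, Finset.mem_image, Finset.mem_filter, Finset.mem_Icc] at hv ⊢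
    omega
  rw [← Finset.sum_subset hsub, Finset.sum_image hinj]
  · refine Finset.sum_congr rfl fun u hu => ?_
    simp only [window, Finset.mem_filter, Finset.mem_Icc] at hu
    rw [show (i : ℤ) + ((u : ℤ) - i) = u by ring, err, if_pos (by omega), shiftSeq_past]
    fin_cases a
    · change errFilter P ζ G h _ _ = errFilter P ζ G h _ _
      congr 2
      change (u : ℤ) + h = n + h - ((n - u + 0 : ℕ) : ℤ)
      omega
    · change errFilter P ζ G k _ _ = errFilter P ζ G k _ _
      congr 2
      change (u : ℤ) + k = n + h - ((n - u + (h - k) : ℕ) : ℤ)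
      omega
  · intro v hv hv'
    rw [err, if_neg]
    · rfl
    · intro hv2
      refine hv' ?_
      simp only [window, Finset.mem_image, Finset.mem_filter, Finset.mem_Icc] at hv ⊢
      exact ⟨(i + v).toNat, by omega, by omega⟩

theorem estimator_apply {Ω E : Type*} [MeasurableSpace Ω] {P : Measure Ω} {ζ : ℤ → Ω → E}
    {G : ℝ → (ℕ → E) → ℝ} {h k : ℕ} (hkh : k < h) (K : ℝ → ℝ) (n m : ℕ) (τ t : ℝ) (ω : Ω)
    (a b : Fin 2) :
    estimator P ζ G h k K n m τ t ω a b = ∑ i ∈ Finset.Icc 1 n, weight K n τ t i *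
      blockProd (errComp P ζ G h k) ![0, h - k] n m i a b (past ζ (n + h) ω) := by
  simp only [estimator, Matrix.sum_apply, Matrix.smul_apply, smul_eq_mul, blockMat,
    Matrix.vecMulVec_apply, blockSum_apply hkh, blockProd]

end Filters

/-! ### Transfer of the assumptions to the sequence space. -/

section Transfer

variable {Ω E : Type*} [MeasurableSpace Ω] [MeasurableSpace E] {P : Measure Ω} {ζ : ℤ → Ω → E}

theorem IsIID.isProbabilityMeasure_map [IsProbabilityMeasure P] (hζ : IsIID P ζ) : IsProbabilityMeasure (P.map (ζ 0)) :=
  Measure.isProbabilityMeasure_map (hζ.measurable 0).aemeasurable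

theorem IsIID.measurePreserving_past (hζ : IsIID P ζ) [IsProbabilityMeasure (P.map (ζ 0))] (i : ℤ) :
    MeasurePreserving (past ζ i) P (iidLaw (P.map (ζ 0))) := by
  have hm : ∀ l : ℕ, Measurable (ζ (i - l)) := fun l => hζ.measurable _
  have hind : iIndepFun (fun l : ℕ => ζ (i - l)) P :=
    hζ.indep.precomp (g := fun l : ℕ => i - l) fun l l' h => by simp only at h; omega
  refine ⟨measurable_pi_lambda _ hm, ?_⟩
  have h := hind.map_fun_eq_infinitePi_map hm
  have e : ∀ l : ℕ, P.map (ζ (i - l)) = P.map (ζ 0) := fun l => (hζ.identDistrib _).map_eq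
  simp only [e] at h
  exact h

theorem integral_comp_measurePreserving {X Y : Type*} [MeasurableSpace X] [MeasurableSpace Y]
    {κ : Measure X} {ρ : Measure Y} {T : X → Y} (hT : MeasurePreserving T κ ρ) {f : Y → ℝ}
    (hf : AEStronglyMeasurable f ρ) : ∫ x, f (T x) ∂κ = ∫ y, f y ∂ρ := by
  rw [← hT.map_eq] at hf ⊢
  exact (integral_map hT.measurable.aemeasurable hf).symm

variable {G : ℝ → (ℕ → E) → ℝ} [IsProbabilityMeasure (P.map (ζ 0))]

theorem memLp_G (hζ : IsIID P ζ) (hGm : ∀ t ∈ Set.Icc (0 : ℝ) 1, Measurable (G t))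
    (hG : IsStochLipschitz P ζ G) {t : ℝ} (ht : t ∈ Set.Icc (0 : ℝ) 1) :
    MemLp (G t) 8 (iidLaw (P.map (ζ 0))) := by
  obtain ⟨M, hM⟩ := hG.moment
  refine ⟨(hGm t ht).aestronglyMeasurable, ?_⟩
  rw [← eLpNorm_comp_measurePreserving (hGm t ht).aestronglyMeasurable
    (hζ.measurePreserving_past 0)]
  exact (hM 0 t ht).trans_lt ENNReal.ofReal_lt_top

variable [IsProbabilityMeasure P]

/-- By stationarity the squared means cancel and the trend is the second moment of the lag
difference; this is what centres the errors. -/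
theorem trend_eq_integral (hζ : IsIID P ζ) (hGm : ∀ t ∈ Set.Icc (0 : ℝ) 1, Measurable (G t))
    (hG : IsStochLipschitz P ζ G) {t : ℝ} (ht : t ∈ Set.Icc (0 : ℝ) 1) (k : ℕ) :
    trend P ζ G k t = ∫ x, lagDiff G k t x ^ 2 ∂(iidLaw (P.map (ζ 0))) := by
  set ν := iidLaw (P.map (ζ 0))
  have m8 := memLp_G hζ hGm hG ht
  have m2 : MemLp (G t) 2 ν := m8.mono_exponent (by norm_num)
  have hsh := measurePreserving_shiftSeq (P.map (ζ 0))
  have m2s : ∀ p, MemLp (fun x => G t (shiftSeq p x)) 2 ν := fun p =>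
    m2.comp_measurePreserving (hsh p)
  have hcov : ∀ k : ℕ, autocov P ζ G k t =
      ∫ x, G t x * G t (shiftSeq k x) ∂ν - (∫ x, G t x ∂ν) ^ 2 := by
    intro k
    have hp := hζ.measurePreserving_past
    have e0 : (fun ω => G t (past ζ 0 ω)) = fun ω => G t (shiftSeq k (past ζ k ω)) := by
      funext ω; rw [shiftSeq_past, sub_self]
    have mk : MemLp (fun ω => G t (past ζ k ω)) 2 P := m2.comp_measurePreserving (hp k)
    have m0 : MemLp (fun ω => G t (past ζ 0 ω)) 2 P := m2.comp_measurePreserving (hp 0)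
    rw [autocov, covariance_eq_sub mk m0, integral_comp_measurePreserving (hp k) m2.1,
      integral_comp_measurePreserving (hp 0) m2.1, sq]
    congr 1
    rw [e0]
    exact integral_comp_measurePreserving (f := fun x => G t x * G t (shiftSeq k x)) (hp k)
      (m2.1.mul (m2s k).1)
  have h0 : ∀ x : ℕ → E, shiftSeq 0 x = x := fun x => rfl
  have i1 : Integrable (fun x => G t x ^ 2) ν := m2.integrable_sq
  have i2 : Integrable (fun x => 2 * (G t x * G t (shiftSeq k x))) ν :=
    (m2.integrable_mul (m2s k)).const_mul 2
  have i3 : Integrable (fun x => G t (shiftSeq k x) ^ 2) ν := (m2s k).integrable_sq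
  have i4 : Integrable (fun x => G t x ^ 2 - 2 * (G t x * G t (shiftSeq k x))) ν := i1.sub i2
  have e : ∀ x, lagDiff G k t x ^ 2 =
      G t x ^ 2 - 2 * (G t x * G t (shiftSeq k x)) + G t (shiftSeq k x) ^ 2 := fun x => by
    unfold lagDiff; ring
  have e3 : ∫ x, G t (shiftSeq k x) ^ 2 ∂ν = ∫ x, G t x ^ 2 ∂ν :=
    integral_comp_measurePreserving (f := fun x => G t x ^ 2) (hsh k) (m2.1.pow 2)
  rw [trend, hcov, hcov]
  simp_rw [e]
  rw [integral_add i4 i3, integral_sub i1 i2, integral_const_mul, e3]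
  simp only [h0, ← sq]
  ring

/-- Eighth moments of `G` put the squared differences in `L⁴`. Writing `a² - b² = (a - b)(a + b)`,
Hölder gives them the `L²` Lipschitz constant `8|C||M|`, and the trend inherits the same constant,
whence 16. -/
theorem filterBounds_errComp (hζ : IsIID P ζ)
    (hGm : ∀ t ∈ Set.Icc (0 : ℝ) 1, Measurable (G t))
    (hG : IsStochLipschitz P ζ G) (h k : ℕ)
    (hδ : ∃ C : ℝ, ∀ j : ℕ, 2 ≤ j →
      physDep P ζ 4 (errFilter₂ P ζ G h k) j
        ≤ ENNReal.ofReal (C / ((j : ℝ) * Real.log j) ^ 2)) :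
    ∃ (Λ : ℝ) (δ : ℕ → ℝ), FilterBounds (P.map (ζ 0)) (errComp P ζ G h k) Λ δ := by
  obtain ⟨C, hC⟩ := hG.lipschitz
  obtain ⟨M, hM⟩ := hG.moment
  obtain ⟨D, hD⟩ := hδ
  set μ := P.map (ζ 0)
  have hp := hζ.measurePreserving_past
  have hsh := measurePreserving_shiftSeq μ
  have m8 : ∀ t ∈ Set.Icc (0 : ℝ) 1, MemLp (G t) 8 (iidLaw μ) := fun t ht => memLp_G hζ hGm hG ht
  have n8 : ∀ t ∈ Set.Icc (0 : ℝ) 1, lpNorm (G t) 8 (iidLaw μ) ≤ |M| := fun t ht => by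
    refine lpNorm_le_of_eLpNorm_le (abs_nonneg M) ?_
    rw [← eLpNorm_comp_measurePreserving (hGm t ht).aestronglyMeasurable (hp 0)]
    exact (hM 0 t ht).trans (ENNReal.ofReal_le_ofReal (le_abs_self M))
  have n4 : ∀ t ∈ Set.Icc (0 : ℝ) 1, ∀ s ∈ Set.Icc (0 : ℝ) 1,
      lpNorm (fun x => G t x - G s x) 4 (iidLaw μ) ≤ |C| * |t - s| := fun t ht s hs => by
    refine lpNorm_le_of_eLpNorm_le (by positivity) ?_
    have hm : Measurable fun x => G t x - G s x := (hGm t ht).sub (hGm s hs)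
    rw [← eLpNorm_comp_measurePreserving hm.aestronglyMeasurable (hp 0)]
    refine (hC 0 t ht s hs).trans (ENNReal.ofReal_le_ofReal ?_)
    gcongr
    exact le_abs_self C
  have d8 : ∀ l, ∀ t ∈ Set.Icc (0 : ℝ) 1, MemLp (lagDiff G l t) 8 (iidLaw μ) := fun l t ht =>
    (m8 t ht).sub ((m8 t ht).comp_measurePreserving (hsh l))
  have nd8 : ∀ l, ∀ t ∈ Set.Icc (0 : ℝ) 1, lpNorm (lagDiff G l t) 8 (iidLaw μ) ≤ 2 * |M| :=
    fun l t ht => by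
      have h1 : lpNorm (lagDiff G l t) 8 (iidLaw μ) ≤ lpNorm (G t) 8 (iidLaw μ) +
          lpNorm (fun x => G t (shiftSeq l x)) 8 (iidLaw μ) :=
        lpNorm_sub_le (m8 t ht) (by norm_num)
      rw [lpNorm_comp_measurePreserving (hsh l) (m8 t ht).1] at h1
      linarith [n8 t ht]
  have h48 : (4 : ℝ≥0∞) ≤ 8 := by norm_num
  have h24 : (2 : ℝ≥0∞) ≤ 4 := by norm_num
  have sq4 : ∀ l, ∀ t ∈ Set.Icc (0 : ℝ) 1, MemLp (fun x => lagDiff G l t x ^ 2) 4 (iidLaw μ) :=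
    fun l t ht => by
      simp only [sq]; exact (d8 l t ht).mul' (d8 l t ht)
  have nsq4 : ∀ l, ∀ t ∈ Set.Icc (0 : ℝ) 1,
      lpNorm (fun x => lagDiff G l t x ^ 2) 4 (iidLaw μ) ≤ 4 * M ^ 2 := fun l t ht => by
    simp only [sq]
    refine (lpNorm_mul_le 4 (d8 l t ht) (d8 l t ht)).trans
      ((mul_le_mul (nd8 l t ht) (nd8 l t ht) lpNorm_nonneg (by positivity)).trans_eq ?_)
    rw [← abs_mul_abs_self M]; ring
  have ntr : ∀ l, ∀ t ∈ Set.Icc (0 : ℝ) 1, |trend P ζ G l t| ≤ 4 * M ^ 2 := fun l t ht => by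
    rw [trend_eq_integral hζ hGm hG ht]
    exact (abs_integral_le_lpNorm_one _).trans
      ((lpNorm_le_lpNorm_of_exponent_le (by norm_num) (sq4 l t ht)).trans (nsq4 l t ht))
  have ecomp : ∀ a t, errComp P ζ G h k a t =
      fun x => lagDiff G (![h, k] a) t x ^ 2 - trend P ζ G (![h, k] a) t := fun a t =>
    funext fun x => errComp_eq P ζ G h k a t x
  have mem4 : ∀ a, ∀ t ∈ Set.Icc (0 : ℝ) 1, MemLp (errComp P ζ G h k a t) 4 (iidLaw μ) :=
    fun a t ht => by
      rw [ecomp]; exact (sq4 _ t ht).sub (memLp_const _)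
  have meas : ∀ a, ∀ t ∈ Set.Icc (0 : ℝ) 1, Measurable (errComp P ζ G h k a t) :=
    fun a t ht => by
      rw [ecomp]
      exact (((hGm t ht).sub ((hGm t ht).comp (measurable_shiftSeq _))).pow_const 2).sub_const _
  have norm4 : ∀ a, ∀ t ∈ Set.Icc (0 : ℝ) 1,
      lpNorm (errComp P ζ G h k a t) 4 (iidLaw μ) ≤ 8 * M ^ 2 := fun a t ht => by
    rw [ecomp]
    have h1 : lpNorm (fun x => lagDiff G (![h, k] a) t x ^ 2 - trend P ζ G (![h, k] a) t) 4
        (iidLaw μ) ≤ lpNorm (fun x => lagDiff G (![h, k] a) t x ^ 2) 4 (iidLaw μ) +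
        lpNorm (fun _ => trend P ζ G (![h, k] a) t) 4 (iidLaw μ) :=
      lpNorm_sub_le (sq4 _ t ht) (by norm_num)
    have h2 : lpNorm (fun _ : ℕ → E => trend P ζ G (![h, k] a) t) 4 (iidLaw μ) =
        |trend P ζ G (![h, k] a) t| := by
      rw [lpNorm_const (by simp) (IsProbabilityMeasure.ne_zero _)]
      simp
    linarith [nsq4 (![h, k] a) t ht, ntr (![h, k] a) t ht]
  refine ⟨16 * |C| * |M|, depBound (16 * M ^ 2) |D|, meas, mem4, fun a t ht => ?_, by positivity,
    fun a t ht s hs => ?_, fun a t ht j => ?_,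
    depBound_nonneg (by positivity) (abs_nonneg D), summable_depBound (abs_nonneg D)⟩
  · rw [ecomp, integral_sub ((sq4 _ t ht).integrable (by norm_num)) (integrable_const _),
      trend_eq_integral hζ hGm hG ht]
    simp [μ]
  · set l := ![h, k] a
    have hdiff : MemLp (fun x => lagDiff G l t x ^ 2 - lagDiff G l s x ^ 2) 4 (iidLaw μ) :=
      (sq4 l t ht).sub (sq4 l s hs)
    have h4t := (d8 l t ht).mono_exponent h48
    have h4s := (d8 l s hs).mono_exponent h48
    have hminus : lpNorm (fun x => lagDiff G l t x - lagDiff G l s x) 4 (iidLaw μ) ≤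
        2 * (|C| * |t - s|) := by
      have e : (fun x => lagDiff G l t x - lagDiff G l s x) =
          (fun x => G t x - G s x) - fun x => G t (shiftSeq l x) - G s (shiftSeq l x) := by
        funext x; simp only [lagDiff, Pi.sub_apply]; ring
      have mm : MemLp (fun x => G t x - G s x) 4 (iidLaw μ) :=
        ((m8 t ht).sub (m8 s hs)).mono_exponent h48
      have h1 := lpNorm_sub_le (g := fun x => G t (shiftSeq l x) - G s (shiftSeq l x)) mm
        (by norm_num)
      rw [lpNorm_comp_measurePreserving (f := fun x => G t x - G s x) (hsh l) mm.1] at h1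
      rw [e]
      linarith [n4 t ht s hs]
    have hplus : lpNorm (fun x => lagDiff G l t x + lagDiff G l s x) 4 (iidLaw μ) ≤ 4 * |M| := by
      have h1 : lpNorm (fun x => lagDiff G l t x + lagDiff G l s x) 4 (iidLaw μ) ≤
          lpNorm (lagDiff G l t) 4 (iidLaw μ) + lpNorm (lagDiff G l s) 4 (iidLaw μ) :=
        lpNorm_add_le h4t (by norm_num)
      have h2 := (lpNorm_le_lpNorm_of_exponent_le h48 (d8 l t ht)).trans (nd8 l t ht)
      have h3 := (lpNorm_le_lpNorm_of_exponent_le h48 (d8 l s hs)).trans (nd8 l s hs)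
      linarith
    have hsq : lpNorm (fun x => lagDiff G l t x ^ 2 - lagDiff G l s x ^ 2) 2 (iidLaw μ) ≤
        8 * |C| * |M| * |t - s| := by
      have e : (fun x => lagDiff G l t x ^ 2 - lagDiff G l s x ^ 2) =
          fun x => (lagDiff G l t x - lagDiff G l s x) * (lagDiff G l t x + lagDiff G l s x) := by
        funext x; ring
      rw [e]
      refine (lpNorm_mul_le 2 (h4t.sub h4s) (h4t.add h4s)).trans
        ((mul_le_mul hminus hplus lpNorm_nonneg (by positivity)).trans_eq (by ring))
    have htr : |trend P ζ G l t - trend P ζ G l s| ≤ 8 * |C| * |M| * |t - s| := by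
      rw [trend_eq_integral hζ hGm hG ht, trend_eq_integral hζ hGm hG hs,
        ← integral_sub ((sq4 l t ht).integrable (by norm_num))
          ((sq4 l s hs).integrable (by norm_num))]
      exact (abs_integral_le_lpNorm_one _).trans
        ((lpNorm_le_lpNorm_of_exponent_le (by norm_num) (hdiff.mono_exponent h24)).trans hsq)
    have e : (fun x => errComp P ζ G h k a t x - errComp P ζ G h k a s x) =
        (fun x => lagDiff G l t x ^ 2 - lagDiff G l s x ^ 2) -
          fun _ => trend P ζ G l t - trend P ζ G l s := by
      funext x; simp only [errComp_eq, Pi.sub_apply, l]; ring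
    have h1 := lpNorm_sub_le (g := fun _ => trend P ζ G l t - trend P ζ G l s)
      (hdiff.mono_exponent h24) (by norm_num)
    have h2 : lpNorm (fun _ : ℕ → E => trend P ζ G l t - trend P ζ G l s) 2 (iidLaw μ) =
        |trend P ζ G l t - trend P ζ G l s| := by
      rw [lpNorm_const (by simp) (IsProbabilityMeasure.ne_zero _)]
      simp
    rw [e]
    linarith
  · unfold depBound
    split_ifs with hj
    -- The decay assumption starts at `j = 2`; for smaller `j` the triangle inequality gives twice
    -- the norm bound `8M²`.
    · have h1 : depNorm μ 4 (errComp P ζ G h k a t) j ≤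
          lpNorm (fun q : (ℕ → E) × (ℕ → E) => errComp P ζ G h k a t q.1) 4
            ((iidLaw μ).prod (iidLaw μ)) +
          lpNorm (fun q : (ℕ → E) × (ℕ → E) =>
            errComp P ζ G h k a t (Function.update q.1 j (q.2 j))) 4
            ((iidLaw μ).prod (iidLaw μ)) :=
        lpNorm_sub_le (memLp_fst (mem4 a t ht)) (by norm_num)
      rw [lpNorm_comp_measurePreserving measurePreserving_fst (mem4 a t ht).1,
        lpNorm_comp_measurePreserving (measurePreserving_updateAt μ j) (mem4 a t ht).1] at h1
      linarith [norm4 a t ht]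
    · refine lpNorm_le_of_eLpNorm_le (by positivity) ?_
      have hmeas : Measurable fun q : (ℕ → E) × (ℕ → E) => errComp P ζ G h k a t q.1 -
          errComp P ζ G h k a t (Function.update q.1 j (q.2 j)) :=
        ((meas a t ht).comp measurable_fst).sub ((meas a t ht).comp (measurable_updateAt j))
      rw [← eLpNorm_comp_measurePreserving hmeas.aestronglyMeasurable ((hp j).prod (hp j))]
      have h1 : eLpNorm (fun p : Ω × Ω => errFilter₂ P ζ G h k t (past ζ j p.1) -
          errFilter₂ P ζ G h k t (coupledPast ζ j p)) 4 (P.prod P) ≤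
          physDep P ζ 4 (errFilter₂ P ζ G h k) j := by
        unfold physDep
        exact le_iSup₂ (f := fun t (_ : t ∈ Set.Icc (0 : ℝ) 1) =>
          eLpNorm (fun p : Ω × Ω => errFilter₂ P ζ G h k t (past ζ j p.1) -
          errFilter₂ P ζ G h k t (coupledPast ζ j p)) 4 (P.prod P)) t ht
      refine le_trans (eLpNorm_mono fun p => ?_) (h1.trans ((hD j (by omega)).trans
        (ENNReal.ofReal_le_ofReal (by gcongr; exact le_abs_self D))))
      simp only [Function.comp, Prod.map]
      rw [← coupledPast_eq_update ζ j p]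
      exact PiLp.norm_apply_le (errFilter₂ P ζ G h k t (past ζ j p.1) -
          errFilter₂ P ζ G h k t (coupledPast ζ j p)) a

/-- Shifting `past ζ p` by `p` and by `p'` yields the information sets at times `0` and `p - p'`;
the filters are centred, so the covariance is the mean product. -/
theorem isCrossCov_crossCov (hζ : IsIID P ζ) {h k : ℕ} {Λ : ℝ} {δ : ℕ → ℝ}
    (hL : FilterBounds (P.map (ζ 0)) (errComp P ζ G h k) Λ δ) :
    IsCrossCov (P.map (ζ 0)) (errComp P ζ G h k) (crossCov P ζ G h k) := by
  intro t ht a b p p'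
  have hp := hζ.measurePreserving_past
  have m2 : ∀ a, MemLp (errComp P ζ G h k a t) 2 (iidLaw (P.map (ζ 0))) := fun a =>
    (hL.memLp a t ht).mono_exponent (by norm_num)
  have hz : ∀ a i, ∫ ω, errComp P ζ G h k a t (past ζ i ω) ∂P = 0 := fun a i => by
    rw [integral_comp_measurePreserving (hp i) (m2 a).1, hL.mean a t ht]
  have mP : ∀ a i, MemLp (fun ω => errComp P ζ G h k a t (past ζ i ω)) 2 P := fun a i =>
    (m2 a).comp_measurePreserving (hp i)
  have h1 : crossCov P ζ G h k t a b ((p : ℤ) - p') =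
      ∫ ω, errComp P ζ G h k a t (past ζ 0 ω) * errComp P ζ G h k b t (past ζ ((p : ℤ) - p') ω) ∂P := by
    have := covariance_eq_sub (mP a 0) (mP b ((p : ℤ) - p'))
    rw [hz, zero_mul, sub_zero] at this
    exact this
  rw [h1, ← integral_comp_measurePreserving (f := fun x => errComp P ζ G h k a t (shiftSeq p x) *
    errComp P ζ G h k b t (shiftSeq p' x)) (hp p)
    ((hL.meas_shift a ht p).mul (hL.meas_shift b ht p')).aestronglyMeasurable]
  simp only [shiftSeq_past, sub_self]

end Transfer

/-! ### Measurability of suprema over time. -/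

section Measurability

/-- Suprema of measurable functions that depend continuously on a parameter in a second countable
space are measurable, even if the parameter set is uncountable. -/
theorem measurable_biSup_of_continuous {ι D Ω : Type*} [MeasurableSpace Ω] [TopologicalSpace D]
    [SecondCountableTopology D] {φ : D → Ω → ℝ≥0∞} (hm : ∀ d, Measurable (φ d))
    (hc : ∀ ω, Continuous fun d => φ d ω) (g : ι → D) (s : Set ι) :
    Measurable fun ω => ⨆ t ∈ s, φ (g t) ω := by
  obtain ⟨c, hcc, hcd⟩ := TopologicalSpace.exists_countable_dense (g '' s)
  have e : (fun ω => ⨆ t ∈ s, φ (g t) ω) = fun ω => ⨆ d ∈ c, φ (d : D) ω := by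
    funext ω
    refine le_antisymm (iSup₂_le fun t ht => ?_) (iSup₂_le fun d _ => ?_)
    · have hcl : IsClosed {d : g '' s | φ (d : D) ω ≤ ⨆ d ∈ c, φ (d : D) ω} :=
        isClosed_le ((hc ω).comp continuous_subtype_val) continuous_const
      have hsub : c ⊆ {d : g '' s | φ (d : D) ω ≤ ⨆ d ∈ c, φ (d : D) ω} := fun d hd =>
        le_iSup₂ (f := fun (d : g '' s) (_ : d ∈ c) => φ (d : D) ω) d hd
      have := hcl.closure_subset_iff.2 hsub (hcd ⟨g t, t, ht, rfl⟩)
      exact this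
    · obtain ⟨⟨_, t, ht, rfl⟩, h⟩ : ∃ d' : g '' s, d' = d := ⟨d, rfl⟩
      rw [← h]
      exact le_iSup₂ (f := fun t (_ : t ∈ s) => φ (g t) ω) t ht
  rw [e]
  exact Measurable.biSup c hcc fun d _ => hm d

end Measurability

/-! ### The Frobenius norm. -/

section Frobenius

theorem frob_nonneg (A : Matrix (Fin 2) (Fin 2) ℝ) : 0 ≤ frob A := Real.sqrt_nonneg _

theorem frob_le_sum_abs (A : Matrix (Fin 2) (Fin 2) ℝ) : frob A ≤ ∑ a, ∑ b, |A a b| := by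
  refine Real.sqrt_le_iff.2 ⟨by positivity, ?_⟩
  simp only [Fin.sum_univ_two]
  rw [← sq_abs (A 0 0), ← sq_abs (A 0 1), ← sq_abs (A 1 0), ← sq_abs (A 1 1)]
  have h1 := abs_nonneg (A 0 0)
  have h2 := abs_nonneg (A 0 1)
  have h3 := abs_nonneg (A 1 0)
  have h4 := abs_nonneg (A 1 1)
  nlinarith [mul_nonneg h1 h2, mul_nonneg h1 h3, mul_nonneg h1 h4, mul_nonneg h2 h3,
    mul_nonneg h2 h4, mul_nonneg h3 h4]

theorem continuous_frob : Continuous frob := by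
  unfold frob
  fun_prop

end Frobenius

/-! ### From entries to the matrix norm in `L²`. -/

section L2

/-- A function dominated by a sum of four transferred `L²` functions and a constant. -/
theorem eLpNorm_two_le_of_entries {Ω X F : Type*} [MeasurableSpace Ω] [MeasurableSpace X]
    [ENorm F] {P : Measure Ω} [IsProbabilityMeasure P] {ν : Measure X} {T : Ω → X}
    (hT : MeasurePreserving T P ν) {Z : Fin 2 → Fin 2 → X → ℝ} {S c : ℝ} (hc : 0 ≤ c)
    (hZ : ∀ a b, MemLp (Z a b) 2 ν ∧ lpNorm (Z a b) 2 ν ≤ S) {f : Ω → F}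
    (hf : ∀ ω, ‖f ω‖ₑ ≤ ENNReal.ofReal (∑ a, ∑ b, (Z a b (T ω) + c))) :
    eLpNorm f 2 P ≤ ENNReal.ofReal (4 * (S + c)) := by
  have hS : 0 ≤ S := lpNorm_nonneg.trans (hZ 0 0).2
  have hm : ∀ a b, AEStronglyMeasurable (fun ω => Z a b (T ω) + c) P := fun a b =>
    ((hZ a b).1.comp_measurePreserving hT).1.add aestronglyMeasurable_const
  have hone : ∀ a b, eLpNorm (fun ω => Z a b (T ω) + c) 2 P ≤ ENNReal.ofReal (S + c) := by
    intro a b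
    have hZm := (hZ a b).1.comp_measurePreserving hT
    refine (eLpNorm_add_le hZm.1 aestronglyMeasurable_const (by norm_num)).trans ?_
    rw [ENNReal.ofReal_add hS hc]
    refine add_le_add ?_ ?_
    · have := eLpNorm_comp_measurePreserving (p := 2) (hZ a b).1.1 hT
      rw [this]
      exact eLpNorm_le_of_lpNorm_le (hZ a b).1 (hZ a b).2
    · rw [eLpNorm_const c (by norm_num) (IsProbabilityMeasure.ne_zero P)]
      simp [Real.enorm_eq_ofReal hc]
  calc eLpNorm f 2 P ≤ eLpNorm (fun ω => ∑ a, ∑ b, (Z a b (T ω) + c)) 2 P :=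
        eLpNorm_mono_enorm fun ω => (hf ω).trans (Real.ofReal_le_enorm _)
    _ = eLpNorm (∑ a : Fin 2, ∑ b : Fin 2, fun ω => (Z a b (T ω) + c)) 2 P := by
        congr 1
    _ ≤ ∑ a : Fin 2, eLpNorm (∑ b : Fin 2, fun ω => (Z a b (T ω) + c)) 2 P :=
        eLpNorm_sum_le (fun a _ => Finset.aestronglyMeasurable_sum _ fun b _ => hm a b)
          (by norm_num)
    _ ≤ ∑ a : Fin 2, ∑ b : Fin 2, eLpNorm (fun ω => (Z a b (T ω) + c)) 2 P :=
        Finset.sum_le_sum fun a _ => eLpNorm_sum_le (fun b _ => hm a b) (by norm_num)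
    _ ≤ ∑ a : Fin 2, ∑ b : Fin 2, ENNReal.ofReal (S + c) :=
        Finset.sum_le_sum fun a _ => Finset.sum_le_sum fun b _ => hone a b
    _ = _ := by
        simp only [Finset.sum_const, Finset.card_univ, Fintype.card_fin]
        rw [ENNReal.ofReal_mul (by norm_num), smul_smul, nsmul_eq_mul]
        norm_num

end L2

/-! ### Consequences of the growth of `m`. -/

section Rates

/-- From `m³ ≤ c³ n` one gets `m²/n ≤ c³/m`, and `√(2m + 1) ≤ 2m` suffices to absorb the cost of
freezing time into `1/m`. -/
theorem eventually_block_rates {m : ℕ → ℕ} (hm : Tendsto m atTop atTop)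
    (hmO : (fun n => (m n : ℝ)) =O[atTop] fun n : ℕ => (n : ℝ) ^ (1 / 3 : ℝ)) :
    (∃ c : ℝ, 0 ≤ c ∧ ∀ᶠ n : ℕ in atTop, 1 ≤ m n ∧ m n ≤ n ∧
      √(2 * (m n : ℝ) + 1) * ((m n : ℝ) / n) ≤ c / m n) ∧
    Tendsto (fun n : ℕ => (m n : ℝ) / n) atTop (nhds 0) := by
  obtain ⟨c, hc0, hc⟩ := hmO.exists_nonneg
  have hmr : Tendsto (fun n => (m n : ℝ)) atTop atTop := tendsto_natCast_atTop_atTop.comp hm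
  have hcube : ∀ᶠ n : ℕ in atTop, 1 ≤ m n ∧ (0 : ℝ) < n ∧ (m n : ℝ) ^ 3 ≤ c ^ 3 * n := by
    filter_upwards [hc.bound, hm.eventually_ge_atTop 1, eventually_gt_atTop 0] with n h1 h2 h3
    refine ⟨h2, by exact_mod_cast h3, ?_⟩
    have hn : (0 : ℝ) ≤ n := n.cast_nonneg
    rw [Real.norm_of_nonneg (by positivity), Real.norm_of_nonneg (by positivity)] at h1
    calc (m n : ℝ) ^ 3 ≤ (c * (n : ℝ) ^ (1 / 3 : ℝ)) ^ 3 := by gcongr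
      _ = c ^ 3 * n := by
        rw [mul_pow, ← Real.rpow_natCast ((n : ℝ) ^ (1 / 3 : ℝ)), ← Real.rpow_mul hn]
        norm_num
  have hsq : ∀ᶠ n : ℕ in atTop, (m n : ℝ) / n * m n ≤ c ^ 3 / m n := by
    filter_upwards [hcube] with n ⟨h1, h2, h3⟩
    have h1' : (1 : ℝ) ≤ m n := by exact_mod_cast h1
    rw [le_div_iff₀ (by positivity), div_mul_eq_mul_div, div_mul_eq_mul_div, div_le_iff₀ h2]
    linarith [h3, show (m n : ℝ) * m n * m n = (m n : ℝ) ^ 3 by ring]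
  have hz : Tendsto (fun n : ℕ => (m n : ℝ) / n) atTop (nhds 0) := by
    have h0 : Tendsto (fun n => c ^ 3 / (m n : ℝ)) atTop (nhds 0) :=
      tendsto_const_nhds.div_atTop hmr
    refine squeeze_zero' (Eventually.of_forall fun n => by positivity) ?_ h0
    filter_upwards [hsq, hcube] with n h ⟨h1, h2, _⟩
    have h1' : (1 : ℝ) ≤ m n := by exact_mod_cast h1
    have : 0 ≤ (m n : ℝ) / n := by positivity
    nlinarith
  refine ⟨⟨2 * c ^ 3, by positivity, ?_⟩, hz⟩
  filter_upwards [hcube, hsq, hz.eventually (eventually_le_nhds (zero_lt_one' ℝ))]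
    with n ⟨h1, h2, _⟩ h4 h5
  have h1' : (1 : ℝ) ≤ m n := by exact_mod_cast h1
  refine ⟨h1, ?_, ?_⟩
  · rw [div_le_one h2] at h5; exact_mod_cast h5
  · have hs : √(2 * (m n : ℝ) + 1) ≤ 2 * m n :=
      Real.sqrt_le_iff.2 ⟨by positivity, by nlinarith⟩
    calc √(2 * (m n : ℝ) + 1) * ((m n : ℝ) / n) ≤ 2 * m n * ((m n : ℝ) / n) := by gcongr
      _ = 2 * ((m n : ℝ) / n * m n) := by ring
      _ ≤ 2 * (c ^ 3 / m n) := by gcongr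
      _ = _ := by ring

theorem sqrt_two_mul_add_one_le {m : ℕ} (hm : 1 ≤ m) : √(2 * (m : ℝ) + 1) ≤ 2 * √(m : ℝ) := by
  have h1' : (1 : ℝ) ≤ m := by exact_mod_cast hm
  refine Real.sqrt_le_iff.2 ⟨by positivity, ?_⟩
  rw [mul_pow, Real.sq_sqrt (by positivity)]
  linarith

end Rates

/-! ### Bias of the estimator. -/

section Bias

variable {E : Type*} [MeasurableSpace E] {μ : Measure E} [IsProbabilityMeasure μ]
variable {L : Fin 2 → ℝ → (ℕ → E) → ℝ} {Λ : ℝ} {δ : ℕ → ℝ} {γ : ℝ → Fin 2 → Fin 2 → ℤ → ℝ}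

/-- The indices whose blocks are cut off at the ends of the sample. -/
def truncated (n m : ℕ) : Finset ℕ := {i ∈ Finset.Icc 1 n | ¬(m < i ∧ i + m ≤ n)}

theorem card_truncated_le (n m : ℕ) : (truncated n m).card ≤ 2 * m := by
  have h : truncated n m ⊆ Finset.Icc 1 m ∪ Finset.Ioc (n - m) n := by
    intro i hi
    simp only [truncated, Finset.mem_filter, Finset.mem_Icc, Finset.mem_union,
      Finset.mem_Ioc] at hi ⊢
    omega
  refine (Finset.card_le_card h).trans ((Finset.card_union_le _ _).trans ?_)
  simp only [Nat.card_Icc, Nat.card_Ioc]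
  omega

/-- The block means are replaced by the long-run covariance at `i/n`, accurately for full blocks and
crudely for cut-off ones, whose total weight stays as a separate term; the smoothing bias is added.
-/
theorem FilterBounds.abs_bias_le (hL : FilterBounds μ L Λ δ) (hγ : IsCrossCov μ L γ)
    (o : Fin 2 → ℕ) (a b : Fin 2) {K : ℝ → ℝ} {B : ℝ} {n m : ℕ} {τ t : ℝ}
    (hw : WeightBounds K B n τ t) (ht : t ∈ Set.Icc (0 : ℝ) 1) {g' : ℝ → ℝ} {M : ℝ}
    (hM : ∀ t ∈ Set.Icc (0 : ℝ) 1, |g' t| ≤ M)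
    (hg : ∀ t ∈ Set.Icc (0 : ℝ) 1, ∀ s ∈ Set.Icc (0 : ℝ) 1,
        |(∑' j, γ s a b j) - (∑' j, γ t a b j) - g' t * (s - t)| ≤ M * (s - t) ^ 2) :
    |∑ i ∈ Finset.Icc 1 n, weight K n τ t i * ∫ y, blockProd L o n m i a b y ∂(iidLaw μ) -
        ∑' j, γ t a b j| ≤
      4 * (∑' v, extZ δ v) * Λ * (√(2 * (m : ℝ) + 1) * (m / n)) +
        (1 + |((o a : ℤ) - o b : ℝ)|) * (∑' j : ℤ, (1 + |(j : ℝ)|) * covBound δ j) /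
          (2 * (m : ℝ) + 1) + M * (B / n) + M * τ ^ 2 +
        (4 * (∑' v, extZ δ v) ^ 2 + ∑' j : ℤ, (1 + |(j : ℝ)|) * covBound δ j) *
          ∑ i ∈ truncated n m, weight K n τ t i := by
  set A := ∑' v, extZ δ v
  set D := ∑' j : ℤ, (1 + |(j : ℝ)|) * covBound δ j
  set g : ℝ → ℝ := fun s => ∑' j, γ s a b j with hgdef
  set X : ℕ → ℝ := fun i => ∫ y, blockProd L o n m i a b y ∂(iidLaw μ) with hX
  set C1 := 4 * A * Λ * (√(2 * (m : ℝ) + 1) * (m / n)) +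
        (1 + |((o a : ℤ) - o b : ℝ)|) * D / (2 * (m : ℝ) + 1) with hC1
  have hD : 0 ≤ D := (abs_nonneg _).trans (hL.abs_tsum_crossCov_le hγ ht a b)
  have hA : 0 ≤ A := tsum_nonneg fun v => extZ_nonneg hL.nonneg v
  have hC10 : 0 ≤ C1 := by
    have := hL.lip_nonneg
    positivity
  have hone : ∀ i ∈ Finset.Icc 1 n, |X i - g ((i : ℝ) / n)| ≤
      C1 + if ¬(m < i ∧ i + m ≤ n) then 4 * A ^ 2 + D else 0 := by
    intro i hi
    have hi' := Finset.mem_Icc.1 hi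
    by_cases hgood : m < i ∧ i + m ≤ n
    · simp only [hgood, and_self, not_true, if_false, add_zero]
      exact hL.abs_integral_blockProd_sub_le hγ o hgood.1 hgood.2 a b
    · rw [if_pos hgood]
      have hn : (0 : ℝ) < n := by exact_mod_cast (by omega : 0 < n)
      have hs : (i : ℝ) / n ∈ Set.Icc (0 : ℝ) 1 :=
        ⟨by positivity, (div_le_one hn).2 (by exact_mod_cast hi'.2)⟩
      have h1 := hL.abs_integral_blockProd_le o n m i a b
      have h2 := hL.abs_tsum_crossCov_le hγ hs a b
      have h3 := abs_sub (X i) (g ((i : ℝ) / n))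
      linarith
  have e : ∑ i ∈ Finset.Icc 1 n, weight K n τ t i * X i - g t =
      ∑ i ∈ Finset.Icc 1 n, weight K n τ t i * (X i - g ((i : ℝ) / n)) +
      (∑ i ∈ Finset.Icc 1 n, weight K n τ t i * g ((i : ℝ) / n) - g t) := by
    simp only [mul_sub, Finset.sum_sub_distrib]; ring
  have h2 := hw.abs_sum_sub_le ht hM hg
  have h1 : |∑ i ∈ Finset.Icc 1 n, weight K n τ t i * (X i - g ((i : ℝ) / n))| ≤
      C1 + (4 * A ^ 2 + D) * ∑ i ∈ truncated n m, weight K n τ t i := by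
    calc |∑ i ∈ Finset.Icc 1 n, weight K n τ t i * (X i - g ((i : ℝ) / n))|
        ≤ ∑ i ∈ Finset.Icc 1 n, |weight K n τ t i * (X i - g ((i : ℝ) / n))| :=
          Finset.abs_sum_le_sum_abs _ _
      _ ≤ ∑ i ∈ Finset.Icc 1 n, weight K n τ t i *
            (C1 + if ¬(m < i ∧ i + m ≤ n) then 4 * A ^ 2 + D else 0) :=
          Finset.sum_le_sum fun i hi => by
            rw [abs_mul, abs_of_nonneg (hw.nonneg i)]
            exact mul_le_mul_of_nonneg_left (hone i hi) (hw.nonneg i)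
      _ = _ := by
          simp only [mul_add, Finset.sum_add_distrib, mul_ite, mul_zero]
          rw [← Finset.sum_mul, hw.sum_eq_one, one_mul, ← Finset.sum_filter, Finset.mul_sum]
          congr 1
          simp only [← mul_add]
          exact Finset.sum_congr rfl fun i _ => mul_comm _ _
  rw [e]
  refine (abs_add_le _ _).trans ?_
  linarith

/-- The bias of the estimator, up to the weight of the truncated blocks. -/
theorem FilterBounds.exists_bias_bound (hL : FilterBounds μ L Λ δ) (hγ : IsCrossCov μ L γ)
    (o : Fin 2 → ℕ) {B c : ℝ} (hB : 0 ≤ B) (hc : 0 ≤ c) (K : ℝ → ℝ)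
    (hS : ∀ a b, ContDiffOn ℝ 2 (fun t => ∑' j, γ t a b j) (Set.Icc (0 : ℝ) 1)) :
    ∃ C, 0 ≤ C ∧ ∀ (n m : ℕ) (τ t : ℝ), 1 ≤ m → m ≤ n →
      √(2 * (m : ℝ) + 1) * ((m : ℝ) / n) ≤ c / m → t ∈ Set.Icc (0 : ℝ) 1 →
      WeightBounds K B n τ t → ∀ a b,
      |∑ i ∈ Finset.Icc 1 n, weight K n τ t i * ∫ y, blockProd L o n m i a b y ∂(iidLaw μ) -
        ∑' j, γ t a b j| ≤ C * (1 / m + τ ^ 2 + ∑ i ∈ truncated n m, weight K n τ t i) := by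
  choose M hM0 g' hM hg using fun a b => exists_taylor_bound (hS a b)
  set A := ∑' v, extZ δ v
  set D := ∑' j : ℤ, (1 + |(j : ℝ)|) * covBound δ j with hDdef
  have hD : 0 ≤ D := (abs_nonneg _).trans
    (hL.abs_tsum_crossCov_le hγ (t := 0) ⟨le_rfl, zero_le_one⟩ 0 0)
  have hA : 0 ≤ A := tsum_nonneg fun v => extZ_nonneg hL.nonneg v
  have hΛ := hL.lip_nonneg
  obtain ⟨O, hO⟩ := (Set.finite_range fun p : Fin 2 × Fin 2 =>
    (1 + |((o p.1 : ℤ) - o p.2 : ℝ)|)).bddAbove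
  obtain ⟨N, hN⟩ := (Set.finite_range fun p : Fin 2 × Fin 2 => M p.1 p.2).bddAbove
  have hO' : ∀ a b, 1 + |((o a : ℤ) - o b : ℝ)| ≤ O := fun a b => hO ⟨(a, b), rfl⟩
  have hN' : ∀ a b, M a b ≤ N := fun a b => hN ⟨(a, b), rfl⟩
  have hO0 : 0 ≤ O := (by positivity : (0 : ℝ) ≤ _).trans (hO' 0 0)
  have hN0 : 0 ≤ N := (hM0 0 0).trans (hN' 0 0)
  refine ⟨4 * A * Λ * c + O * D + N * B + N + (4 * A ^ 2 + D), by positivity,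
    fun n m τ t hm hmn hr ht hw a b => ?_⟩
  have hm' : (0 : ℝ) < m := by exact_mod_cast hm
  have hn' : (m : ℝ) ≤ n := by exact_mod_cast hmn
  set T := ∑ i ∈ truncated n m, weight K n τ t i
  have hT : 0 ≤ T := Finset.sum_nonneg fun i _ => hw.nonneg i
  refine (hL.abs_bias_le hγ o a b hw ht (hM a b) (hg a b)).trans ?_
  have h1 : 4 * A * Λ * (√(2 * (m : ℝ) + 1) * (m / n)) ≤ 4 * A * Λ * c * (1 / m) := by
    calc _ ≤ 4 * A * Λ * (c / m) := by gcongr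
      _ = _ := by ring
  have h2 : (1 + |((o a : ℤ) - o b : ℝ)|) * D / (2 * (m : ℝ) + 1) ≤ O * D * (1 / m) := by
    calc _ ≤ O * D / m := by
          gcongr
          · exact hO' a b
          · linarith
      _ = _ := by ring
  have h3 : M a b * (B / n) ≤ N * B * (1 / m) := by
    calc _ ≤ N * (B / m) := by
          have := hM0 a b
          gcongr
          exact hN' a b
      _ = _ := by ring
  have h4 : M a b * τ ^ 2 ≤ N * τ ^ 2 := by
    gcongr
    exact hN' a b
  have e : ∀ x y z w v p q r : ℝ, 0 ≤ x → 0 ≤ y → 0 ≤ z → 0 ≤ w → 0 ≤ v → 0 ≤ p → 0 ≤ q → 0 ≤ r →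
      x * p + y * p + z * p + w * q + v * r ≤ (x + y + z + w + v) * (p + q + r) := by
    intro x y z w v p q r _ _ _ _ _ _ _ _
    have : 0 ≤ x * (q + r) + y * (q + r) + z * (q + r) + w * (p + r) + v * (p + q) := by
      positivity
    nlinarith
  have := e (4 * A * Λ * c) (O * D) (N * B) N (4 * A ^ 2 + D) (1 / m) (τ ^ 2) T
    (by positivity) (by positivity) (by positivity) hN0 (by positivity) (by positivity)
    (by positivity) hT
  linarith

end Bias

/-! ### Estimation error at one time and uniformly in time. -/

section Error

theorem sqrt_rate_pointwise {B x : ℝ} {m : ℕ} (hm : 1 ≤ m) (hB : 0 ≤ B) :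
    √(2 * (m : ℝ) + 1) * √(B / x) ≤ 2 * √B * √((m : ℝ) / x) := by
  rw [Real.sqrt_div hB, Real.sqrt_div m.cast_nonneg]
  calc _ ≤ 2 * √(m : ℝ) * (√B / √x) := by gcongr; exact sqrt_two_mul_add_one_le hm
    _ = _ := by ring

theorem sqrt_rate_uniform {τ : ℝ} {m n : ℕ} (hm : 1 ≤ m) (hn : 0 < n) (hτ : 0 < τ) :
    √(2 * (m : ℝ) + 1) * √(n : ℝ) / (n * τ) ≤ 2 * √((m : ℝ) / (n * τ ^ 2)) := by
  have hn' : (0 : ℝ) < n := by exact_mod_cast hn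
  have e : (m : ℝ) / (n * τ ^ 2) = m * n / (n * τ) ^ 2 := by field_simp
  rw [e, Real.sqrt_div (by positivity), Real.sqrt_mul (by positivity),
    Real.sqrt_sq (by positivity)]
  calc _ ≤ 2 * √(m : ℝ) * √(n : ℝ) / (n * τ) := by gcongr; exact sqrt_two_mul_add_one_le hm
    _ = _ := by ring

/-- Squared, this is `m² ≤ mn`. It hides the weight of the cut-off blocks in the uniform rate. -/
theorem div_le_sqrt_rate_uniform {τ : ℝ} {m n : ℕ} (hmn : m ≤ n) (hn : 0 < n) (hτ : 0 < τ) :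
    (m : ℝ) / (n * τ) ≤ √((m : ℝ) / (n * τ ^ 2)) := by
  have hn' : (0 : ℝ) < n := by exact_mod_cast hn
  have hmn' : (m : ℝ) ≤ n := by exact_mod_cast hmn
  refine Real.le_sqrt_of_sq_le ?_
  have e : (m : ℝ) / (n * τ ^ 2) = m * n / (n * τ) ^ 2 := by field_simp
  rw [e, div_pow, sq (m : ℝ)]
  gcongr

variable {Ω E : Type*} [MeasurableSpace Ω] [MeasurableSpace E] {P : Measure Ω}
  {ζ : ℤ → Ω → E} [IsProbabilityMeasure (P.map (ζ 0))]
  {G : ℝ → (ℕ → E) → ℝ} {h k : ℕ} {Λ : ℝ} {δ : ℕ → ℝ} {K : ℝ → ℝ} {B : ℝ} {n m : ℕ} {τ t : ℝ}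

theorem measurable_blockMat (hζ : IsIID P ζ) (hkh : k < h)
    (hL : FilterBounds (P.map (ζ 0)) (errComp P ζ G h k) Λ δ) (n m i : ℕ) (a b : Fin 2) :
    Measurable fun ω => blockMat P ζ G h k n m i ω a b := by
  have e : (fun ω => blockMat P ζ G h k n m i ω a b) = fun ω =>
      blockProd (errComp P ζ G h k) ![0, h - k] n m i a b (past ζ (n + h) ω) := by
    funext ω
    simp only [Matrix.smul_apply, smul_eq_mul, blockMat, Matrix.vecMulVec_apply,
      blockSum_apply hkh, blockProd]
  rw [e]
  exact (hL.measurable_blockProd _ n m i a b).comp (hζ.measurePreserving_past _).measurable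

theorem measurable_frob_sub (hζ : IsIID P ζ) (hkh : k < h)
    (hL : FilterBounds (P.map (ζ 0)) (errComp P ζ G h k) Λ δ) (n m : ℕ)
    (v : ℕ → ℝ) (σ : Matrix (Fin 2) (Fin 2) ℝ) :
    Measurable fun ω => frob
      (∑ i ∈ Finset.Icc 1 n, v i • blockMat P ζ G h k n m i ω - σ) := by
  unfold frob
  simp only [Matrix.sub_apply, Matrix.sum_apply, Matrix.smul_apply, smul_eq_mul]
  refine Measurable.sqrt (Finset.measurable_sum _ fun a _ => Finset.measurable_sum _ fun b _ =>
    Measurable.pow_const (Measurable.sub_const (Finset.measurable_sum _ fun i _ => ?_) _) _)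
  exact (measurable_blockMat hζ hkh hL n m i a b).const_mul _

/-- A kernel of bounded variation may jump, so the error need not be continuous in `t`. It is
continuous in the pair of weights and target matrix, which ranges over a second countable space. -/
theorem measurable_iSup_frob_error (hζ : IsIID P ζ) (hkh : k < h)
    (hL : FilterBounds (P.map (ζ 0)) (errComp P ζ G h k) Λ δ) (K : ℝ → ℝ) (n m : ℕ) (τ : ℝ)
    (s : Set ℝ) :
    Measurable fun ω => ⨆ t ∈ s, ENNReal.ofReal
      (frob (estimator P ζ G h k K n m τ t ω - longRunCov P ζ G h k t)) := by
  let φ : (ℕ → ℝ) × (Fin 2 → Fin 2 → ℝ) → Ω → ℝ≥0∞ := fun d ω => ENNReal.ofReal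
    (frob (∑ i ∈ Finset.Icc 1 n, d.1 i • blockMat P ζ G h k n m i ω - Matrix.of d.2))
  refine measurable_biSup_of_continuous (φ := φ)
    (fun d => (measurable_frob_sub hζ hkh hL n m d.1 _).ennreal_ofReal) (fun ω => ?_)
    (fun t => (weight K n τ t, longRunCov P ζ G h k t)) s
  refine ENNReal.continuous_ofReal.comp (continuous_frob.comp (Continuous.sub ?_ ?_))
  · exact continuous_finsetSum _ fun i _ =>
      ((continuous_apply i).comp continuous_fst).smul continuous_const
  · exact continuous_snd

/-- Splitting an entry of the estimation error into fluctuation and bias. -/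
theorem abs_estimator_sub_le (hkh : k < h) (K : ℝ → ℝ) (n m : ℕ) (τ t : ℝ) (ω : Ω) (a b : Fin 2)
    (s : ℝ) :
    |estimator P ζ G h k K n m τ t ω a b - s| ≤
      |∑ i ∈ Finset.Icc 1 n, weight K n τ t i *
        (blockProd (errComp P ζ G h k) ![0, h - k] n m i a b (past ζ (n + h) ω) -
          ∫ y, blockProd (errComp P ζ G h k) ![0, h - k] n m i a b y
            ∂(iidLaw (P.map (ζ 0))))| +
      |∑ i ∈ Finset.Icc 1 n, weight K n τ t i *
          ∫ y, blockProd (errComp P ζ G h k) ![0, h - k] n m i a b y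
            ∂(iidLaw (P.map (ζ 0))) - s| := by
  refine le_trans (le_of_eq ?_) (abs_add_le _ _)
  rw [estimator_apply hkh]
  simp only [mul_sub, Finset.sum_sub_distrib]
  congr 1
  ring

variable [IsProbabilityMeasure P]

/-- The weighted sum is the last partial sum in the running maximum, so the maximal inequality
applies with the kernel weights themselves. -/
theorem eLpNorm_frob_error_le (hζ : IsIID P ζ) (hkh : k < h)
    (hL : FilterBounds (P.map (ζ 0)) (errComp P ζ G h k) Λ δ) (hB : 0 ≤ B)
    (hw : WeightBounds K B n τ t) (hm : 1 ≤ m) {β : ℝ} (hβ : 0 ≤ β)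
    (hbias : ∀ a b, |∑ i ∈ Finset.Icc 1 n, weight K n τ t i *
          ∫ y, blockProd (errComp P ζ G h k) ![0, h - k] n m i a b y
            ∂(iidLaw (P.map (ζ 0))) - longRunCov P ζ G h k t a b| ≤ β) :
    eLpNorm (fun ω => frob (estimator P ζ G h k K n m τ t ω - longRunCov P ζ G h k t)) 2 P ≤
      ENNReal.ofReal (4 * (48 * (∑' v, extZ δ v) ^ 2 * √B * √((m : ℝ) / (n * τ)) + β)) := by
  set A := ∑' v, extZ δ v
  refine eLpNorm_two_le_of_entries (hζ.measurePreserving_past (n + h)) hβ (fun a b => ?_)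
    (Z := fun a b x => runMax (fun j => |∑ q ∈ Finset.range j, weight K n τ t (n - q) *
      (blockProd (errComp P ζ G h k) ![0, h - k] n m (n - q) a b x -
        ∫ y, blockProd (errComp P ζ G h k) ![0, h - k] n m (n - q) a b y
          ∂(iidLaw (P.map (ζ 0))))|) n) (fun ω => ?_)
  · obtain ⟨h1, h2⟩ := hL.lpNorm_runMax_blockProd_le ![0, h - k] n m a b hw.nonneg
    refine ⟨h1, h2.trans ?_⟩
    rw [← sum_Icc_one_eq_sum_reverse (fun i => weight K n τ t i ^ 2)]
    calc _ ≤ 24 * A ^ 2 * √(2 * (m : ℝ) + 1) * √(B / (n * τ)) := by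
          gcongr
          exact hw.sum_sq_le
      _ = 24 * A ^ 2 * (√(2 * (m : ℝ) + 1) * √(B / (n * τ))) := by ring
      _ ≤ 24 * A ^ 2 * (2 * √B * √((m : ℝ) / (n * τ))) := by
          exact mul_le_mul_of_nonneg_left (sqrt_rate_pointwise hm hB) (by positivity)
      _ = _ := by ring
  · rw [Real.enorm_eq_ofReal (frob_nonneg _)]
    refine ENNReal.ofReal_le_ofReal ((frob_le_sum_abs _).trans
      (Finset.sum_le_sum fun a _ => Finset.sum_le_sum fun b _ => ?_))
    rw [Matrix.sub_apply]
    refine (abs_estimator_sub_le hkh K n m τ t ω a b _).trans (add_le_add ?_ (hbias a b))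
    rw [sum_Icc_one_eq_sum_reverse (fun i => weight K n τ t i *
        (blockProd (errComp P ζ G h k) ![0, h - k] n m i a b (past ζ (n + h) ω) -
          ∫ y, blockProd (errComp P ζ G h k) ![0, h - k] n m i a b y
            ∂(iidLaw (P.map (ζ 0)))))]
    exact le_runMax (fun j => |∑ q ∈ Finset.range j, weight K n τ t (n - q) *
      (blockProd (errComp P ζ G h k) ![0, h - k] n m (n - q) a b (past ζ (n + h) ω) -
        ∫ y, blockProd (errComp P ζ G h k) ![0, h - k] n m (n - q) a b y
          ∂(iidLaw (P.map (ζ 0))))|) le_rfl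

/-- The maximal inequality is used with unit weights: after summation by parts the running maximum
no longer depends on `t`, so the supremum is taken inside the norm. -/
theorem eLpNorm_iSup_frob_error_le (hζ : IsIID P ζ) (hkh : k < h)
    (hL : FilterBounds (P.map (ζ 0)) (errComp P ζ G h k) Λ δ) (hB : 0 ≤ B) {s : Set ℝ}
    (hw : ∀ t ∈ s, WeightBounds K B n τ t) (hm : 1 ≤ m) (hn : 0 < n) (hτ : 0 < τ)
    {β : ℝ} (hβ : 0 ≤ β)
    (hbias : ∀ t ∈ s, ∀ a b, |∑ i ∈ Finset.Icc 1 n, weight K n τ t i *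
          ∫ y, blockProd (errComp P ζ G h k) ![0, h - k] n m i a b y
            ∂(iidLaw (P.map (ζ 0))) - longRunCov P ζ G h k t a b| ≤ β) :
    eLpNorm (fun ω => ⨆ t ∈ s, ENNReal.ofReal
        (frob (estimator P ζ G h k K n m τ t ω - longRunCov P ζ G h k t))) 2 P ≤
      ENNReal.ofReal
        (4 * (96 * (∑' v, extZ δ v) ^ 2 * B * √((m : ℝ) / (n * τ ^ 2)) + β)) := by
  set A := ∑' v, extZ δ v
  have hn' : (0 : ℝ) < n := by exact_mod_cast hn
  refine eLpNorm_two_le_of_entries (hζ.measurePreserving_past (n + h)) hβ (fun a b => ?_)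
    (Z := fun a b x => 2 * (B / (n * τ)) * runMax (fun j => |∑ q ∈ Finset.range j, 1 *
      (blockProd (errComp P ζ G h k) ![0, h - k] n m (n - q) a b x -
        ∫ y, blockProd (errComp P ζ G h k) ![0, h - k] n m (n - q) a b y
          ∂(iidLaw (P.map (ζ 0))))|) n) (fun ω => ?_)
  · obtain ⟨h1, h2⟩ := hL.lpNorm_runMax_blockProd_le ![0, h - k] n m a b
      (w := fun _ => 1) (fun _ => zero_le_one)
    refine ⟨h1.const_mul _, ?_⟩
    rw [lpNorm_const_mul, abs_of_nonneg (by positivity)]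
    simp only [one_pow, Finset.sum_const, Finset.card_range, nsmul_eq_mul, mul_one] at h2
    calc _ ≤ 2 * (B / (n * τ)) * (24 * A ^ 2 * √(2 * (m : ℝ) + 1) * √(n : ℝ)) := by gcongr
      _ = 48 * A ^ 2 * B * (√(2 * (m : ℝ) + 1) * √(n : ℝ) / (n * τ)) := by ring
      _ ≤ 48 * A ^ 2 * B * (2 * √((m : ℝ) / (n * τ ^ 2))) := by
          exact mul_le_mul_of_nonneg_left (sqrt_rate_uniform hm hn hτ) (by positivity)
      _ = _ := by ring
  · rw [enorm_eq_self]
    refine iSup₂_le fun t ht => ENNReal.ofReal_le_ofReal ((frob_le_sum_abs _).trans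
      (Finset.sum_le_sum fun a _ => Finset.sum_le_sum fun b _ => ?_))
    rw [Matrix.sub_apply]
    refine (abs_estimator_sub_le hkh K n m τ t ω a b _).trans (add_le_add ?_ (hbias t ht a b))
    simp only [one_mul]
    exact (hw t ht).abs_sum_mul_le fun i =>
      blockProd (errComp P ζ G h k) ![0, h - k] n m i a b (past ζ (n + h) ω) -
          ∫ y, blockProd (errComp P ζ G h k) ![0, h - k] n m i a b y ∂(iidLaw (P.map (ζ 0)))

end Error

/-! ### Weight of the blocks cut off by the sample. -/

section TruncatedWeights

variable {K : ℝ → ℝ} {B : ℝ} {n m : ℕ} {τ t : ℝ}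

theorem WeightBounds.sum_truncated_le (hw : WeightBounds K B n τ t) (hB : 0 ≤ B) (hmn : m ≤ n)
    (hn : 0 < n) (hτ : 0 < τ) :
    ∑ i ∈ truncated n m, weight K n τ t i ≤ 2 * B * √((m : ℝ) / (n * τ ^ 2)) := by
  have hn' : (0 : ℝ) < n := by exact_mod_cast hn
  have hc : ((truncated n m).card : ℝ) ≤ 2 * m := by exact_mod_cast card_truncated_le n m
  calc ∑ i ∈ truncated n m, weight K n τ t i ≤ (truncated n m).card • (B / (n * τ)) :=
        Finset.sum_le_card_nsmul _ _ _ fun i _ => hw.le i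
    _ ≤ 2 * m * (B / (n * τ)) := by
        rw [nsmul_eq_mul]
        gcongr
    _ = 2 * B * (m / (n * τ)) := by ring
    _ ≤ _ := by
        gcongr
        exact div_le_sqrt_rate_uniform hmn hn hτ

/-- Cut-off blocks are centred within `m/n` of 0 or 1, while the weights live within `τ` of `t`. -/
theorem WeightBounds.sum_truncated_eq_zero (hw : WeightBounds K B n τ t) (hn : 0 < n)
    (h0 : τ + (m : ℝ) / n < t) (h1 : τ + (m : ℝ) / n < 1 - t) :
    ∑ i ∈ truncated n m, weight K n τ t i = 0 := by
  have hn' : (0 : ℝ) < n := by exact_mod_cast hn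
  refine Finset.sum_eq_zero fun i hi => ?_
  by_contra hne
  have hs := abs_le.1 (hw.support i hne)
  simp only [truncated, Finset.mem_filter, Finset.mem_Icc, not_and_or, not_lt, not_le] at hi
  rcases hi.2 with h | h
  · have : (i : ℝ) / n ≤ m / n := by gcongr
    linarith
  · have h' : (n : ℝ) ≤ i + m := by exact_mod_cast h.le
    have : 1 ≤ (i : ℝ) / n + m / n := by
      rw [← add_div, le_div_iff₀ hn']
      linarith
    linarith

end TruncatedWeights

end

end LocStat

/-! ### Assembly of the rates. -/

theorem theorem3 {Ω E : Type*} [MeasurableSpace Ω] [MeasurableSpace E]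
    (P : Measure Ω) [IsProbabilityMeasure P]
    (ζ : ℤ → Ω → E) (hζ : LocStat.IsIID P ζ)
    (G : ℝ → (ℕ → E) → ℝ) (hGm : ∀ t ∈ Set.Icc (0 : ℝ) 1, Measurable (G t))
    (hG : LocStat.IsStochLipschitz P ζ G)
    (K : ℝ → ℝ) (hK : LocStat.IsKernel K)
    (h k : ℕ) (hk : 1 ≤ k) (hkh : k < h)
    (hS : ∀ a b, ContDiffOn ℝ 2 (fun t => LocStat.longRunCov P ζ G h k t a b)
      (Set.Icc (0 : ℝ) 1))
    (hδ : ∃ C : ℝ, ∀ j : ℕ, 2 ≤ j →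
      LocStat.physDep P ζ 4 (LocStat.errFilter₂ P ζ G h k) j
        ≤ ENNReal.ofReal (C / ((j : ℝ) * Real.log j) ^ 2))
    (m : ℕ → ℕ) (hm : Tendsto m atTop atTop)
    (hmO : (fun n => (m n : ℝ)) =O[atTop] fun n : ℕ => (n : ℝ) ^ (1 / 3 : ℝ))
    (τ : ℕ → ℝ) (hτ : Tendsto τ atTop (nhds 0))
    (hnτ : Tendsto (fun n : ℕ => (n : ℝ) * τ n) atTop atTop) :
    -- the series defining the long-run covariance converges absolutely
    (∀ t ∈ Set.Icc (0 : ℝ) 1, ∀ a b, Summable (LocStat.crossCov P ζ G h k t a b)) ∧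
    -- (i) the error in `L²` at a fixed time
    (∀ t ∈ Set.Ioo (0 : ℝ) 1, ∃ C : ℝ, ∀ᶠ n : ℕ in atTop,
      AEMeasurable (fun ω => LocStat.frob
        (LocStat.estimator P ζ G h k K n (m n) (τ n) t ω - LocStat.longRunCov P ζ G h k t)) P ∧
      eLpNorm (fun ω => LocStat.frob
        (LocStat.estimator P ζ G h k K n (m n) (τ n) t ω - LocStat.longRunCov P ζ G h k t)) 2 P
        ≤ ENNReal.ofReal (C * (√((m n : ℝ) / (n * τ n)) + 1 / (m n : ℝ) + τ n ^ 2))) ∧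
    -- (ii) the `L²` norm of the largest error on `[τ, 1 - τ]`
    (∃ C : ℝ, ∀ᶠ n : ℕ in atTop,
      AEMeasurable (fun ω => ⨆ t ∈ Set.Icc (τ n) (1 - τ n), ENNReal.ofReal (LocStat.frob
        (LocStat.estimator P ζ G h k K n (m n) (τ n) t ω - LocStat.longRunCov P ζ G h k t))) P ∧
      eLpNorm (fun ω => ⨆ t ∈ Set.Icc (τ n) (1 - τ n), ENNReal.ofReal (LocStat.frob
        (LocStat.estimator P ζ G h k K n (m n) (τ n) t ω - LocStat.longRunCov P ζ G h k t))) 2 P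
        ≤ ENNReal.ofReal
          (C * (√((m n : ℝ) / (n * τ n ^ 2)) + 1 / (m n : ℝ) + τ n ^ 2))) := by
  have := hζ.isProbabilityMeasure_map
  obtain ⟨Λ, δ, hL⟩ := LocStat.filterBounds_errComp hζ hGm hG h k hδ
  have hγ := LocStat.isCrossCov_crossCov hζ hL
  obtain ⟨B, hB, hWB⟩ := hK.exists_weightBounds
  obtain ⟨⟨c, hc, hrates⟩, hmn0⟩ := LocStat.eventually_block_rates hm hmO
  obtain ⟨Cb, hCb, hbias⟩ := hL.exists_bias_bound hγ ![0, h - k] hB hc K hS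
  set A := ∑' v, LocStat.extZ δ v
  have hreg : ∀ᶠ n : ℕ in atTop, 0 < n ∧ 0 < τ n ∧ B ≤ n * τ n := by
    filter_upwards [hnτ.eventually_ge_atTop B, hnτ.eventually_gt_atTop 0, eventually_gt_atTop 0]
      with n h1 h2 h3
    exact ⟨h3, pos_of_mul_pos_right h2 n.cast_nonneg, h1⟩
  refine ⟨fun t ht a b => hL.summable_crossCov hγ ht a b, fun t ht => ?_, ?_⟩
  · have hτm : Tendsto (fun n => τ n + (m n : ℝ) / n) atTop (nhds 0) := by
      simpa using hτ.add hmn0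
    -- `192 = 4 · 48` stems from the fluctuation of the four entries, `4 * Cb` from their bias;
    -- cut-off blocks get no weight once `τ + m/n < min t (1 - t)`.
    refine ⟨192 * A ^ 2 * √B + 4 * Cb, ?_⟩
    filter_upwards [hrates, hreg, hτm.eventually (eventually_lt_nhds ht.1),
      hτm.eventually (eventually_lt_nhds (sub_pos.2 ht.2))]
      with n ⟨hm1, hmn, hr⟩ ⟨hn, hτ0, hBn⟩ h0 h1
    refine ⟨(LocStat.measurable_frob_sub hζ hkh hL n (m n) _ _).aemeasurable, ?_⟩
    have hmn' : 0 ≤ (m n : ℝ) / n := by positivity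
    have hw := hWB n (τ n) t hn hτ0 hBn ⟨by linarith, by linarith⟩
    have hb := hbias n (m n) (τ n) t hm1 hmn hr ⟨ht.1.le, ht.2.le⟩ hw
    rw [hw.sum_truncated_eq_zero hn h0 h1, add_zero] at hb
    refine (LocStat.eLpNorm_frob_error_le hζ hkh hL hB hw hm1 (by positivity) hb).trans
      (ENNReal.ofReal_le_ofReal ?_)
    have e1 : 0 ≤ 192 * A ^ 2 * √B * (1 / (m n : ℝ) + τ n ^ 2) := by positivity
    have e2 : 0 ≤ 4 * Cb * √((m n : ℝ) / (n * τ n)) := by positivity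
    linarith
  -- The summand `2 * B * Cb` accounts for the cut-off blocks, which matter near the ends of `[τ, 1
  -- - τ]`.
  · refine ⟨4 * (96 * A ^ 2 * B + 2 * B * Cb) + 4 * Cb, ?_⟩
    filter_upwards [hrates, hreg] with n ⟨hm1, hmn, hr⟩ ⟨hn, hτ0, hBn⟩
    refine ⟨(LocStat.measurable_iSup_frob_error hζ hkh hL K n (m n) (τ n) _).aemeasurable, ?_⟩
    have hw : ∀ t ∈ Set.Icc (τ n) (1 - τ n), LocStat.WeightBounds K B n (τ n) t :=
      fun t ht => hWB n (τ n) t hn hτ0 hBn ht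
    have hb : ∀ t ∈ Set.Icc (τ n) (1 - τ n), ∀ a b, _ ≤ Cb * (1 / (m n : ℝ) + τ n ^ 2 +
        2 * B * √((m n : ℝ) / (n * τ n ^ 2))) := fun t ht a b =>
      (hbias n (m n) (τ n) t hm1 hmn hr ⟨hτ0.le.trans ht.1, by linarith [ht.2]⟩
        (hw t ht) a b).trans (by
          gcongr
          exact (hw t ht).sum_truncated_le hB hmn hn hτ0)
    refine (LocStat.eLpNorm_iSup_frob_error_le hζ hkh hL hB hw hm1 hn hτ0 (by positivity)
      hb).trans (ENNReal.ofReal_le_ofReal ?_)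
    have e1 : 0 ≤ 4 * (96 * A ^ 2 * B + 2 * B * Cb) * (1 / (m n : ℝ) + τ n ^ 2) := by positivity
    have e2 : 0 ≤ 4 * Cb * √((m n : ℝ) / (n * τ n ^ 2)) := by positivity
    linarith
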